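/- **Theorem 4.1.** Conventions: all groups are discrete. A *$G$-CW-pair* $(X,A)$ is a $G$-CW-complex $X$ with a $G$-CW-subcomplex $A$; it is *proper* if all isotropy groups of $X$ are finite, and *finite* if $X$ has only finitely many equivariant cells. For a group homomorphism $\alpha\colon H\to G$ and an $H$-space $X$ let $\operatorname{ind}_\alpha X$ be the $G$-space $(G\times X)/\bigl((g\alpha(h),x)\sim(g,hx)\bigr)$. Let $R$ be a commutative ring. A *proper equivariant cohomology theory* $\mathcal H^*_?$ with values in $R$-modules assigns to every group $G$ a contravariant functor $\mathcal H^*_G$ from proper $G$-CW-pairs to $\mathbb Z$-graded $R$-modules which is $G$-homotopy invariant, has natural long exact sequences of pairs and satisfies excision for $G$-pushouts (equivalently, has long exact Mayer–Vietoris sequences); no disjoint union axiom is required. Moreover there are, for every $\alpha\colon H\to G$ and every proper $H$-CW-pair $(X,A)$, natural homomorphisms $\operatorname{ind}_\alpha\colon\mathcal H^n_G(\operatorname{ind}_\alpha(X,A))\to\mathcal H^n_H(X,A)$ which are bijective if $\ker\alpha$ acts freely on $X$, and which are compatible with the boundary homomorphisms, functorial in $\alpha$, and compatible with inner automorphisms.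 It is *multiplicative* if there are $R$-bilinear products $\mathcal H^m_G(X,A)\times\mathcal H^n_G(X,B)\to\mathcal H^{m+n}_G(X,A\cup B)$ which are natural, associative, graded commutative, have units $1\in\mathcal H^0_G(X)$, and are compatible with the boundary homomorphisms and with $\operatorname{ind}_\alpha$. Write $\mathcal H^*=\mathcal H^*_{\{1\}}$, and let $\ast$ be the one-point space. Then $\mathcal H^0_G(X)$ is a commutative ring, and $\mathcal H^m_G(X)$ is a module over $\mathcal H^0(\ast)$ through $\mathcal H^0(\ast)\to\mathcal H^0(G\backslash X)\xrightarrow{\operatorname{ind}_{G\to 1}}\mathcal H^0_G(X)$. For a proper $G$-CW-complex $X$ the *augmentation ideal* $\mathbb I_G(X)\subseteq\mathcal H^0_G(X)$ is the kernel of $$\mathcal H^0_G(X)\to\prod_{\overline{x}\in G\backslash\pi_0(X)}\mathcal H^0(\ast),$$ whose component at $\overline{x}$ is the composite $\mathcal H^0_G(X)\to\mathcal H^0_G(G)\xrightarrow{\operatorname{ind}_{1\to G}}\mathcal H^0(\ast)$ whose first map is induced by $g\mapsto gx$. For a finite group $H$ put $\mathbb I(H)=\mathbb I_H(\ast)$.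 Let $f\colon X\to L$ be a $G$-map between proper $G$-CW-complexes with $X$ finite, so that $\mathcal H^0_G(L)$ acts on $\mathcal H^m_G(X)$ through $f$. Let $EG$ be a contractible free $G$-CW-complex, and let $(EG\times_GX)_{(n-1)}$ be the $(n-1)$-skeleton of $EG\times_GX=G\backslash(EG\times X)$. The map $$\lambda^m_G(f\colon X\to L)\colon\bigl\{\mathcal H^m_G(X)/\mathbb I_G(L)^n\cdot\mathcal H^m_G(X)\bigr\}_{n\ge1}\to\bigl\{\mathcal H^m\bigl((EG\times_GX)_{(n-1)}\bigr)\bigr\}_{n\ge1}$$ of inverse systems of $\mathcal H^0(\ast)$-modules is induced by $$\mathcal H^m_G(X)\to\mathcal H^m_G(EG\times X)\xrightarrow{(\operatorname{ind}_{G\to 1})^{-1}}\mathcal H^m(EG\times_GX)\to\mathcal H^m\bigl((EG\times_GX)_{(n-1)}\bigr),$$ where the first map is induced by the projection and the last one is restriction. A levelwise homomorphism $\{\varphi_n\}\colon\{M_n\}\to\{N_n\}$ of inverse systems indexed by $n\ge1$ is a *pro-isomorphism* if for every $k\ge1$ there is $n\ge k$ such that $\ker\varphi_n$ maps to $0$ in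 $M_k$ and the image of $N_n\to N_k$ is contained in the image of $\varphi_k$. Statement: Let $\mathcal H^*_?$ be a multiplicative proper equivariant cohomology theory with values in $R$-modules, let $G$ be a group, let $L$ be a proper $G$-CW-complex, and let $\mathcal F(L)=\{H\subseteq G\text{ a subgroup}\mid L^H\ne\emptyset\}$. Assume: 1. the ring $\mathcal H^0(\ast)$ is Noetherian; 2. for all $H\in\mathcal F(L)$ and $m\in\mathbb Z$ the $\mathcal H^0(\ast)$-module $\mathcal H^m_H(\ast)$ is finitely generated; 3. for every $H\in\mathcal F(L)$, every prime ideal $\mathcal P\subseteq\mathcal H^0_H(\ast)$ and every $G$-map $f\colon G/H\to L$: if the composite $\mathcal H^0_G(L)\xrightarrow{\mathcal H^0_G(f)}\mathcal H^0_G(G/H)\xrightarrow{\operatorname{ind}_{H\to G}}\mathcal H^0_H(\ast)$ maps $\mathbb I_G(L)$ into $\mathcal P$, then $\mathbb I(H)\subseteq\mathcal P$; 4. for every $H\in\mathcal F(L)$ and $m\in\mathbb Z$ the map $\lambda^m_H(\operatorname{id}\colon\ast\to\ast)\colon\{\mathcal H^m_H(\ast)/\mathbb I(H)^n\cdot\mathcal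 H^m_H(\ast)\}_{n\ge1}\to\{\mathcal H^m((BH)_{(n-1)})\}_{n\ge1}$ is a pro-isomorphism (for every model of $EH$, where $BH=EH\times_H\ast=H\backslash EH$). Then for every finite proper $G$-CW-complex $X$, every $G$-map $f\colon X\to L$, every model of $EG$ and every $m\in\mathbb Z$ the map $\lambda^m_G(f\colon X\to L)$ is a well-defined pro-isomorphism of $\mathcal H^0(\ast)$-modules. -/

import Mathlib

open scoped unitInterval

universe u v w

/-! ### Spaces with an action of a discrete group -/

/-- A topological space with a continuous (left) action of the discrete group `G`. -/
structure GSpace (G : Type u) [Group G] where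
  carrier : Type u
  [top : TopologicalSpace carrier]
  [act : MulAction G carrier]
  [cont : ContinuousConstSMul G carrier]

namespace GSpace

instance {G : Type u} [Group G] : CoeSort (GSpace G) (Type u) := ⟨GSpace.carrier⟩

attribute [instance] GSpace.top GSpace.act GSpace.cont

variable {G : Type u} [Group G]

/-- The invariant subsets of a `G`-space. -/
abbrev Invariant (X : GSpace G) : Type u := SubMulAction G X

/-- A `G`-invariant subset, with the subspace topology, as a `G`-space. -/
def sub {X : GSpace G} (A : SubMulAction G X) : GSpace G :=
  letI : ContinuousConstSMul G A :=
    ⟨fun g => ((continuous_const_smul g).comp continuous_subtype_val).subtype_mk _⟩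
  ⟨A⟩

/-- The one-point space. -/
def pt : GSpace G := ⟨PUnit.{u + 1}⟩

/-- The product with the diagonal action. -/
def prod (X Y : GSpace G) : GSpace G := ⟨X × Y⟩

end GSpace

/-- A `G`-map: a continuous `G`-equivariant map. -/
structure GMap {G : Type u} [Group G] (X Y : GSpace G) where
  toFun : X → Y
  continuous_toFun : Continuous toFun
  map_smul' : ∀ (g : G) (x : X), toFun (g • x) = g • toFun x

namespace GMap

variable {G : Type u} [Group G]

instance {X Y : GSpace G} : CoeFun (GMap X Y) (fun _ => X → Y) := ⟨GMap.toFun⟩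

def id (X : GSpace G) : GMap X X := ⟨fun x => x, continuous_id, fun _ _ => rfl⟩

def comp {X Y Z : GSpace G} (g : GMap Y Z) (f : GMap X Y) : GMap X Z :=
  ⟨fun x => g (f x), g.continuous_toFun.comp f.continuous_toFun,
    fun a x => by rw [f.map_smul', g.map_smul']⟩

/-- The map to the one-point space. -/
def toPt (X : GSpace G) : GMap X GSpace.pt :=
  ⟨fun _ => PUnit.unit, continuous_const, fun _ _ => rfl⟩

/-- The projection `X × Y → Y`. -/
def snd (X Y : GSpace G) : GMap (X.prod Y) Y := ⟨Prod.snd, continuous_snd, fun _ _ => rfl⟩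

/-- The inclusion of an invariant subspace. -/
def incl {X : GSpace G} (A : SubMulAction G X) : GMap (GSpace.sub A) X :=
  ⟨Subtype.val, continuous_subtype_val, fun _ _ => rfl⟩

/-- The restriction of a `G`-map to invariant subspaces of source and target. -/
def restrict {X Y : GSpace G} (f : GMap X Y) (A : SubMulAction G X) (B : SubMulAction G Y)
    (h : ∀ x ∈ A, f x ∈ B) : GMap (GSpace.sub A) (GSpace.sub B) :=
  ⟨fun x => ⟨f x.1, h x.1 x.2⟩,
    (f.continuous_toFun.comp continuous_subtype_val).subtype_mk _,
    fun g x => Subtype.ext (f.map_smul' g x.1)⟩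

/-- The inclusion of one invariant subspace into a larger one. -/
def inclusion {X : GSpace G} {A B : SubMulAction G X} (h : A ≤ B) :
    GMap (GSpace.sub A) (GSpace.sub B) := restrict (id X) A B fun _ hx => h hx

end GMap

theorem GMap.bot_mem {G : Type u} [Group G] {X Y : GSpace G} (f : GMap X Y)
    (B : SubMulAction G Y) : ∀ x ∈ (⊥ : SubMulAction G X), f x ∈ B :=
  fun _ hx => absurd hx (by exact fun h => h)

/-- `B ∩ A`, as an invariant subset of `A`. -/
def GSpace.traceOn {G : Type u} [Group G] {X : GSpace G} (A B : SubMulAction G X) :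
    SubMulAction G (GSpace.sub A) where
  carrier := {x | (x : A).1 ∈ B}
  smul_mem' g _ hx := B.smul_mem g hx

/-- Two maps of pairs `(X, A) → (Y, B)` are `G`-homotopic (through maps of pairs). -/
def GHomotopic {G : Type u} [Group G] {X Y : GSpace G} (A : SubMulAction G X)
    (B : SubMulAction G Y) (f₀ f₁ : GMap X Y) : Prop :=
  ∃ h : X → I → Y, Continuous (fun p : X × I => h p.1 p.2) ∧
    (∀ x, h x 0 = f₀ x) ∧ (∀ x, h x 1 = f₁ x) ∧
    (∀ (g : G) x t, h (g • x) t = g • h x t) ∧ ∀ x ∈ A, ∀ t, h x t ∈ B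

/-- The square with corners `A`, `B`, `X`, `Y` (with `A ⊆ X`, `B ⊆ Y` and `F : X → Y`) is a
pushout of `G`-spaces, that is, `Y` is obtained from `B` by attaching `X` along `F|A : A → B`. -/
structure IsGPushout {G : Type u} [Group G] {X Y : GSpace G} (A : SubMulAction G X)
    (B : SubMulAction G Y) (F : GMap X Y) : Prop where
  mem_iff : ∀ x, F x ∈ B ↔ x ∈ A
  inj : ∀ x x', x ∉ A → F x = F x' → x = x'
  surj : ∀ y, y ∉ B → ∃ x, F x = y
  isClosed : ∀ Z : Set Y, IsClosed (F.toFun ⁻¹' Z) → IsClosed {b : B | b.1 ∈ Z} → IsClosed Z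

/-! ### `G`-CW-complexes -/

/-- The closed unit disc `Dⁿ`; its interior is `‖x‖ < 1` and its boundary sphere is `‖x‖ = 1`. -/
abbrev Disc (n : ℕ) : Type := Metric.closedBall (0 : EuclideanSpace ℝ (Fin n)) 1

/-- A `G`-CW-structure on the `G`-space `X`. An equivariant `n`-cell `e` of type
`G/stab e × Dⁿ` is given by its characteristic map `G/stab e × Dⁿ → X`, `(gH, x) ↦ g • char e x`.
The `n`-skeleton `X_n` is the union of the images of all characteristic maps of dimension
at most `n`. The last five fields say that `X_n` is the pushout of `X_{n-1}` and
`∐ G/stab e × Dⁿ` along `∐ G/stab e × Sⁿ⁻¹`, with the subspace topology of `X`, and that `X` is the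
union of its skeleta with the colimit topology. -/
structure GCWStructure {G : Type u} [Group G] (X : GSpace G) where
  cell : ℕ → Type u
  stab : ∀ {n}, cell n → Subgroup G
  char : ∀ {n}, cell n → Disc n → X
  continuous_char : ∀ {n} (e : cell n), Continuous (char e)
  stab_smul : ∀ {n} (e : cell n), ∀ h ∈ stab e, ∀ x, h • char e x = char e x
  boundary : ∀ {n} (e : cell n) (x : Disc n), ‖x.1‖ = 1 →
    ∃ k < n, ∃ (e' : cell k) (g : G) (x' : Disc k), char e x = g • char e' x'
  interior_inj : ∀ {n k} (e : cell n) (e' : cell k) (x : Disc n) (x' : Disc k) (g : G),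
    ‖x.1‖ < 1 → ‖x'.1‖ < 1 → g • char e x = char e' x' →
      (⟨n, e, x⟩ : Σ n, cell n × Disc n) = ⟨k, e', x'⟩ ∧ g ∈ stab e
  cover : ∀ y : X, ∃ (n : ℕ) (e : cell n) (g : G) (x : Disc n), y = g • char e x
  isClosed_of_skeleton : ∀ (n : ℕ) (Z : Set X),
    (∀ y ∈ Z, ∃ k ≤ n, ∃ (e : cell k) (g : G) (x : Disc k), y = g • char e x) →
    (∀ k ≤ n, ∀ (e : cell k) (g : G), IsClosed {x : Disc k | g • char e x ∈ Z}) → IsClosed Z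
  isClosed_of_colimit : ∀ Z : Set X,
    (∀ n : ℕ, IsClosed {y | y ∈ Z ∧
      ∃ k ≤ n, ∃ (e : cell k) (g : G) (x : Disc k), y = g • char e x}) → IsClosed Z

namespace GCWStructure

variable {G : Type u} [Group G] {X : GSpace G}

/-- The `n`-skeleton. -/
def skel (S : GCWStructure X) (n : ℕ) : SubMulAction G X where
  carrier := {y | ∃ k ≤ n, ∃ (e : S.cell k) (g : G) (x : Disc k), y = g • S.char e x}
  smul_mem' a y := by
    rintro ⟨k, hk, e, g, x, rfl⟩
    exact ⟨k, hk, e, a * g, x, (mul_smul a g _).symm⟩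

theorem skel_mono (S : GCWStructure X) : Monotone S.skel := by
  rintro m n hmn y ⟨k, hk, h⟩
  exact ⟨k, hk.trans hmn, h⟩

/-- All isotropy groups are finite. -/
def IsProper (S : GCWStructure X) : Prop := ∀ (n : ℕ) (e : S.cell n), Finite (S.stab e)

/-- There are only finitely many equivariant cells. -/
def IsFinite (S : GCWStructure X) : Prop := Finite (Σ n, S.cell n)

/-- `A` is a `G`-CW-subcomplex: if it contains an interior point of a cell, then it contains the
whole closed cell. -/
def IsSubcomplex (S : GCWStructure X) (A : SubMulAction G X) : Prop :=
  ∀ (n : ℕ) (e : S.cell n) (x : Disc n), ‖x.1‖ < 1 → S.char e x ∈ A → ∀ x', S.char e x' ∈ A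

end GCWStructure

/-- `X` is a proper `G`-CW-complex with the members of `𝒜` as subcomplexes. -/
def ProperGCW {G : Type u} [Group G] (X : GSpace G) (𝒜 : Set (SubMulAction G X)) : Prop :=
  ∃ S : GCWStructure X, S.IsProper ∧ ∀ A ∈ 𝒜, S.IsSubcomplex A

/-- `(X, A)` is a pair of proper `G`-CW-complexes. -/
def ProperGCWPair {G : Type u} [Group G] (X : GSpace G) (A : SubMulAction G X) : Prop :=
  ProperGCW X {A}

/-- A model for `EG`: a contractible free `G`-CW-complex. -/
structure ClassifyingSpace (G : Type u) [Group G] where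
  space : GSpace G
  cw : GCWStructure space
  free : ∀ (g : G) (x : space), g • x = x → g = 1
  contractible : ContractibleSpace space

/-! ### Induction along a group homomorphism -/

section Induction

variable {G H K : Type u} [Group G] [Group H] [Group K]

/-- The equivalence relation of the right `H`-action `(g, x) · h = (g α(h), h⁻¹ x)` on `G × X`. -/
def indSetoid (α : H →* G) (X : GSpace H) : Setoid (G × X) where
  r p q := ∃ h : H, q = (p.1 * α h, h⁻¹ • p.2)
  iseqv :=
    { refl := fun p => ⟨1, by simp⟩
      symm := by
        rintro p q ⟨h, rfl⟩
        exact ⟨h⁻¹, by simp⟩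
      trans := by
        rintro p q r ⟨h, rfl⟩ ⟨k, rfl⟩
        exact ⟨h * k, by simp [mul_smul, mul_assoc]⟩ }

/-- The underlying set of `ind_α X`. -/
def IndCarrier (α : H →* G) (X : GSpace H) : Type u := Quotient (indSetoid α X)

/-- The class of `(g, x)` in `ind_α X`. -/
def indMk (α : H →* G) (X : GSpace H) (g : G) (x : X) : IndCarrier α X :=
  Quotient.mk (indSetoid α X) (g, x)

theorem indMk_eq_iff (α : H →* G) (X : GSpace H) (g g' : G) (x x' : X) :
    indMk α X g x = indMk α X g' x' ↔ ∃ h : H, g' = g * α h ∧ x' = h⁻¹ • x := by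
  refine (Quotient.eq (r := indSetoid α X)).trans ?_
  change (∃ h : H, (g', x') = (g * α h, h⁻¹ • x)) ↔ _
  simp only [Prod.mk.injEq]

theorem indMk_mul (α : H →* G) (X : GSpace H) (g : G) (h : H) (x : X) :
    indMk α X (g * α h) x = indMk α X g (h • x) :=
  ((indMk_eq_iff α X g (g * α h) (h • x) x).2 ⟨h, rfl, by simp⟩).symm

/-- The quotient topology of `G × X` with `G` discrete. -/
instance (α : H →* G) (X : GSpace H) : TopologicalSpace (IndCarrier α X) :=
  ⨆ g : G, TopologicalSpace.coinduced (indMk α X g) X.top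

instance (α : H →* G) (X : GSpace H) : MulAction G (IndCarrier α X) where
  smul a := Quotient.map (fun p => (a * p.1, p.2)) (by
    rintro p q ⟨h, rfl⟩
    exact ⟨h, by simp [mul_assoc]⟩)
  one_smul := by
    rintro ⟨p⟩
    exact congrArg (Quotient.mk _) (by simp)
  mul_smul a b := by
    rintro ⟨p⟩
    exact congrArg (Quotient.mk _) (by simp [mul_assoc])

theorem smul_indMk (α : H →* G) (X : GSpace H) (a g : G) (x : X) :
    a • indMk α X g x = indMk α X (a * g) x := rfl

theorem indMk_surj (α : H →* G) (X : GSpace H) (y : IndCarrier α X) :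
    ∃ g x, y = indMk α X g x := by
  obtain ⟨p, rfl⟩ := Quotient.exists_rep y
  exact ⟨p.1, p.2, rfl⟩

theorem continuous_ind_iff (α : H →* G) (X : GSpace H) {Y : Type*} [TopologicalSpace Y]
    (f : IndCarrier α X → Y) :
    Continuous f ↔ ∀ g, Continuous fun x => f (indMk α X g x) := by
  rw [continuous_iSup_dom]
  exact forall_congr' fun g => continuous_coinduced_dom

theorem isClosed_ind_iff (α : H →* G) (X : GSpace H) (Z : Set (IndCarrier α X)) :
    IsClosed Z ↔ ∀ g, IsClosed {x | indMk α X g x ∈ Z} := by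
  rw [isClosed_iSup_iff]
  exact forall_congr' fun g => isClosed_coinduced

theorem continuous_indMk (α : H →* G) (X : GSpace H) (g : G) : Continuous (indMk α X g) :=
  (continuous_ind_iff α X fun y => y).1 continuous_id g

instance (α : H →* G) (X : GSpace H) : ContinuousConstSMul G (IndCarrier α X) where
  continuous_const_smul a := by
    rw [continuous_ind_iff]
    exact fun g => continuous_indMk α X (a * g)

/-- The induction `ind_α X` of the `H`-space `X` with `α : H → G`. -/
def Ind (α : H →* G) (X : GSpace H) : GSpace G := ⟨IndCarrier α X⟩

/-- The point of `ind_α X` represented by `(g, x)`. -/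
def Ind.mk (α : H →* G) {X : GSpace H} (g : G) (x : X) : Ind α X := indMk α X g x

/-- The invariant subset `ind_α A` of `ind_α X`. -/
def indSub (α : H →* G) {X : GSpace H} (A : SubMulAction H X) : SubMulAction G (Ind α X) where
  carrier := {y | ∃ g, ∃ a ∈ A, y = Ind.mk α g a}
  smul_mem' b y := by
    rintro ⟨g, a, ha, rfl⟩
    exact ⟨b * g, a, ha, rfl⟩

theorem indSub_bot (α : H →* G) {X : GSpace H} :
    indSub α (⊥ : SubMulAction H X) = ⊥ := by
  ext y
  constructor
  · rintro ⟨g, a, ha, _⟩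
    exact absurd ha (by exact fun h => h)
  · exact fun h => absurd h (by exact fun h => h)

theorem indSub_mono (α : H →* G) {X : GSpace H} {A B : SubMulAction H X} (h : A ≤ B) :
    indSub α A ≤ indSub α B := by
  rintro y ⟨g, a, ha, rfl⟩
  exact ⟨g, a, h ha, rfl⟩

theorem Ind.mk_mem_indSub (α : H →* G) {X : GSpace H} {A : SubMulAction H X} {g : G} {x : X} :
    Ind.mk α g x ∈ indSub α A ↔ x ∈ A := by
  constructor
  · rintro ⟨g', a, ha, h⟩
    obtain ⟨k, -, rfl⟩ := (indMk_eq_iff α X _ _ _ _).1 h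
    have := A.smul_mem k ha
    rwa [smul_inv_smul] at this
  · exact fun hx => ⟨g, x, hx, rfl⟩

/-- The `G`-map `ind_α X → Z`, `[(g, x)] ↦ g • f x`, adjoint to the `α`-equivariant map
`f : X → Z`. -/
def Ind.desc (α : H →* G) {X : GSpace H} {Z : GSpace G} (f : X → Z) (hf : Continuous f)
    (hα : ∀ (h : H) (x : X), f (h • x) = α h • f x) : GMap (Ind α X) Z where
  toFun := Quotient.lift (fun p : G × X => p.1 • f p.2) (by
    rintro p q ⟨h, rfl⟩
    change p.1 • f p.2 = (p.1 * α h) • f (h⁻¹ • p.2)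
    rw [mul_smul, ← hα, smul_inv_smul])
  continuous_toFun :=
    (continuous_ind_iff α X _).2 fun g => (continuous_const_smul g).comp hf
  map_smul' a y := by
    obtain ⟨g, x, rfl⟩ := indMk_surj α X y
    exact mul_smul a g (f x)

/-- `ind_α f`. -/
def Ind.map (α : H →* G) {X Y : GSpace H} (f : GMap X Y) : GMap (Ind α X) (Ind α Y) :=
  Ind.desc α (fun x => Ind.mk α 1 (f x)) ((continuous_indMk α Y 1).comp f.continuous_toFun)
    fun h x => by
      rw [f.map_smul']
      change indMk α Y 1 (h • f x) = indMk α Y (α h * 1) (f x)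
      rw [← indMk_mul, mul_one, one_mul]

/-- The canonical homeomorphism from `ind_α A` to the subspace `ind_α A ⊆ ind_α X`. -/
def Ind.subMap (α : H →* G) {X : GSpace H} (A : SubMulAction H X) :
    GMap (Ind α (GSpace.sub A)) (GSpace.sub (indSub α A)) :=
  Ind.desc α (fun x => ⟨Ind.mk α 1 (x : A).1, 1, (x : A).1, (x : A).2, rfl⟩)
    (((continuous_indMk α X 1).comp continuous_subtype_val).subtype_mk _)
    fun h x => Subtype.ext (by
      change indMk α X 1 (h • (x : A).1) = indMk α X (α h * 1) (x : A).1
      rw [← indMk_mul, mul_one, one_mul])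

/-- The canonical homeomorphism `ind_{β ∘ α} X → ind_β (ind_α X)`, `[(k, x)] ↦ [(k, [(1, x)])]`. -/
def Ind.assocMap (β : G →* K) (α : H →* G) (X : GSpace H) :
    GMap (Ind (β.comp α) X) (Ind β (Ind α X)) :=
  Ind.desc (β.comp α) (fun x => Ind.mk β 1 (Ind.mk α 1 x))
    ((continuous_indMk β (Ind α X) 1).comp (continuous_indMk α X 1))
    fun h x => by
      change indMk β (Ind α X) 1 (indMk α X 1 (h • x)) =
        indMk β (Ind α X) (β (α h) * 1) (indMk α X 1 x)
      have h₁ : indMk α X 1 (h • x) = α h • indMk α X 1 x := by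
        rw [smul_indMk, ← indMk_mul, one_mul, mul_one]
      have h₂ := indMk_mul β (Ind α X) 1 (α h) (indMk α X 1 x)
      rw [one_mul] at h₂
      rw [mul_one, h₂, h₁]
      rfl

/-- The homeomorphism `X → ind_{c(g)} X`, `x ↦ [(1, g⁻¹ x)]`, for the inner automorphism
`c(g) : a ↦ g a g⁻¹` of `G`. -/
def Ind.conjMap (g : G) (X : GSpace G) : GMap X (Ind (MulAut.conj g).toMonoidHom X) where
  toFun x := Ind.mk _ 1 (g⁻¹ • x)
  continuous_toFun := (continuous_indMk _ X 1).comp (continuous_const_smul g⁻¹)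
  map_smul' a x := by
    change indMk _ X 1 (g⁻¹ • a • x) = indMk _ X (a * 1) (g⁻¹ • x)
    have h : a * 1 = 1 * (MulAut.conj g).toMonoidHom (g⁻¹ * a * g) := by
      simp [MulAut.conj_apply, mul_assoc]
    rw [h, indMk_mul]
    congr 1
    simp [mul_smul]

/-- For `x ∈ X` the `G`-map `G = ind_{1 → G} * → X` which sends `g` to `g • x`. -/
def GSpace.orbitMap {X : GSpace G} (x : X) :
    GMap (Ind (1 : PUnit.{u + 1} →* G) GSpace.pt) X :=
  Ind.desc _ (fun _ => x) continuous_const fun _ _ => (one_smul G x).symm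

end Induction

/-! ### Facts on `G`-CW-complexes needed below -/

section CWFacts

variable {G H : Type u} [Group G] [Group H]

theorem ProperGCW.mono {X : GSpace G} {𝒜 ℬ : Set (SubMulAction G X)} (h : ProperGCW X 𝒜)
    (hℬ : ℬ ⊆ 𝒜) : ProperGCW X ℬ := by
  obtain ⟨S, hS, hA⟩ := h
  exact ⟨S, hS, fun A h => hA A (hℬ h)⟩

theorem ProperGCW.insert_bot {X : GSpace G} {𝒜 : Set (SubMulAction G X)} (h : ProperGCW X 𝒜) :
    ProperGCW X (insert ⊥ 𝒜) := by
  obtain ⟨S, hS, hA⟩ := h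
  refine ⟨S, hS, ?_⟩
  rintro A (rfl | h)
  · exact fun n e x _ hx => absurd hx (by exact fun h => h)
  · exact hA A h

theorem ProperGCWPair.bot {X : GSpace G} {A : SubMulAction G X} (h : ProperGCWPair X A) :
    ProperGCWPair X ⊥ :=
  (ProperGCW.insert_bot h).mono (by simp)

/-- The induced `G`-CW-structure on `ind_α X`. -/
def GCWStructure.ind (α : H →* G) {X : GSpace H} (S : GCWStructure X) :
    GCWStructure (Ind α X) where
  cell := S.cell
  stab e := (S.stab e).map α
  char e x := Ind.mk α 1 (S.char e x)
  continuous_char e := (continuous_indMk α X 1).comp (S.continuous_char e)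
  stab_smul e := by
    rintro _ ⟨h, hh, rfl⟩ x
    change indMk α X (α h * 1) (S.char e x) = indMk α X 1 (S.char e x)
    rw [mul_one, ← one_mul (α h), indMk_mul, S.stab_smul e h hh]
  boundary e x hx := by
    obtain ⟨k, hk, e', g, x', h⟩ := S.boundary e x hx
    refine ⟨k, hk, e', α g, x', ?_⟩
    change indMk α X 1 (S.char e x) = indMk α X (α g * 1) (S.char e' x')
    rw [h, ← indMk_mul, mul_one, one_mul]
  interior_inj e e' x x' g hx hx' h := by
    change indMk α X (g * 1) (S.char e x) = indMk α X 1 (S.char e' x') at h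
    obtain ⟨k, hk, h'⟩ := (indMk_eq_iff α X _ _ _ _).1 h
    obtain ⟨h1, h2⟩ := S.interior_inj e e' x x' k⁻¹ hx hx' h'.symm
    refine ⟨h1, k⁻¹, h2, ?_⟩
    rw [map_inv]
    rw [mul_one] at hk
    exact inv_eq_of_mul_eq_one_left hk.symm
  cover y := by
    obtain ⟨a, z, rfl⟩ := indMk_surj α X y
    obtain ⟨n, e, h, x, rfl⟩ := S.cover z
    refine ⟨n, e, a * α h, x, ?_⟩
    change indMk α X a (h • S.char e x) = indMk α X (a * α h * 1) (S.char e x)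
    rw [mul_one, indMk_mul]
  isClosed_of_skeleton n Z hZ hcl := by
    refine (isClosed_ind_iff α X Z).2 fun g => S.isClosed_of_skeleton n _ ?_ ?_
    · intro y hy
      obtain ⟨k, hk, e, a, x, h⟩ := hZ _ hy
      change indMk α X g y = indMk α X (a * 1) (S.char e x) at h
      obtain ⟨b, -, h'⟩ := (indMk_eq_iff α X _ _ _ _).1 h
      exact ⟨k, hk, e, b, x, by rw [h', smul_inv_smul]⟩
    · intro k hk e h
      convert hcl k hk e (g * α h) using 3 with x
      change indMk α X g (h • S.char e x) ∈ Z ↔ indMk α X (g * α h * 1) (S.char e x) ∈ Z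
      rw [mul_one, indMk_mul]
  isClosed_of_colimit Z hZ := by
    refine (isClosed_ind_iff α X Z).2 fun g => S.isClosed_of_colimit _ fun n => ?_
    convert (isClosed_ind_iff α X _).1 (hZ n) g using 3 with y
    refine and_congr Iff.rfl ⟨?_, ?_⟩
    · rintro ⟨k, hk, e, a, x, rfl⟩
      refine ⟨k, hk, e, g * α a, x, ?_⟩
      change indMk α X g (a • S.char e x) = indMk α X (g * α a * 1) (S.char e x)
      rw [mul_one, indMk_mul]
    · rintro ⟨k, hk, e, a, x, h⟩
      change indMk α X g y = indMk α X (a * 1) (S.char e x) at h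
      obtain ⟨b, -, h'⟩ := (indMk_eq_iff α X _ _ _ _).1 h
      exact ⟨k, hk, e, b, x, by rw [h', smul_inv_smul]⟩

theorem ProperGCWPair.ind (α : H →* G) {X : GSpace H} {A : SubMulAction H X}
    (h : ProperGCWPair X A) : ProperGCWPair (Ind α X) (indSub α A) := by
  obtain ⟨S, hS, hA⟩ := h
  refine ⟨S.ind α, fun n e => ?_, ?_⟩
  · have := hS n e
    exact Set.Finite.image α (Set.toFinite (S.stab e : Set H))
  · rintro _ rfl n e x hx hm x'
    exact (Ind.mk_mem_indSub α).2 (hA A rfl n e x hx ((Ind.mk_mem_indSub α).1 hm) x')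

theorem ProperGCWPair.ind_bot (α : H →* G) {X : GSpace H} (h : ProperGCWPair X ⊥) :
    ProperGCWPair (Ind α X) ⊥ := indSub_bot α (X := X) ▸ h.ind α

/-- The `G`-CW-structure on the one-point space. -/
def GCWStructure.point : GCWStructure (GSpace.pt : GSpace G) where
  cell n := { _x : PUnit.{u + 1} // n = 0 }
  stab _ := ⊤
  char _ _ := PUnit.unit
  continuous_char _ := continuous_const
  stab_smul _ _ _ _ := rfl
  boundary := by
    rintro n ⟨-, rfl⟩ x hx
    rw [Subsingleton.elim x.1 0, norm_zero] at hx
    exact absurd hx (by norm_num)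
  interior_inj := by
    rintro n k ⟨a, rfl⟩ ⟨b, rfl⟩ x x' g - - -
    refine ⟨?_, trivial⟩
    obtain rfl : x = x' := Subsingleton.elim _ _
    rfl
  cover y := ⟨0, ⟨PUnit.unit, rfl⟩, 1, ⟨0, by simp⟩, rfl⟩
  isClosed_of_skeleton n Z _ _ := by
    have : DiscreteTopology (GSpace.pt : GSpace G) :=
      inferInstanceAs (DiscreteTopology PUnit.{u + 1})
    exact isClosed_discrete Z
  isClosed_of_colimit Z _ := by
    have : DiscreteTopology (GSpace.pt : GSpace G) :=
      inferInstanceAs (DiscreteTopology PUnit.{u + 1})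
    exact isClosed_discrete Z

theorem ProperGCWPair.point [Finite G] : ProperGCWPair (GSpace.pt : GSpace G) ⊥ :=
  ⟨GCWStructure.point, fun _ _ => Subtype.finite, by
    rintro _ rfl n e x - hx
    exact absurd hx (by exact fun h => h)⟩

end CWFacts

/-! ### Equivariant cohomology theories -/

/-- A proper `G`-cohomology theory with values in `R`-modules: for every pair `(X, A)` of proper
`G`-CW-complexes a `ℤ`-graded `R`-module `Hⁿ(X, A)`, contravariant in `(X, A)`, which is
`G`-homotopy invariant, has natural long exact sequences of pairs, and satisfies excision for
`G`-pushouts (which together with the long exact sequences is the same as having long exact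
Mayer-Vietoris sequences of `G`-pushouts). No disjoint union axiom is required.
The axioms concern pairs of proper `G`-CW-complexes only; by convention `Hⁿ(X, A) = 0` for all other
pairs. The absolute group `Hⁿ(X)` is `H n X ⊥`, as `⊥` is the empty subset. -/
structure GCohomologyTheory (R : Type w) [CommRing R] (G : Type u) [Group G] where
  H : ℤ → (X : GSpace G) → SubMulAction G X → Type v
  [addCommGroup : ∀ n X A, AddCommGroup (H n X A)]
  [module : ∀ n X A, Module R (H n X A)]
  subsingleton_of_not : ∀ n X A, ¬ ProperGCWPair X A → Subsingleton (H n X A)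
  /-- The map induced by a map of pairs. -/
  map : ∀ (n : ℤ) {X Y : GSpace G} {A : SubMulAction G X} {B : SubMulAction G Y} (f : GMap X Y),
    (∀ x ∈ A, f x ∈ B) → (H n Y B →ₗ[R] H n X A)
  map_id : ∀ (n : ℤ) {X : GSpace G} {A : SubMulAction G X} (a : H n X A),
    map n (GMap.id X) (fun _ h => h) a = a
  map_comp : ∀ (n : ℤ) {X Y Z : GSpace G} {A : SubMulAction G X} {B : SubMulAction G Y}
    {C : SubMulAction G Z} (f : GMap X Y) (g : GMap Y Z) (hf : ∀ x ∈ A, f x ∈ B)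
    (hg : ∀ y ∈ B, g y ∈ C), ProperGCWPair X A → ProperGCWPair Y B → ProperGCWPair Z C →
    ∀ c : H n Z C, map n (g.comp f) (fun x hx => hg _ (hf x hx)) c = map n f hf (map n g hg c)
  map_homotopic : ∀ (n : ℤ) {X Y : GSpace G} {A : SubMulAction G X} {B : SubMulAction G Y}
    (f₀ f₁ : GMap X Y) (h₀ : ∀ x ∈ A, f₀ x ∈ B) (h₁ : ∀ x ∈ A, f₁ x ∈ B),
    ProperGCWPair X A → ProperGCWPair Y B → GHomotopic A B f₀ f₁ → map n f₀ h₀ = map n f₁ h₁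
  /-- The boundary homomorphism `Hⁿ(A) → Hⁿ⁺¹(X, A)`. -/
  bdry : ∀ (n : ℤ) {X : GSpace G} (A : SubMulAction G X),
    H n (GSpace.sub A) ⊥ →ₗ[R] H (n + 1) X A
  bdry_natural : ∀ (n : ℤ) {X Y : GSpace G} {A : SubMulAction G X} {B : SubMulAction G Y}
    (f : GMap X Y) (hf : ∀ x ∈ A, f x ∈ B), ProperGCWPair X A → ProperGCWPair Y B →
    ∀ b : H n (GSpace.sub B) ⊥,
      bdry n A (map n (f.restrict A B hf) (GMap.bot_mem _ _) b) = map (n + 1) f hf (bdry n B b)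
  /-- Exactness of `Hⁿ(X, A) → Hⁿ(X) → Hⁿ(A)`. -/
  exact_space : ∀ (n : ℤ) {X : GSpace G} (A : SubMulAction G X), ProperGCWPair X A →
    Function.Exact (map n (A := ⊥) (B := A) (GMap.id X) (GMap.bot_mem _ _))
      (map n (A := ⊥) (B := ⊥) (GMap.incl A) (GMap.bot_mem _ _))
  /-- Exactness of `Hⁿ(X) → Hⁿ(A) → Hⁿ⁺¹(X, A)`. -/
  exact_sub : ∀ (n : ℤ) {X : GSpace G} (A : SubMulAction G X), ProperGCWPair X A →
    Function.Exact (map n (A := ⊥) (B := ⊥) (GMap.incl A) (GMap.bot_mem _ _)) (bdry n A)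
  /-- Exactness of `Hⁿ(A) → Hⁿ⁺¹(X, A) → Hⁿ⁺¹(X)`. -/
  exact_pair : ∀ (n : ℤ) {X : GSpace G} (A : SubMulAction G X), ProperGCWPair X A →
    Function.Exact (bdry n A)
      (map (n + 1) (A := ⊥) (B := A) (GMap.id X) (GMap.bot_mem _ _))
  excision : ∀ (n : ℤ) {X Y : GSpace G} {A : SubMulAction G X} {B : SubMulAction G Y}
    (F : GMap X Y) (hF : IsGPushout A B F), ProperGCWPair X A → ProperGCWPair Y B →
    Function.Bijective (map n F (A := A) (B := B) fun x hx => (hF.mem_iff x).2 hx)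

attribute [instance] GCohomologyTheory.addCommGroup GCohomologyTheory.module

/-- A multiplicative structure on a proper `G`-cohomology theory, given by products
`Hᵐ(X, A) ⊗ Hⁿ(X, B) → Hᵐ⁺ⁿ(X, A ∪ B)`. To avoid transports along equalities the target of the
product is written `Hᵏ(X, C)` with `m + n = k` and `A ∪ B = C`. -/
structure GCohomologyTheory.MulStructure {R : Type w} [CommRing R] {G : Type u} [Group G]
    (T : GCohomologyTheory.{u, v, w} R G) where
  cup : ∀ {m n k : ℤ} {X : GSpace G} {A B C : SubMulAction G X}, m + n = k → A ⊔ B = C →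
    (T.H m X A →ₗ[R] T.H n X B →ₗ[R] T.H k X C)
  one : ∀ X : GSpace G, T.H 0 X ⊥
  cup_comm : ∀ {m n k : ℤ} {X : GSpace G} {A B C : SubMulAction G X} (h : m + n = k)
    (h' : n + m = k) (hC : A ⊔ B = C) (hC' : B ⊔ A = C), ProperGCW X {A, B} →
    ∀ (a : T.H m X A) (b : T.H n X B), cup h hC a b = (m * n).negOnePow • cup h' hC' b a
  cup_assoc : ∀ {l m n lm mn k : ℤ} {X : GSpace G} {A B C AB BC D : SubMulAction G X}
    (hlm : l + m = lm) (hmn : m + n = mn) (h : lm + n = k) (h' : l + mn = k)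
    (hAB : A ⊔ B = AB) (hBC : B ⊔ C = BC) (hD : AB ⊔ C = D) (hD' : A ⊔ BC = D),
    ProperGCW X {A, B, C} → ∀ (a : T.H l X A) (b : T.H m X B) (c : T.H n X C),
    cup h hD (cup hlm hAB a b) c = cup h' hD' a (cup hmn hBC b c)
  one_cup : ∀ {n : ℤ} {X : GSpace G} {A : SubMulAction G X} (h : 0 + n = n) (hA : ⊥ ⊔ A = A),
    ProperGCWPair X A → ∀ a : T.H n X A, cup h hA (one X) a = a
  map_cup : ∀ {m n k : ℤ} {X Y : GSpace G} {A B C : SubMulAction G X}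
    {A' B' C' : SubMulAction G Y} (h : m + n = k) (hC : A ⊔ B = C) (hC' : A' ⊔ B' = C')
    (f : GMap X Y) (hfA : ∀ x ∈ A, f x ∈ A') (hfB : ∀ x ∈ B, f x ∈ B') (hfC : ∀ x ∈ C, f x ∈ C'),
    ProperGCW X {A, B} → ProperGCW Y {A', B'} → ∀ (a : T.H m Y A') (b : T.H n Y B'),
    T.map k f hfC (cup h hC' a b) = cup h hC (T.map m f hfA a) (T.map n f hfB b)
  map_one : ∀ {X Y : GSpace G} (f : GMap X Y), ProperGCWPair X ⊥ → ProperGCWPair Y ⊥ →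
    T.map 0 f (f.bot_mem _) (one Y) = one X
  /-- Compatibility with the boundary homomorphisms: for `u ∈ Hᵐ(A)` and `v ∈ Hⁿ(X, B)` one has
  `∂(u ∪ v|_A) = ∂u ∪ v` in `Hᵐ⁺ⁿ⁺¹(X, A ∪ B)`. Here `∂` on the left-hand side is the boundary
  homomorphism `Hᵏ(A, A ∩ B) ≅ Hᵏ(A ∪ B, B) → Hᵏ⁺¹(X, A ∪ B)`, so that it is applied to the class
  `z ∈ Hᵏ(A ∪ B, B)` which restricts to `u ∪ v|_A` in `Hᵏ(A, A ∩ B)`. For `B = ∅` this reads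
  `∂(u ∪ v|_A) = ∂u ∪ v` in `Hᵐ⁺ⁿ⁺¹(X, A)`. -/
  bdry_cup : ∀ {m n k : ℤ} {X : GSpace G} {A B : SubMulAction G X} (h : m + n = k)
    (h' : m + 1 + n = k + 1), ProperGCW X {A, B} →
    ∀ (u : T.H m (GSpace.sub A) ⊥) (v : T.H n X B)
      (z : T.H k (GSpace.sub (A ⊔ B)) (GSpace.traceOn (A ⊔ B) B)),
      T.map k (GMap.inclusion (le_sup_left : A ≤ A ⊔ B))
          (A := GSpace.traceOn A B) (fun _ hx => hx) z =
        cup h (bot_sup_eq _) u (T.map n (GMap.incl A) (fun _ hx => hx) v) →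
      T.bdry k (A ⊔ B) (T.map k (GMap.id _) (GMap.bot_mem _ _) z) =
        cup h' rfl (T.bdry m A u) v

/-- A proper equivariant cohomology theory with values in `R`-modules: a proper `G`-cohomology
theory for every (discrete) group `G`, linked by an induction structure. The pair
`ind_α (X, A) = (ind_α X, ind_α A)` is written `(ind_α X, C)` with `ind_α A = C`. -/
structure EquivariantCohomologyTheory (R : Type w) [CommRing R] where
  thy : ∀ (G : Type u) [Group G], GCohomologyTheory.{u, v, w} R G
  ind : ∀ {G H : Type u} [Group G] [Group H] (α : H →* G) (n : ℤ) {X : GSpace H}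
    {A : SubMulAction H X} {C : SubMulAction G (Ind α X)}, indSub α A = C →
    ((thy G).H n (Ind α X) C →ₗ[R] (thy H).H n X A)
  ind_natural : ∀ {G H : Type u} [Group G] [Group H] (α : H →* G) (n : ℤ) {X Y : GSpace H}
    {A : SubMulAction H X} {B : SubMulAction H Y} {C : SubMulAction G (Ind α X)}
    {D : SubMulAction G (Ind α Y)} (hC : indSub α A = C) (hD : indSub α B = D) (f : GMap X Y)
    (hf : ∀ x ∈ A, f x ∈ B) (hf' : ∀ x ∈ C, Ind.map α f x ∈ D),
    ProperGCWPair X A → ProperGCWPair Y B → ∀ d : (thy G).H n (Ind α Y) D,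
    ind α n hC ((thy G).map n (Ind.map α f) hf' d) = (thy H).map n f hf (ind α n hD d)
  /-- If `ker α` acts freely on `X`, then `ind_α` is bijective. -/
  ind_bijective : ∀ {G H : Type u} [Group G] [Group H] (α : H →* G) (n : ℤ) {X : GSpace H}
    {A : SubMulAction H X} {C : SubMulAction G (Ind α X)} (hC : indSub α A = C),
    ProperGCWPair X A → (∀ h ∈ α.ker, ∀ x : X, h • x = x → h = 1) →
    Function.Bijective (ind α n hC)
  ind_bdry : ∀ {G H : Type u} [Group G] [Group H] (α : H →* G) (n : ℤ) {X : GSpace H}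
    {A : SubMulAction H X}, ProperGCWPair X A →
    ∀ a : (thy G).H n (GSpace.sub (indSub α A)) ⊥,
      ind α (n + 1) (A := A) rfl ((thy G).bdry n (indSub α A) a) =
        (thy H).bdry n A (ind α n (indSub_bot α)
          ((thy G).map n (Ind.subMap α A) (GMap.bot_mem _ _) a))
  /-- Functoriality in `α`: `ind_{β ∘ α} = ind_α ∘ ind_β` under `ind_β (ind_α X) = ind_{β ∘ α} X`. -/
  ind_comp : ∀ {G H K : Type u} [Group G] [Group H] [Group K] (β : G →* K) (α : H →* G) (n : ℤ)
    {X : GSpace H} {A : SubMulAction H X} {C : SubMulAction G (Ind α X)}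
    {D : SubMulAction K (Ind β (Ind α X))} {E : SubMulAction K (Ind (β.comp α) X)}
    (hC : indSub α A = C) (hD : indSub β C = D) (hE : indSub (β.comp α) A = E)
    (hED : ∀ x ∈ E, Ind.assocMap β α X x ∈ D), ProperGCWPair X A →
    ∀ d : (thy K).H n (Ind β (Ind α X)) D,
      ind (β.comp α) n hE ((thy K).map n (Ind.assocMap β α X) hED d) =
        ind α n hC (ind β n hD d)
  /-- Compatibility with inner automorphisms. -/
  ind_conj : ∀ {G : Type u} [Group G] (g : G) (n : ℤ) {X : GSpace G} {A : SubMulAction G X}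
    {C : SubMulAction G (Ind (MulAut.conj g).toMonoidHom X)}
    (hC : indSub (MulAut.conj g).toMonoidHom A = C) (hAC : ∀ x ∈ A, Ind.conjMap g X x ∈ C),
    ProperGCWPair X A → ∀ c : (thy G).H n (Ind (MulAut.conj g).toMonoidHom X) C,
      ind (MulAut.conj g).toMonoidHom n hC c = (thy G).map n (Ind.conjMap g X) hAC c

/-- A proper equivariant cohomology theory with a multiplicative structure. -/
structure MultiplicativeCohomologyTheory (R : Type w) [CommRing R] extends
    EquivariantCohomologyTheory.{u, v, w} R where
  mul : ∀ (G : Type u) [Group G], (thy G).MulStructure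
  ind_cup : ∀ {G H : Type u} [Group G] [Group H] (α : H →* G) {m n k : ℤ} {X : GSpace H}
    {A B C : SubMulAction H X} {A' B' C' : SubMulAction G (Ind α X)} (h : m + n = k)
    (hC : A ⊔ B = C) (hC' : A' ⊔ B' = C') (hA' : indSub α A = A') (hB' : indSub α B = B')
    (hCC' : indSub α C = C'), ProperGCW X {A, B} →
    ∀ (a : (thy G).H m (Ind α X) A') (b : (thy G).H n (Ind α X) B'),
      ind α k hCC' ((mul G).cup h hC' a b) =
        (mul H).cup h hC (ind α m hA' a) (ind α n hB' b)
  ind_one : ∀ {G H : Type u} [Group G] [Group H] (α : H →* G) {X : GSpace H},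
    ProperGCWPair X ⊥ → ind α 0 (indSub_bot α) ((mul G).one (Ind α X)) = (mul H).one X

namespace MultiplicativeCohomologyTheory

variable {R : Type w} [CommRing R] (𝓗 : MultiplicativeCohomologyTheory.{u, v, w} R)
variable {G : Type u} [Group G]

/-- `𝓗ⁿ_G(X, A)`. -/
abbrev Rel (n : ℤ) (X : GSpace G) (A : SubMulAction G X) : Type v := (𝓗.thy G).H n X A

/-- `𝓗ⁿ_G(X)`. -/
abbrev Abs (n : ℤ) (X : GSpace G) : Type v := 𝓗.Rel n X ⊥

/-- `𝓗ⁿ_G(f) : 𝓗ⁿ_G(Y) → 𝓗ⁿ_G(X)`. -/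
def pull (n : ℤ) {X Y : GSpace G} (f : GMap X Y) : 𝓗.Abs n Y →ₗ[R] 𝓗.Abs n X :=
  (𝓗.thy G).map n f (f.bot_mem _)

/-- `ind_α : 𝓗ⁿ_G(ind_α X) → 𝓗ⁿ_H(X)`. -/
def indAbs {H : Type u} [Group H] (α : H →* G) (n : ℤ) (X : GSpace H) :
    𝓗.Abs n (Ind α X) →ₗ[R] 𝓗.Abs n X := 𝓗.ind α n (indSub_bot α)

/-- The product `𝓗⁰_G(X) × 𝓗ⁿ_G(X, A) → 𝓗ⁿ_G(X, A)`. -/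
def act (n : ℤ) {X : GSpace G} {A : SubMulAction G X} :
    𝓗.Abs 0 X →ₗ[R] 𝓗.Rel n X A →ₗ[R] 𝓗.Rel n X A :=
  (𝓗.mul G).cup (zero_add n) (bot_sup_eq _)

theorem act_act (n : ℤ) {X : GSpace G} {A : SubMulAction G X} (a b : 𝓗.Abs 0 X)
    (c : 𝓗.Rel n X A) : 𝓗.act n (𝓗.act 0 a b) c = 𝓗.act n a (𝓗.act n b c) := by
  by_cases h : ProperGCWPair X A
  · refine (𝓗.mul G).cup_assoc _ _ _ _ _ _ _ _ ?_ a b c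
    exact (ProperGCW.insert_bot h).mono (by simp)
  · exact ((𝓗.thy G).subsingleton_of_not n X A h).elim _ _

theorem one_act (n : ℤ) {X : GSpace G} {A : SubMulAction G X} (c : 𝓗.Rel n X A) :
    𝓗.act n ((𝓗.mul G).one X) c = c := by
  by_cases h : ProperGCWPair X A
  · exact (𝓗.mul G).one_cup _ _ h c
  · exact ((𝓗.thy G).subsingleton_of_not n X A h).elim _ _

theorem act_comm {X : GSpace G} (a b : 𝓗.Abs 0 X) : 𝓗.act 0 a b = 𝓗.act 0 b a := by
  by_cases h : ProperGCWPair X ⊥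
  · have := (𝓗.mul G).cup_comm (zero_add 0) (zero_add 0) (bot_sup_eq _) (bot_sup_eq _)
      (ProperGCW.mono h (by simp)) a b
    simpa [act] using this
  · exact ((𝓗.thy G).subsingleton_of_not 0 X ⊥ h).elim _ _

/-- The commutative ring `𝓗⁰_G(X)`. -/
instance (X : GSpace G) : CommRing (𝓗.Abs 0 X) :=
  { (𝓗.thy G).addCommGroup 0 X ⊥ with
    mul := fun a b => 𝓗.act 0 a b
    one := (𝓗.mul G).one X
    left_distrib := fun a b c => (𝓗.act 0 a).map_add b c
    right_distrib := fun a b c => by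
      change 𝓗.act 0 (a + b) c = _
      rw [map_add]
      rfl
    zero_mul := fun a => by
      change 𝓗.act 0 0 a = 0
      rw [map_zero]
      rfl
    mul_zero := fun a => (𝓗.act 0 a).map_zero
    mul_assoc := 𝓗.act_act 0
    one_mul := 𝓗.one_act 0
    mul_one := fun a => (𝓗.act_comm _ _).trans (𝓗.one_act 0 a)
    mul_comm := 𝓗.act_comm }

theorem mul_def {X : GSpace G} (a b : 𝓗.Abs 0 X) : a * b = 𝓗.act 0 a b := rfl

theorem one_def (X : GSpace G) : (1 : 𝓗.Abs 0 X) = (𝓗.mul G).one X := rfl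

theorem map_act (n : ℤ) {X Y : GSpace G} {A : SubMulAction G X} {B : SubMulAction G Y}
    (f : GMap X Y) (hf : ∀ x ∈ A, f x ∈ B) (hY : ProperGCWPair Y B) (a : 𝓗.Abs 0 Y)
    (b : 𝓗.Rel n Y B) :
    (𝓗.thy G).map n f hf (𝓗.act n a b) = 𝓗.act n (𝓗.pull 0 f a) ((𝓗.thy G).map n f hf b) := by
  by_cases h : ProperGCWPair X A
  · exact (𝓗.mul G).map_cup _ _ _ f _ _ _ (ProperGCW.insert_bot h) (ProperGCW.insert_bot hY) a b
  · exact ((𝓗.thy G).subsingleton_of_not n X A h).elim _ _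

/-- `𝓗⁰_G(f)` as a homomorphism of rings, for proper `G`-CW-complexes. -/
def pullRingHom {X Y : GSpace G} (f : GMap X Y) (hY : ProperGCWPair Y ⊥) :
    𝓗.Abs 0 Y →+* 𝓗.Abs 0 X where
  toFun := 𝓗.pull 0 f
  map_zero' := map_zero _
  map_add' := map_add _
  map_one' := by
    by_cases h : ProperGCWPair X ⊥
    · exact (𝓗.mul G).map_one f h hY
    · exact ((𝓗.thy G).subsingleton_of_not 0 X ⊥ h).elim _ _
  map_mul' := 𝓗.map_act 0 f (f.bot_mem _) hY

/-- `ind_α : 𝓗⁰_G(ind_α X) → 𝓗⁰_H(X)` is a homomorphism of rings. -/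
def indRingHom {H : Type u} [Group H] (α : H →* G) (X : GSpace H) :
    𝓗.Abs 0 (Ind α X) →+* 𝓗.Abs 0 X where
  toFun := 𝓗.indAbs α 0 X
  map_zero' := map_zero _
  map_add' := map_add _
  map_one' := by
    by_cases h : ProperGCWPair X ⊥
    · exact 𝓗.ind_one α h
    · exact ((𝓗.thy H).subsingleton_of_not 0 X ⊥ h).elim _ _
  map_mul' a b := by
    by_cases h : ProperGCWPair X ⊥
    · exact 𝓗.ind_cup α _ _ _ _ _ _ (ProperGCW.mono (𝒜 := {⊥}) h (by simp)) a b
    · exact ((𝓗.thy H).subsingleton_of_not 0 X ⊥ h).elim _ _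

/-- The coefficient ring `𝓗⁰(*)` of the non-equivariant theory `𝓗* = 𝓗*_{1}`. -/
abbrev Coeff : Type v := 𝓗.Abs 0 (GSpace.pt : GSpace PUnit.{u + 1})

/-- The homomorphism of rings `𝓗⁰(*) → 𝓗⁰(G\X) → 𝓗⁰_G(X)` given by the projection `G\X → *` and
by induction with `G → 1`. -/
def coeffMap (X : GSpace G) : 𝓗.Coeff →+* 𝓗.Abs 0 X :=
  (𝓗.indRingHom (1 : G →* PUnit.{u + 1}) X).comp
    (𝓗.pullRingHom (GMap.toPt (Ind (1 : G →* PUnit.{u + 1}) X)) ProperGCWPair.point)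

/-- The `𝓗⁰(*)`-module structure on `𝓗ⁿ_G(X, A)`. -/
instance (n : ℤ) (X : GSpace G) (A : SubMulAction G X) : Module 𝓗.Coeff (𝓗.Rel n X A) where
  smul c a := 𝓗.act n (𝓗.coeffMap X c) a
  one_smul a := by
    change 𝓗.act n (𝓗.coeffMap X 1) a = a
    rw [map_one]
    exact 𝓗.one_act n a
  mul_smul c d a := by
    change 𝓗.act n (𝓗.coeffMap X (c * d)) a = _
    rw [map_mul]
    exact 𝓗.act_act n _ _ a
  smul_zero c := (𝓗.act n (𝓗.coeffMap X c)).map_zero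
  smul_add c := (𝓗.act n (𝓗.coeffMap X c)).map_add
  add_smul c d a := by
    change 𝓗.act n (𝓗.coeffMap X (c + d)) a = _
    rw [map_add]
    exact congrArg (fun f => f a) ((𝓗.act n).map_add _ _)
  zero_smul a := by
    change 𝓗.act n (𝓗.coeffMap X 0) a = 0
    rw [map_zero]
    exact congrArg (fun f => f a) (𝓗.act n).map_zero

theorem coeff_smul_def (n : ℤ) {X : GSpace G} {A : SubMulAction G X} (c : 𝓗.Coeff)
    (a : 𝓗.Rel n X A) : c • a = 𝓗.act n (𝓗.coeffMap X c) a := rfl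

theorem pull_coeffMap {X Y : GSpace G} (f : GMap X Y) (hX : ProperGCWPair X ⊥)
    (hY : ProperGCWPair Y ⊥) (c : 𝓗.Coeff) :
    𝓗.pull 0 f (𝓗.coeffMap Y c) = 𝓗.coeffMap X c := by
  let α : G →* PUnit.{u + 1} := 1
  have h₁ := 𝓗.ind_natural α 0 (indSub_bot α) (indSub_bot α) f (f.bot_mem ⊥)
    ((Ind.map α f).bot_mem ⊥) hX hY (𝓗.pull 0 (GMap.toPt (Ind α Y)) c)
  have h₂ := (𝓗.thy PUnit.{u + 1}).map_comp 0 (Ind.map α f) (GMap.toPt (Ind α Y))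
    ((Ind.map α f).bot_mem ⊥) ((GMap.toPt (Ind α Y)).bot_mem ⊥) (hX.ind_bot α) (hY.ind_bot α)
    ProperGCWPair.point c
  exact h₁.symm.trans (congrArg (𝓗.indAbs α 0 X) h₂.symm)

theorem pull_coeff_smul (n : ℤ) {X Y : GSpace G} (f : GMap X Y) (c : 𝓗.Coeff)
    (y : 𝓗.Abs n Y) : 𝓗.pull n f (c • y) = c • 𝓗.pull n f y := by
  by_cases hY : ProperGCWPair Y ⊥
  · by_cases hX : ProperGCWPair X ⊥
    · rw [coeff_smul_def, coeff_smul_def, ← 𝓗.pull_coeffMap f hX hY]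
      exact 𝓗.map_act n f (f.bot_mem _) hY _ y
    · exact ((𝓗.thy G).subsingleton_of_not n X ⊥ hX).elim _ _
  · have := (𝓗.thy G).subsingleton_of_not n Y ⊥ hY
    rw [Subsingleton.elim (c • y) 0, Subsingleton.elim y 0, map_zero, smul_zero]

/-- `𝓗ⁿ_G(f)` as a homomorphism of `𝓗⁰(*)`-modules. -/
def pullCoeff (n : ℤ) {X Y : GSpace G} (f : GMap X Y) :
    𝓗.Abs n Y →ₗ[𝓗.Coeff] 𝓗.Abs n X where
  toFun := 𝓗.pull n f
  map_add' := map_add _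
  map_smul' := 𝓗.pull_coeff_smul n f

/-- For `x ∈ X` the composite `𝓗⁰_G(X) → 𝓗⁰_G(G) → 𝓗⁰(*)` of `𝓗⁰_G(g ↦ g • x)` and of induction
with `1 → G`. -/
def pointEval {X : GSpace G} (x : X) (a : 𝓗.Abs 0 X) : 𝓗.Coeff :=
  𝓗.indRingHom (1 : PUnit.{u + 1} →* G) GSpace.pt (𝓗.pull 0 (GSpace.orbitMap x) a)

/-- The augmentation ideal `𝕀_G(X) ⊆ 𝓗⁰_G(X)`: the kernel of the product over all `x ∈ X` of the
maps `pointEval x`. (These maps only depend on the class of `x` in `G\π₀(X)`.) -/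
def augmentationIdeal (X : GSpace G) : Ideal (𝓗.Abs 0 X) where
  carrier := {a | ∀ x : X, 𝓗.pointEval x a = 0}
  add_mem' {a b} ha hb x := by
    have : 𝓗.pointEval x (a + b) = 𝓗.pointEval x a + 𝓗.pointEval x b := by
      unfold pointEval
      exact (congrArg _ (map_add (𝓗.pull 0 (GSpace.orbitMap x)) a b)).trans (map_add _ _ _)
    rw [this, ha x, hb x, add_zero]
  zero_mem' x := by
    unfold pointEval
    exact (congrArg _ (map_zero (𝓗.pull 0 (GSpace.orbitMap x)))).trans (map_zero _)
  smul_mem' b a ha x := by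
    by_cases h : ProperGCWPair X ⊥
    · have h₁ : 𝓗.pointEval x (b * a) = 𝓗.pointEval x b * 𝓗.pointEval x a := by
        unfold pointEval
        exact (congrArg _ (map_mul (𝓗.pullRingHom (GSpace.orbitMap x) h) b a)).trans
          (map_mul _ _ _)
      change 𝓗.pointEval x (b * a) = 0
      rw [h₁, ha x, mul_zero]
    · have := (𝓗.thy G).subsingleton_of_not 0 X ⊥ h
      rw [Subsingleton.elim (b • a) a]
      exact ha x

/-- For a `G`-map `f : X → L` the submodule `𝕀_G(L)ⁿ · 𝓗ᵐ_G(X)` of `𝓗ᵐ_G(X)`, where `𝓗⁰_G(L)`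
acts on `𝓗ᵐ_G(X)` through `f`. -/
def powSubmodule {X L : GSpace G} (f : GMap X L) (m : ℤ) (n : ℕ) :
    Submodule 𝓗.Coeff (𝓗.Abs m X) :=
  Submodule.span 𝓗.Coeff
    {y | ∃ a ∈ 𝓗.augmentationIdeal L ^ n, ∃ x, y = 𝓗.act m (𝓗.pull 0 f a) x}

theorem powSubmodule_succ_le {X L : GSpace G} (f : GMap X L) (m : ℤ) (n : ℕ) :
    𝓗.powSubmodule f m (n + 1) ≤ 𝓗.powSubmodule f m n := by
  refine Submodule.span_mono ?_
  rintro y ⟨a, ha, x, rfl⟩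
  exact ⟨a, Ideal.pow_le_pow_right (Nat.le_succ n) ha, x, rfl⟩

end MultiplicativeCohomologyTheory

/-! ### Pro-modules -/

/-- A pro-`S`-module indexed by the positive integers, that is, an inverse system
`M₁ ← M₂ ← M₃ ← ⋯` of `S`-modules; `obj k` is `M_{k+1}`. -/
structure ProModule (S : Type v) [CommRing S] where
  obj : ℕ → Type v
  [addCommGroup : ∀ k, AddCommGroup (obj k)]
  [module : ∀ k, Module S (obj k)]
  map : ∀ k, obj (k + 1) →ₗ[S] obj k

attribute [instance] ProModule.addCommGroup ProModule.module

/-- The composite structure map from `obj (k + d)` to `obj k`. -/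
def ProModule.trans {S : Type v} [CommRing S] (M : ProModule S) (k : ℕ) :
    ∀ d : ℕ, M.obj (k + d) →ₗ[S] M.obj k
  | 0 => LinearMap.id
  | d + 1 => (ProModule.trans M k d).comp (M.map (k + d))

/-- A strict homomorphism of pro-modules. -/
structure StrictProHom {S : Type v} [CommRing S] (M N : ProModule S) where
  app : ∀ k, M.obj k →ₗ[S] N.obj k
  comm : ∀ k (x : M.obj (k + 1)), N.map k (app (k + 1) x) = app k (M.map k x)

/-- A strict homomorphism is a pro-isomorphism if its levelwise kernel and its levelwise cokernel
are pro-trivial. -/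
def StrictProHom.IsProIso {S : Type v} [CommRing S] {M N : ProModule S}
    (l : StrictProHom M N) : Prop :=
  (∀ k, ∃ d, ∀ x : M.obj (k + d), l.app (k + d) x = 0 → M.trans k d x = 0) ∧
    ∀ k, ∃ d, ∀ y : N.obj (k + d), ∃ x : M.obj k, l.app k x = N.trans k d y

/-! ### The completion map -/

section Completion

variable {G : Type u} [Group G]

/-- The `k`-skeleton `⋃_{p + q = k} X_p × Y_q` of the product of two `G`-CW-complexes. -/
def prodSkel {X Y : GSpace G} (S : GCWStructure X) (T : GCWStructure Y) (k : ℕ) :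
    SubMulAction G (X.prod Y) where
  carrier := {z : X × Y | ∃ p q, p + q = k ∧ z.1 ∈ S.skel p ∧ z.2 ∈ T.skel q}
  smul_mem' g _ := by
    rintro ⟨p, q, h, hp, hq⟩
    exact ⟨p, q, h, (S.skel p).smul_mem g hp, (T.skel q).smul_mem g hq⟩

theorem prodSkel_succ_le {X Y : GSpace G} (S : GCWStructure X) (T : GCWStructure Y) (k : ℕ) :
    prodSkel S T k ≤ prodSkel S T (k + 1) := by
  rintro z ⟨p, q, h, hp, hq⟩
  exact ⟨p + 1, q, by omega, S.skel_mono (Nat.le_succ p) hp, hq⟩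

/-- The Borel construction `EG ×_G X = G\(EG × X)`, a space with an action of the trivial group. -/
def borelConstruction (E : ClassifyingSpace G) (X : GSpace G) : GSpace PUnit.{u + 1} :=
  Ind (1 : G →* PUnit.{u + 1}) (E.space.prod X)

/-- The `k`-skeleton `(EG ×_G X)_{(k)}`. -/
def borelSkel (E : ClassifyingSpace G) {X : GSpace G} (S : GCWStructure X) (k : ℕ) :
    (borelConstruction E X).Invariant :=
  indSub (1 : G →* PUnit.{u + 1}) (prodSkel E.cw S k)

theorem borelSkel_succ_le (E : ClassifyingSpace G) {X : GSpace G} (S : GCWStructure X) (k : ℕ) :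
    borelSkel E S k ≤ borelSkel E S (k + 1) := indSub_mono _ (prodSkel_succ_le _ _ k)

/-- The family `𝓕(L)` of the subgroups `H` of `G` with `L^H ≠ ∅`. -/
def fixedFamily (L : GSpace G) : Set (Subgroup G) := {H | ∃ x : L, ∀ h ∈ H, h • x = x}

variable {R : Type w} [CommRing R] (𝓗 : MultiplicativeCohomologyTheory.{u, v, w} R)

/-- The pro-`𝓗⁰(*)`-module `{𝓗ᵐ_G(X) / 𝕀_G(L)ⁿ · 𝓗ᵐ_G(X)}_{n ≥ 1}`. -/
def completionSource {X L : GSpace G} (f : GMap X L) (m : ℤ) : ProModule 𝓗.Coeff where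
  obj k := 𝓗.Abs m X ⧸ 𝓗.powSubmodule f m (k + 1)
  map k := Submodule.factor (𝓗.powSubmodule_succ_le f m (k + 1))

/-- The pro-`𝓗⁰(*)`-module `{𝓗ᵐ((EG ×_G X)_{(n-1)})}_{n ≥ 1}`. -/
def completionTarget (E : ClassifyingSpace G) {X : GSpace G} (S : GCWStructure X) (m : ℤ) :
    ProModule 𝓗.Coeff where
  obj k := 𝓗.Abs m (GSpace.sub (borelSkel E S k))
  map k := 𝓗.pullCoeff m (GMap.inclusion (borelSkel_succ_le E S k))

/-- `l` is the map `λᵐ_G(f : X → L)`: it sends the class of `x ∈ 𝓗ᵐ_G(X)` to the restriction to the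
skeleton of the class `y ∈ 𝓗ᵐ(EG ×_G X)` which corresponds to the pullback of `x` under the
projection `EG × X → X` by the isomorphism `ind_{G → 1} : 𝓗ᵐ(EG ×_G X) ≅ 𝓗ᵐ_G(EG × X)`. -/
def IsCompletionMap (E : ClassifyingSpace G) {X L : GSpace G} (S : GCWStructure X)
    (f : GMap X L) (m : ℤ)
    (l : StrictProHom (completionSource 𝓗 f m) (completionTarget 𝓗 E S m)) : Prop :=
  ∀ (k : ℕ) (x : 𝓗.Abs m X) (y : 𝓗.Abs m (borelConstruction E X)),
    𝓗.indAbs (1 : G →* PUnit.{u + 1}) m (E.space.prod X) y =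
        𝓗.pull m (GMap.snd E.space X) x →
      l.app k (Submodule.Quotient.mk x) = 𝓗.pull m (GMap.incl (borelSkel E S k)) y

end Completion

/-! ### Comparison maps of filtered modules with inverse systems -/

/-! Write `EG_k` for the `k`-skeleton of `EG`. Since `G` acts freely on `EG × X`, induction
identifies the cohomology of the skeleta of `EG ×_G X` with the equivariant cohomology of the
skeleta of `EG × X` (`borelMap_bijective`). If `X` has dimension less than `N`, these skeleta are
interleaved, up to a shift by `N`, with the products `EG_k × X` (`isProIso_of_isGoodPair`). The
products are functorial in `X` and make sense for pairs. So the theorem becomes a statement about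
all finite proper pairs `(X, A)` over `L`: the projections `EG_k × (X, A) → (X, A)` induce a
pro-isomorphism from the `𝕀_G(L)`-adic quotients of `𝓗ᵐ_G(X, A)`, and this module is Noetherian over
`𝓗⁰_G(L)`. Such a comparison is called good.

Good comparisons obey a five lemma (`Comparison.IsGood.five`). Passing to adic quotients is not
exact, and the Artin–Rees lemma repairs this. The ring `𝓗⁰_G(L)` itself need not be Noetherian, so
Artin–Rees is applied over its quotient by the annihilator of a Noetherian module. The five lemma
requires beforehand that the projection to `EG_k × X` kills a power of `𝕀_G(L)`. This is the
nilpotency theorem `pull_eq_zero_of_mem_pow`: on a free complex of dimension less than `k` mapping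
to a finite proper complex `X`, the ideal `𝕀_G(X)ᵏ` vanishes, each factor taking care of one
dimension. There is no disjoint union axiom, so infinitely many free cells are treated at once, by
factoring their map to `X` up to homotopy through a finite union of copies of `G`. Nilpotency also
makes the completion map well defined.

The five lemma, excision and homotopy invariance reduce the theorem, by induction over cells, to
orbits `G/H` with `H` finite (`isGoodPair_of_orbits`). There the induction isomorphism leads to the
completion theorem for `H` and the restriction of `EG` to `H`, but with the `𝕀(H)`-adic filtration.
The condition on prime ideals puts `𝕀(H)` into the radical of the ideal generated by `𝕀_G(L)`, and
by Noetherianity a power of `𝕀(H)` lies in that ideal (`isGoodPair_orbit`).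

The axioms apply only to CW-pairs and actual pushouts, so cell structures are needed on discs,
subcomplexes, restrictions to subgroups and products. For products the point is that a finite proper
complex is locally finite: the map from the disjoint union of all its closed cells is proper. -/

theorem Module.isNoetherianRing_quotient_annihilator (Λ M : Type*) [CommRing Λ] [AddCommGroup M]
    [Module Λ M] [IsNoetherian Λ M] : IsNoetherianRing (Λ ⧸ Module.annihilator Λ M) := by
  obtain ⟨s, hs⟩ := IsNoetherian.noetherian (⊤ : Submodule Λ M)
  -- Evaluation on finitely many generators embeds the quotient by the annihilator into a finite
  -- power of `M`.
  let φ : Λ →ₗ[Λ] (s → M) := LinearMap.pi fun i => LinearMap.toSpanSingleton Λ M i.1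
  have hker : LinearMap.ker φ = Module.annihilator Λ M := by
    ext r
    rw [LinearMap.mem_ker, Module.mem_annihilator]
    constructor
    · intro h m
      have hm : m ∈ Submodule.span Λ (s : Set M) := hs ▸ Submodule.mem_top
      induction hm using Submodule.span_induction with
      | mem x hx => exact congrFun h ⟨x, hx⟩
      | zero => exact smul_zero r
      | add x y _ _ hx hy => rw [smul_add, hx, hy, add_zero]
      | smul a x _ hx => rw [smul_comm, hx, smul_zero]
    · exact fun h => funext fun i => h i.1
  have : IsNoetherian Λ (Λ ⧸ Module.annihilator Λ M) := by
    rw [← hker]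
    exact isNoetherian_of_injective ((LinearMap.ker φ).liftQ φ le_rfl)
      (LinearMap.ker_eq_bot.1 (Submodule.ker_liftQ_eq_bot _ _ _ le_rfl))
  exact isNoetherianRing_iff.2 (isNoetherian_of_tower Λ this)

/-- The Artin–Rees lemma for a Noetherian module over an arbitrary commutative ring. -/
theorem Ideal.exists_pow_smul_top_inf_le {Λ M : Type*} [CommRing Λ] [AddCommGroup M]
    [Module Λ M] [IsNoetherian Λ M] (𝔞 : Ideal Λ) (N : Submodule Λ M) (j : ℕ) :
    ∃ i, 𝔞 ^ i • ⊤ ⊓ N ≤ 𝔞 ^ j • N := by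
  -- Over this quotient ring, which is Noetherian, the classical Artin–Rees lemma is available; the
  -- submodules of `M` and the action of powers of `𝔞` do not change.
  let _ : Module (Λ ⧸ Module.annihilator Λ M) M := Module.quotientAnnihilator
  have hR := Module.isNoetherianRing_quotient_annihilator Λ M
  have htower : IsScalarTower Λ (Λ ⧸ Module.annihilator Λ M) M := by
    refine ⟨fun a b x => ?_⟩
    obtain ⟨b, rfl⟩ := Ideal.Quotient.mk_surjective b
    exact mul_smul a b x
  have hfin : Module.Finite (Λ ⧸ Module.annihilator Λ M) M :=
    Module.Finite.of_restrictScalars_finite Λ _ M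
  let N' : Submodule (Λ ⧸ Module.annihilator Λ M) M :=
    { N with
      smul_mem' := by
        intro c x hx
        obtain ⟨c, rfl⟩ := Ideal.Quotient.mk_surjective c
        exact N.smul_mem c hx }
  let J := 𝔞.map (algebraMap Λ (Λ ⧸ Module.annihilator Λ M))
  obtain ⟨k, hk⟩ := J.exists_pow_inf_eq_pow_smul N'
  -- Beyond the Artin–Rees index `k` the intersection equals `J ^ j` times the intersection at level
  -- `k`.
  refine ⟨k + j, ?_⟩
  have h₁ : J ^ (k + j) • ⊤ ⊓ N' ≤ J ^ j • N' := by
    rw [hk _ (Nat.le_add_right k j), Nat.add_sub_cancel_left]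
    exact Submodule.smul_mono le_rfl inf_le_right
  have key : ∀ (i : ℕ) (P : Submodule (Λ ⧸ Module.annihilator Λ M) M),
      𝔞 ^ i • P.restrictScalars Λ = (J ^ i • P).restrictScalars Λ := by
    intro i P
    rw [← Ideal.map_pow, ← Ideal.smul_restrictScalars]
  have e₁ := key (k + j) ⊤
  have e₂ := key j N'
  have hN : N'.restrictScalars Λ = N := rfl
  rw [Submodule.restrictScalars_top] at e₁
  rw [hN] at e₂
  rw [e₁, e₂]
  exact fun x hx => h₁ hx

/-- A module together with compatible maps to the members of an inverse system of abelian groups. -/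
structure Comparison (Λ : Type v) [CommRing Λ] where
  source : Type v
  [addCommGroup : AddCommGroup source]
  [module : Module Λ source]
  target : ℕ → Type v
  [targetGroup : ∀ k, AddCommGroup (target k)]
  res : ∀ {j k : ℕ}, j ≤ k → target k →+ target j
  res_res : ∀ {i j k : ℕ} (h : i ≤ j) (h' : j ≤ k) (x : target k),
    res h (res h' x) = res (h.trans h') x
  app : ∀ k, source →+ target k
  res_app : ∀ {j k : ℕ} (h : j ≤ k) (x : source), res h (app k x) = app j x

/-! ### Good comparisons and the five lemma for adic filtrations -/

namespace Comparison

attribute [instance] Comparison.addCommGroup Comparison.module Comparison.targetGroup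

variable {Λ : Type v} [CommRing Λ]

/-- A morphism of comparisons. -/
structure Hom (c d : Comparison Λ) where
  src : c.source →ₗ[Λ] d.source
  tgt : ∀ k, c.target k →+ d.target k
  tgt_res : ∀ {j k : ℕ} (h : j ≤ k) (x : c.target k), tgt j (c.res h x) = d.res h (tgt k x)
  tgt_app : ∀ k (x : c.source), tgt k (c.app k x) = d.app k (src x)

/-- Levelwise exactness of two composable morphisms. -/
structure Exact {c d e : Comparison Λ} (f : Hom c d) (g : Hom d e) : Prop where
  src : Function.Exact f.src g.src
  tgt : ∀ k, Function.Exact (f.tgt k) (g.tgt k)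

/-- Each map of the comparison kills a power of `𝔞`. -/
def IsContinuous (𝔞 : Ideal Λ) (c : Comparison Λ) : Prop :=
  ∀ k, ∃ d, ∀ x ∈ 𝔞 ^ d • (⊤ : Submodule Λ c.source), c.app k x = 0

/-- The comparison induces an isomorphism of pro-groups from the system of the quotients of the
source by the powers of `𝔞`, and the source is Noetherian. -/
structure IsGood (𝔞 : Ideal Λ) (c : Comparison Λ) : Prop where
  noetherian : IsNoetherian Λ c.source
  continuous : c.IsContinuous 𝔞
  mono : ∀ j, ∃ k, ∀ x : c.source, c.app k x = 0 → x ∈ 𝔞 ^ j • (⊤ : Submodule Λ c.source)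
  epi : ∀ k, ∃ k', ∃ h : k ≤ k', ∀ y : c.target k', ∃ x, c.app k x = c.res h y

theorem pow_smul_top_antitone {M : Type*} [AddCommGroup M] [Module Λ M] (𝔞 : Ideal Λ) {i j : ℕ}
    (h : i ≤ j) : 𝔞 ^ j • (⊤ : Submodule Λ M) ≤ 𝔞 ^ i • ⊤ :=
  Submodule.smul_mono_left (Ideal.pow_le_pow_right h)

theorem map_mem_pow_smul_top {M N : Type*} [AddCommGroup M] [Module Λ M] [AddCommGroup N]
    [Module Λ N] (𝔞 : Ideal Λ) (f : M →ₗ[Λ] N) {i : ℕ} {x : M}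
    (hx : x ∈ 𝔞 ^ i • (⊤ : Submodule Λ M)) : f x ∈ 𝔞 ^ i • (⊤ : Submodule Λ N) := by
  have := Submodule.mem_map_of_mem (f := f) hx
  rw [Submodule.map_smul''] at this
  exact Submodule.smul_mono le_rfl le_top this

theorem exists_map_eq_of_mem_pow_smul_range {M N : Type*} [AddCommGroup M] [Module Λ M]
    [AddCommGroup N] [Module Λ N] (𝔞 : Ideal Λ) (f : M →ₗ[Λ] N) {i : ℕ} {y : N}
    (hy : y ∈ 𝔞 ^ i • LinearMap.range f) : ∃ x ∈ 𝔞 ^ i • (⊤ : Submodule Λ M), f x = y := by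
  rw [LinearMap.range_eq_map, ← Submodule.map_smul''] at hy
  exact hy

/-- The five lemma. -/
theorem IsGood.five {𝔞 : Ideal Λ} {c₁ c₂ c₃ c₄ c₅ : Comparison Λ} {a : Hom c₁ c₂} {b : Hom c₂ c₃}
    {d : Hom c₃ c₄} {e : Hom c₄ c₅} (hab : Exact a b) (hbd : Exact b d) (hde : Exact d e)
    (h₁ : c₁.IsGood 𝔞) (h₂ : c₂.IsGood 𝔞) (h₃ : c₃.IsContinuous 𝔞) (h₄ : c₄.IsGood 𝔞)
    (h₅ : c₅.IsGood 𝔞) : c₃.IsGood 𝔞 where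
  noetherian := by
    have := h₂.noetherian
    have := h₄.noetherian
    exact isNoetherian_of_range_eq_ker b.src d.src hbd.src.linearMap_ker_eq.symm
  continuous := h₃
  mono j := by
    have := h₄.noetherian
    obtain ⟨k₂, hk₂⟩ := h₂.mono j
    obtain ⟨k₁, hk₁, H₁⟩ := h₁.epi k₂
    obtain ⟨j₁, hj₁⟩ := h₃ k₁
    -- Artin–Rees turns deep membership of `d x` in `c₄` into a lift `x'` lying deep in `c₃`. The
    -- exponent `j` puts `x'` into the desired submodule, and `j₁` makes `x'` invisible at level
    -- `k₁`.
    obtain ⟨i, hi⟩ := 𝔞.exists_pow_smul_top_inf_le (LinearMap.range d.src) (max j j₁)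
    obtain ⟨k₄, hk₄⟩ := h₄.mono i
    refine ⟨max k₁ k₄, fun x hx => ?_⟩
    have hx₁ : c₃.app k₁ x = 0 := by
      rw [← c₃.res_app (le_max_left k₁ k₄), hx, map_zero]
    have hx₄ : c₃.app k₄ x = 0 := by
      rw [← c₃.res_app (le_max_right k₁ k₄), hx, map_zero]
    have hdx := hi ⟨hk₄ (d.src x) (by rw [← d.tgt_app, hx₄, map_zero]), x, rfl⟩
    obtain ⟨x', hx', hdx'⟩ := exists_map_eq_of_mem_pow_smul_range 𝔞 d.src hdx
    -- The remainder `x - x'` comes from `c₂`. Its preimage `y` can be corrected by an element of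
    -- `c₁` so that it vanishes at level `k₂`, hence lies in `𝔞 ^ j`.
    obtain ⟨y, hy⟩ := (hbd.src (x - x')).1 (by rw [map_sub, hdx', sub_self])
    have hy₁ : b.tgt k₁ (c₂.app k₁ y) = 0 := by
      rw [b.tgt_app, hy, map_sub, hx₁, hj₁ x' (pow_smul_top_antitone 𝔞 (le_max_right _ _) hx'),
        sub_zero]
    obtain ⟨z, hz⟩ := ((hab.tgt k₁) _).1 hy₁
    obtain ⟨w, hw⟩ := H₁ z
    have hyw : c₂.app k₂ (y - a.src w) = 0 := by
      rw [map_sub, ← a.tgt_app, hw, a.tgt_res, hz, c₂.res_app, sub_self]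
    have hby := map_mem_pow_smul_top 𝔞 b.src (hk₂ _ hyw)
    rw [map_sub, hab.src.apply_apply_eq_zero, sub_zero, hy] at hby
    have := Submodule.add_mem _ hby (pow_smul_top_antitone 𝔞 (le_max_left j j₁) hx')
    rwa [sub_add_cancel] at this
  epi k := by
    have := h₅.noetherian
    obtain ⟨k₂, hk₂, H₂⟩ := h₂.epi k
    obtain ⟨j, hj⟩ := h₄.continuous k₂
    -- A preimage `m₄` of `d y` need not be killed by `e`, only mapped deep into `c₅`. By Artin–Rees
    -- it can be changed by an element of `𝔞 ^ j`, invisible at level `k₂`, so that it lifts to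
    -- `c₃`.
    obtain ⟨i, hi⟩ := 𝔞.exists_pow_smul_top_inf_le (LinearMap.range e.src) j
    obtain ⟨k₅, hk₅⟩ := h₅.mono i
    obtain ⟨k₄, hk₄, H₄⟩ := h₄.epi (max k₂ k₅)
    refine ⟨k₄, hk₂.trans ((le_max_left _ _).trans hk₄), fun y => ?_⟩
    obtain ⟨m₄, hm₄⟩ := H₄ (d.tgt k₄ y)
    have he : c₅.app k₅ (e.src m₄) = 0 := by
      have h : e.tgt _ (c₄.app (max k₂ k₅) m₄) = 0 := by
        rw [hm₄, ← d.tgt_res, (hde.tgt _).apply_apply_eq_zero]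
      rw [← c₅.res_app (le_max_right k₂ k₅), ← e.tgt_app, h, map_zero]
    obtain ⟨m₄', hm₄', hem₄⟩ := exists_map_eq_of_mem_pow_smul_range 𝔞 e.src
      (hi ⟨hk₅ _ he, m₄, rfl⟩)
    obtain ⟨m₃, hm₃⟩ := (hde.src (m₄ - m₄')).1 (by rw [map_sub, hem₄, sub_self])
    have hy : d.tgt k₂ (c₃.res ((le_max_left _ _).trans hk₄) y - c₃.app k₂ m₃) = 0 := by
      rw [map_sub, d.tgt_app, hm₃, map_sub, hj m₄' hm₄', sub_zero, d.tgt_res,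
        ← c₄.res_app (le_max_left k₂ k₅), hm₄, c₄.res_res, sub_self]
    obtain ⟨z, hz⟩ := ((hbd.tgt k₂) _).1 hy
    obtain ⟨m₂, hm₂⟩ := H₂ z
    refine ⟨b.src m₂ + m₃, ?_⟩
    rw [map_add, ← b.tgt_app, hm₂, b.tgt_res, hz, map_sub, c₃.res_res, c₃.res_app, sub_add_cancel]

/-- Goodness is invariant under isomorphism. -/
theorem IsGood.of_bijective {𝔞 : Ideal Λ} {c d : Comparison Λ} (f : Hom c d)
    (hs : Function.Bijective f.src) (ht : ∀ k, Function.Bijective (f.tgt k)) (h : c.IsGood 𝔞) :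
    d.IsGood 𝔞 where
  noetherian := by
    have := h.noetherian
    exact isNoetherian_of_surjective f.src (LinearMap.range_eq_top.2 hs.2)
  continuous k := by
    obtain ⟨i, hi⟩ := h.continuous k
    refine ⟨i, fun x hx => ?_⟩
    rw [← LinearMap.range_eq_top.2 hs.2] at hx
    obtain ⟨y, hy, rfl⟩ := exists_map_eq_of_mem_pow_smul_range 𝔞 f.src hx
    rw [← f.tgt_app, hi y hy, map_zero]
  mono j := by
    obtain ⟨k, hk⟩ := h.mono j
    refine ⟨k, fun x hx => ?_⟩
    obtain ⟨y, rfl⟩ := hs.2 x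
    rw [← f.tgt_app] at hx
    exact map_mem_pow_smul_top 𝔞 f.src (hk y ((ht k).1 (hx.trans (map_zero _).symm)))
  epi k := by
    obtain ⟨k', hk, H⟩ := h.epi k
    refine ⟨k', hk, fun y => ?_⟩
    obtain ⟨z, rfl⟩ := (ht k').2 y
    obtain ⟨x, hx⟩ := H z
    exact ⟨f.src x, by rw [← f.tgt_app, hx, f.tgt_res]⟩

theorem IsGood.of_bijective' {𝔞 : Ideal Λ} {c d : Comparison Λ} (f : Hom c d)
    (hs : Function.Bijective f.src) (ht : ∀ k, Function.Bijective (f.tgt k)) (h : d.IsGood 𝔞) :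
    c.IsGood 𝔞 := by
  let g : Hom d c :=
    { src := (LinearEquiv.ofBijective f.src hs).symm.toLinearMap
      tgt := fun k => (AddEquiv.ofBijective (f.tgt k) (ht k)).symm.toAddMonoidHom
      tgt_res := fun {j k} hjk x => by
        refine (AddEquiv.symm_apply_eq (AddEquiv.ofBijective (f.tgt j) (ht j))).2 ?_
        refine Eq.trans ?_ (f.tgt_res hjk _).symm
        exact congrArg _ ((AddEquiv.ofBijective (f.tgt k) (ht k)).apply_symm_apply x).symm
      tgt_app := fun k x => by
        refine (AddEquiv.symm_apply_eq (AddEquiv.ofBijective (f.tgt k) (ht k))).2 ?_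
        refine Eq.trans ?_ (f.tgt_app k _).symm
        exact congrArg _ ((LinearEquiv.ofBijective f.src hs).apply_symm_apply x).symm }
  exact h.of_bijective g (LinearEquiv.ofBijective f.src hs).symm.bijective
    fun k => (AddEquiv.ofBijective (f.tgt k) (ht k)).symm.bijective

end Comparison

/-! ### Skeleta and subcomplexes -/

namespace GCWStructure

variable {G : Type u} [Group G] {X : GSpace G}

/-- The union of the cells of dimension less than `n`. -/
def skelLT (S : GCWStructure X) (n : ℕ) : SubMulAction G X where
  carrier := {y | ∃ k < n, ∃ (e : S.cell k) (g : G) (x : Disc k), y = g • S.char e x}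
  smul_mem' a y := by
    rintro ⟨k, hk, e, g, x, rfl⟩
    exact ⟨k, hk, e, a * g, x, (mul_smul a g _).symm⟩

theorem norm_le_one {n : ℕ} (x : Disc n) : ‖x.1‖ ≤ 1 := mem_closedBall_zero_iff.1 x.2

theorem skelLT_succ (S : GCWStructure X) (n : ℕ) : S.skelLT (n + 1) = S.skel n := by
  ext y
  exact exists_congr fun k => and_congr_left fun _ => Nat.lt_succ_iff

theorem skelLT_mono (S : GCWStructure X) : Monotone S.skelLT := by
  rintro m n hmn y ⟨k, hk, h⟩
  exact ⟨k, hk.trans_le hmn, h⟩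

/-- Every point is an interior point of a cell, whose dimension is bounded by that of any cell
containing the point. -/
theorem exists_interior (S : GCWStructure X) {n : ℕ} (e : S.cell n) (g : G) (x : Disc n) :
    ∃ k ≤ n, ∃ (e' : S.cell k) (g' : G) (x' : Disc k), ‖x'.1‖ < 1 ∧
      g • S.char e x = g' • S.char e' x' := by
  induction n using Nat.strong_induction_on generalizing g with
  | _ n ih =>
    rcases (norm_le_one x).lt_or_eq with hx | hx
    · exact ⟨n, le_rfl, e, g, x, hx, rfl⟩
    · obtain ⟨k, hk, e', a, x', h⟩ := S.boundary e x hx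
      obtain ⟨l, hl, e'', b, x'', h', h''⟩ := ih k hk e' (g * a) x'
      exact ⟨l, hl.trans hk.le, e'', b, x'', h', by rw [h, ← mul_smul, h'']⟩

theorem exists_interior' (S : GCWStructure X) (y : X) :
    ∃ (k : ℕ) (e' : S.cell k) (g' : G) (x' : Disc k), ‖x'.1‖ < 1 ∧ y = g' • S.char e' x' := by
  obtain ⟨n, e, g, x, rfl⟩ := S.cover y
  obtain ⟨k, -, h⟩ := S.exists_interior e g x
  exact ⟨k, h⟩

theorem smul_interior_inj (S : GCWStructure X) {n k : ℕ} (e : S.cell n) (e' : S.cell k)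
    (x : Disc n) (x' : Disc k) (g g' : G) (hx : ‖x.1‖ < 1) (hx' : ‖x'.1‖ < 1)
    (h : g • S.char e x = g' • S.char e' x') :
    (⟨n, e, x⟩ : Σ n, S.cell n × Disc n) = ⟨k, e', x'⟩ ∧ g'⁻¹ * g ∈ S.stab e :=
  S.interior_inj e e' x x' (g'⁻¹ * g) hx hx' (by rw [mul_smul, h, inv_smul_smul])

/-- The point on the right is an interior point of some cell of dimension at most `k`, and the open
cell containing a point is unique up to translation. -/
theorem dim_le (S : GCWStructure X) {n k : ℕ} {e : S.cell n} {e' : S.cell k}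
    {x : Disc n} {x' : Disc k} {g g' : G} (hx : ‖x.1‖ < 1)
    (h : g • S.char e x = g' • S.char e' x') : n ≤ k := by
  obtain ⟨l, hl, e'', a, x'', hx'', h''⟩ := S.exists_interior e' g' x'
  obtain ⟨h₁, -⟩ := S.smul_interior_inj e e'' x x'' g a hx hx'' (h.trans h'')
  exact (congrArg Sigma.fst h₁).le.trans hl

theorem char_mem_skelLT_of_norm (S : GCWStructure X) {n : ℕ} (e : S.cell n) (x : Disc n)
    (hx : ‖x.1‖ = 1) : S.char e x ∈ S.skelLT n := S.boundary e x hx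

theorem norm_eq_one_of_mem_skelLT (S : GCWStructure X) {n : ℕ} (e : S.cell n) (x : Disc n) (g : G)
    (h : g • S.char e x ∈ S.skelLT n) : ‖x.1‖ = 1 := by
  obtain ⟨k, hk, e', a, x', h⟩ := h
  by_contra hx
  exact hk.not_ge (S.dim_le ((norm_le_one x).lt_of_ne hx) h)

theorem smul_char_mem_iff {S : GCWStructure X} {A : SubMulAction G X} {n : ℕ} {e : S.cell n}
    {g : G} {x : Disc n} : g • S.char e x ∈ A ↔ S.char e x ∈ A := SubMulAction.smul_mem_iff' A g

theorem isSubcomplex_skelLT (S : GCWStructure X) (n : ℕ) : S.IsSubcomplex (S.skelLT n) := by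
  rintro k e x hx ⟨l, hl, e', g, x', h⟩ y
  have := S.dim_le (g := 1) (g' := g) hx (by rw [one_smul]; exact h)
  exact ⟨k, this.trans_lt hl, e, 1, y, (one_smul _ _).symm⟩

theorem isSubcomplex_bot (S : GCWStructure X) : S.IsSubcomplex ⊥ :=
  fun _ _ _ _ h => absurd h (by exact fun h => h)

/-- If `Z` misses the interior of a cell, its preimage there lies in the boundary sphere, which maps
to a lower skeleton. Closedness on that cell then follows from closedness in lower dimensions, so
only the other cells have to be tested. -/
theorem isClosed_inter_skelLT (S : GCWStructure X) (n : ℕ) (Z : Set X)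
    (h : ∀ k < n, ∀ (e : S.cell k) (g : G), IsClosed {x | g • S.char e x ∈ Z} ∨
      ∀ x, ‖x.1‖ < 1 → g • S.char e x ∉ Z) : IsClosed (Z ∩ S.skelLT n) := by
  induction n with
  | zero =>
    convert isClosed_empty
    ext y
    simp only [Set.mem_inter_iff, Set.mem_empty_iff_false, iff_false, not_and]
    rintro - ⟨k, hk, -⟩
    exact absurd hk (Nat.not_lt_zero k)
  | succ n ih =>
    have ih := ih fun k hk => h k (hk.trans n.lt_succ_self)
    -- All lower skeleta are needed, as an omitted cell may have any dimension `k ≤ n` and its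
    -- boundary lies in `skelLT k`.
    have ih' : ∀ k ≤ n, IsClosed (Z ∩ S.skelLT k) := by
      intro k hk
      have : Z ∩ (S.skelLT k : Set X) = (Z ∩ S.skelLT n) ∩ S.skelLT k := by
        ext y
        exact ⟨fun hy => ⟨⟨hy.1, S.skelLT_mono hk hy.2⟩, hy.2⟩, fun hy => ⟨hy.1.1, hy.2⟩⟩
      rcases hk.lt_or_eq with hk' | rfl
      · rw [this]
        refine S.isClosed_of_skeleton k _ (fun y hy => ?_) fun j hj e g => ?_
        · obtain ⟨i, hi, hy⟩ := hy.2
          exact ⟨i, hi.le, hy⟩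
        · rcases hj.lt_or_eq with hj | rfl
          · convert ih.preimage ((continuous_const_smul g).comp (S.continuous_char e)) using 1
            ext x
            exact ⟨fun hx => hx.1, fun hx => ⟨hx, j, hj, e, g, x, rfl⟩⟩
          · convert (ih.preimage ((continuous_const_smul g).comp (S.continuous_char e))).inter
              (isClosed_eq (f := fun x : Disc j => ‖x.1‖) (g := fun _ => (1 : ℝ))
                (by fun_prop) (by fun_prop)) using 1
            ext x
            refine ⟨fun hx => ⟨hx.1, S.norm_eq_one_of_mem_skelLT e x g hx.2⟩, fun hx => ⟨hx.1, ?_⟩⟩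
            exact smul_char_mem_iff.2 (S.char_mem_skelLT_of_norm e x hx.2)
      · exact ih
    refine S.isClosed_of_skeleton n _ (fun y hy => ?_) fun k hk e g => ?_
    · obtain ⟨i, hi, hy⟩ := hy.2
      exact ⟨i, Nat.lt_succ_iff.1 hi, hy⟩
    · rcases h k (Nat.lt_succ_iff.2 hk) e g with hc | hc
      · convert hc using 3 with x
        exact ⟨fun hx => hx.1, fun hx => ⟨hx, k, Nat.lt_succ_iff.2 hk, e, g, x, rfl⟩⟩
      · convert (ih' k hk).preimage ((continuous_const_smul g).comp (S.continuous_char e)) using 1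
        ext x
        refine ⟨fun hx => ⟨hx.1, ?_⟩, fun hx => ⟨hx.1, S.skelLT_mono (hk.trans n.le_succ) hx.2⟩⟩
        have hx' : ‖x.1‖ = 1 := by
          by_contra hne
          exact hc x ((norm_le_one x).lt_of_ne hne) hx.1
        exact smul_char_mem_iff.2 (S.char_mem_skelLT_of_norm e x hx')

/-- A set is closed if its preimages in all cells are closed; cells whose interior does not meet
the set may be left out. -/
theorem isClosed_of_cells (S : GCWStructure X) (Z : Set X)
    (h : ∀ k, ∀ (e : S.cell k) (g : G), IsClosed {x | g • S.char e x ∈ Z} ∨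
      ∀ x, ‖x.1‖ < 1 → g • S.char e x ∉ Z) : IsClosed Z := by
  refine S.isClosed_of_colimit Z fun n => ?_
  convert S.isClosed_inter_skelLT (n + 1) Z fun k _ => h k using 1
  ext y
  exact and_congr Iff.rfl (exists_congr fun k => and_congr_left fun _ => Nat.lt_succ_iff.symm)

theorem IsSubcomplex.isClosed {S : GCWStructure X} {A : SubMulAction G X} (h : S.IsSubcomplex A) :
    IsClosed (A : Set X) := by
  refine S.isClosed_of_cells _ fun k e g => ?_
  by_cases hx : ∃ x : Disc k, ‖x.1‖ < 1 ∧ S.char e x ∈ A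
  · obtain ⟨x, hx, hA⟩ := hx
    refine Or.inl ?_
    convert isClosed_univ
    exact Set.eq_univ_of_forall fun y => A.smul_mem g (h k e x hx hA y)
  · push Not at hx
    exact Or.inr fun x hx' hA => hx x hx' (smul_char_mem_iff.1 hA)

/-- The induced structure on a subcomplex. -/
def restrict (S : GCWStructure X) {A : SubMulAction G X} (hA : S.IsSubcomplex A) :
    GCWStructure (GSpace.sub A) where
  cell n := {e : S.cell n // ∀ x, S.char e x ∈ A}
  stab e := S.stab e.1
  char e x := ⟨S.char e.1 x, e.2 x⟩
  continuous_char e := (S.continuous_char e.1).subtype_mk _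
  stab_smul e h hh x := Subtype.ext (S.stab_smul e.1 h hh x)
  boundary {n} e x hx := by
    obtain ⟨k, hk, e', g, x', h⟩ := S.boundary e.1 x hx
    -- The closed cell found in `X` may fail to lie in `A`. The cell with the point in its interior
    -- does lie in `A`, because `A` is a subcomplex.
    obtain ⟨l, hl, e'', g', x'', h', h''⟩ := S.exists_interior e' g x'
    have := e.2 x
    rw [h, h'', smul_char_mem_iff] at this
    exact ⟨l, hl.trans_lt hk, ⟨e'', hA l e'' x'' h' this⟩, g', x'', Subtype.ext (h.trans h'')⟩
  interior_inj {n k} e e' x x' g hx hx' h := by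
    obtain ⟨h₁, h₂⟩ := S.interior_inj e.1 e'.1 x x' g hx hx' (congrArg Subtype.val h)
    refine ⟨?_, h₂⟩
    obtain ⟨e, he⟩ := e
    obtain ⟨e', he'⟩ := e'
    cases h₁
    rfl
  cover y := by
    obtain ⟨n, e, g, x, hx, h⟩ := S.exists_interior' y.1
    have hy : y.1 ∈ A := y.2
    rw [h, smul_char_mem_iff] at hy
    exact ⟨n, ⟨e, hA n e x hx hy⟩, g, x, Subtype.ext h⟩
  isClosed_of_skeleton n Z hZ hcl := by
    -- Closedness is tested in `X`: cells outside `A` have interiors disjoint from `A`, so they may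
    -- be left out.
    have : IsClosed ((Subtype.val : A → X) '' Z) := by
      convert S.isClosed_inter_skelLT (n + 1) ((Subtype.val : A → X) '' Z) fun k hk e g => ?_ using 1
      · symm
        refine Set.inter_eq_left.2 ?_
        rintro _ ⟨y, hy, rfl⟩
        obtain ⟨k, hk, e, g, x, rfl⟩ := hZ y hy
        exact ⟨k, Nat.lt_succ_iff.2 hk, e.1, g, x, rfl⟩
      · by_cases he : ∀ x, S.char e x ∈ A
        · refine Or.inl ?_
          convert hcl k (Nat.lt_succ_iff.1 hk) ⟨e, he⟩ g using 3 with x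
          constructor
          · rintro ⟨y, hy, h⟩
            have hy' : g • (⟨S.char e x, he x⟩ : GSpace.sub A) = y := Subtype.ext h.symm
            rw [← hy'] at hy
            exact hy
          · exact fun h => ⟨_, h, rfl⟩
        · refine Or.inr ?_
          rintro x hx ⟨y, -, hy⟩
          have hyA : y.1 ∈ A := y.2
          exact he (hA k e x hx (smul_char_mem_iff.1 (hy ▸ hyA)))
    rw [← Set.preimage_image_eq Z (Subtype.val_injective (p := (· ∈ A)))]
    exact this.preimage continuous_subtype_val
  isClosed_of_colimit Z hZ := by
    have : IsClosed ((Subtype.val : A → X) '' Z) := by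
      refine S.isClosed_of_cells _ fun k e g => ?_
      by_cases he : ∀ x, S.char e x ∈ A
      · refine Or.inl ?_
        have hc : Continuous fun x : Disc k => (⟨S.char e x, he x⟩ : GSpace.sub A) :=
          (S.continuous_char e).subtype_mk _
        convert (hZ k).preimage (((GSpace.sub A).cont.continuous_const_smul g).comp hc) using 1
        ext x
        constructor
        · rintro ⟨y, hy, h⟩
          have hy' : g • (⟨S.char e x, he x⟩ : GSpace.sub A) = y := Subtype.ext h.symm
          exact ⟨by rwa [← hy'] at hy, k, le_rfl, ⟨e, he⟩, g, x, rfl⟩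
        · exact fun h => ⟨_, h.1, rfl⟩
      · refine Or.inr ?_
        rintro x hx ⟨y, -, hy⟩
        have hyA : y.1 ∈ A := y.2
        exact he (hA k e x hx (smul_char_mem_iff.1 (hy ▸ hyA)))
    rw [← Set.preimage_image_eq Z (Subtype.val_injective (p := (· ∈ A)))]
    exact this.preimage continuous_subtype_val

theorem IsProper.restrict {S : GCWStructure X} (h : S.IsProper) {A : SubMulAction G X}
    (hA : S.IsSubcomplex A) : (S.restrict hA).IsProper := fun n e => h n e.1

theorem IsFinite.restrict {S : GCWStructure X} (h : S.IsFinite) {A : SubMulAction G X}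
    (hA : S.IsSubcomplex A) : (S.restrict hA).IsFinite := by
  have : Finite (Σ n, S.cell n) := h
  refine Finite.of_injective (fun c : Σ n, (S.restrict hA).cell n =>
    (⟨c.1, c.2.1⟩ : Σ n, S.cell n)) ?_
  rintro ⟨n, e, he⟩ ⟨k, e', he'⟩ h
  cases h
  rfl

end GCWStructure

/-! ### Discs as CW-complexes -/

/-- The cells of `Dⁿ`: besides the top cell, `Dⁿ⁺¹` has a base point and an `n`-cell whose closure
is the boundary sphere. -/
inductive DiscCell : ℕ → ℕ → Type
  | top (n : ℕ) : DiscCell n n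
  | base (n : ℕ) : DiscCell (n + 1) 0
  | sphere (n : ℕ) : DiscCell (n + 1) n

namespace DiscCell

/-- The vector `(2√(1 - |x|²) x, 2|x|² - 1)` of the unit sphere. -/
noncomputable def collapseVec {n : ℕ} (x : EuclideanSpace ℝ (Fin n)) :
    EuclideanSpace ℝ (Fin (n + 1)) :=
  WithLp.toLp 2 (Fin.snoc (α := fun _ => ℝ) (fun i => 2 * √(1 - ‖x‖ ^ 2) * x i) (2 * ‖x‖ ^ 2 - 1))

theorem collapseVec_castSucc {n : ℕ} (x : EuclideanSpace ℝ (Fin n)) (i : Fin n) :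
    collapseVec x i.castSucc = 2 * √(1 - ‖x‖ ^ 2) * x i := by
  simp [collapseVec]

theorem collapseVec_last {n : ℕ} (x : EuclideanSpace ℝ (Fin n)) :
    collapseVec x (Fin.last n) = 2 * ‖x‖ ^ 2 - 1 := by
  simp [collapseVec]

theorem continuous_collapseVec (n : ℕ) :
    Continuous (collapseVec : EuclideanSpace ℝ (Fin n) → EuclideanSpace ℝ (Fin (n + 1))) := by
  refine (PiLp.continuous_toLp 2 _).comp (continuous_pi fun i => ?_)
  refine Fin.lastCases ?_ (fun i => ?_) i
  · simp only [Fin.snoc_last]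
    fun_prop
  · simp only [Fin.snoc_castSucc]
    fun_prop

theorem norm_sq_succ {n : ℕ} (y : EuclideanSpace ℝ (Fin (n + 1))) :
    ‖y‖ ^ 2 = ‖(WithLp.toLp 2 fun i : Fin n => y i.castSucc : EuclideanSpace ℝ (Fin n))‖ ^ 2 +
      y (Fin.last n) ^ 2 := by
  simp [EuclideanSpace.norm_sq_eq, Fin.sum_univ_castSucc]

theorem norm_collapseVec {n : ℕ} (x : EuclideanSpace ℝ (Fin n)) (hx : ‖x‖ ≤ 1) :
    ‖collapseVec x‖ = 1 := by
  have h₀ : (0 : ℝ) ≤ 1 - ‖x‖ ^ 2 := by nlinarith [norm_nonneg x]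
  have h₁ : (WithLp.toLp 2 fun i : Fin n => collapseVec x i.castSucc : EuclideanSpace ℝ (Fin n)) =
      (2 * √(1 - ‖x‖ ^ 2)) • x := by
    ext i
    simp [collapseVec_castSucc]
  have h : ‖collapseVec x‖ ^ 2 = 1 := by
    rw [norm_sq_succ, h₁, collapseVec_last, norm_smul, mul_pow, Real.norm_eq_abs, sq_abs, mul_pow,
      Real.sq_sqrt h₀]
    ring
  nlinarith [norm_nonneg (collapseVec x)]

/-- The characteristic map of the boundary sphere of `Dⁿ⁺¹`. -/
noncomputable def collapse {n : ℕ} (x : Disc n) : Disc (n + 1) :=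
  ⟨collapseVec x.1, mem_closedBall_zero_iff.2
    (norm_collapseVec x.1 (GCWStructure.norm_le_one x)).le⟩

theorem norm_collapse {n : ℕ} (x : Disc n) : ‖(collapse x).1‖ = 1 :=
  norm_collapseVec x.1 (GCWStructure.norm_le_one x)

/-- The base point of the boundary sphere of `Dⁿ⁺¹`. -/
noncomputable def pole (n : ℕ) : Disc (n + 1) :=
  ⟨EuclideanSpace.single (Fin.last n) 1, by simp⟩

theorem norm_pole (n : ℕ) : ‖(pole n).1‖ = 1 := by simp [pole]

/-- The last coordinate `2‖x‖² - 1` equals `1` only for `‖x‖ = 1`, and then the factor `√(1 - ‖x‖²)`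
kills the other coordinates. Thus `collapse` identifies the boundary of the disc to the base point.
-/
theorem collapse_eq_pole_iff {n : ℕ} (x : Disc n) : collapse x = pole n ↔ ‖x.1‖ = 1 := by
  constructor
  · intro h
    have h := congrArg (fun y : Disc (n + 1) => y.1 (Fin.last n)) h
    simp only [collapse, pole, collapseVec_last, PiLp.single_apply, if_true] at h
    nlinarith [norm_nonneg x.1]
  · intro h
    refine Subtype.ext (PiLp.ext fun i => ?_)
    refine Fin.lastCases ?_ (fun i => ?_) i
    · simp [collapse, pole, collapseVec_last, h]
      norm_num
    · simp [collapse, pole, collapseVec_castSucc, h, Fin.castSucc_ne_last]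

/-- The last coordinate determines the norm; the other coordinates are then the vector scaled by a
known positive factor. -/
theorem collapse_injOn {n : ℕ} (x y : Disc n) (hy : ‖y.1‖ < 1)
    (h : collapse x = collapse y) : x = y := by
  have hl := congrArg (fun y : Disc (n + 1) => y.1 (Fin.last n)) h
  simp only [collapse, collapseVec_last] at hl
  have hn : ‖x.1‖ ^ 2 = ‖y.1‖ ^ 2 := by linarith
  have hpos : 0 < √(1 - ‖y.1‖ ^ 2) := Real.sqrt_pos.2 (by nlinarith [norm_nonneg y.1])
  refine Subtype.ext (PiLp.ext fun i => ?_)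
  have hi := congrArg (fun y : Disc (n + 1) => y.1 i.castSucc) h
  simp only [collapse, collapseVec_castSucc, hn] at hi
  exact mul_left_cancel₀ (by positivity) hi

theorem exists_collapse {n : ℕ} (y : Disc (n + 1)) (hy : ‖y.1‖ = 1) :
    y = pole n ∨ ∃ x : Disc n, y = collapse x := by
  set t := y.1 (Fin.last n) with ht
  set z : EuclideanSpace ℝ (Fin n) := WithLp.toLp 2 fun i : Fin n => y.1 i.castSucc with hz
  have hs : ‖z‖ ^ 2 + t ^ 2 = 1 := by rw [hz, ht, ← norm_sq_succ, hy, one_pow]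
  have ht1 : t ≤ 1 := by nlinarith [sq_nonneg ‖z‖]
  have ht2 : -1 ≤ t := by nlinarith [sq_nonneg ‖z‖]
  rcases ht1.eq_or_lt with h | h
  · left
    have hz0 : z = 0 := by
      rw [← norm_eq_zero]
      nlinarith [norm_nonneg z]
    refine Subtype.ext (PiLp.ext fun i => ?_)
    refine Fin.lastCases ?_ (fun i => ?_) i
    · rw [← ht, h]
      simp [pole]
    · have : z i = 0 := by simp [hz0]
      simpa [pole, PiLp.single_apply, Fin.castSucc_ne_last] using this
  · right
    -- Solving `t = 2‖x‖² - 1` gives `‖x‖² = (1 + t) / 2`, so the scaling factor of `collapse` must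
    -- be `√(2 * (1 - t))`, and `x` is `z` divided by it.
    have hpos : 0 < √(2 * (1 - t)) := Real.sqrt_pos.2 (by linarith)
    have hnorm : ‖(√(2 * (1 - t)))⁻¹ • z‖ ^ 2 = (1 + t) / 2 := by
      rw [norm_smul, mul_pow, norm_inv, Real.norm_eq_abs, inv_pow, sq_abs,
        Real.sq_sqrt (by linarith), show ‖z‖ ^ 2 = (1 - t) * (1 + t) by linarith]
      have : 1 - t ≠ 0 := by linarith
      field_simp
    refine ⟨⟨(√(2 * (1 - t)))⁻¹ • z, mem_closedBall_zero_iff.2 ?_⟩, ?_⟩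
    · nlinarith [norm_nonneg ((√(2 * (1 - t)))⁻¹ • z)]
    · refine Subtype.ext (PiLp.ext fun i => ?_)
      refine Fin.lastCases ?_ (fun i => ?_) i
      · simp only [collapse, collapseVec_last, hnorm]
        rw [← ht]
        ring
      · simp only [collapse, collapseVec_castSucc, hnorm]
        have h4 : 2 * √(1 - (1 + t) / 2) = √(2 * (1 - t)) := by
          have : (2 : ℝ) * (1 - t) = 2 ^ 2 * (1 - (1 + t) / 2) := by ring
          rw [this, Real.sqrt_mul (by norm_num), Real.sqrt_sq (by norm_num)]
        rw [h4]
        simp only [PiLp.smul_apply, smul_eq_mul]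
        rw [mul_inv_cancel_left₀ hpos.ne']

/-- The characteristic maps. -/
noncomputable def char : ∀ {n k : ℕ}, DiscCell n k → Disc k → Disc n
  | _, _, top _ => id
  | _, _, base n => fun _ => pole n
  | _, _, sphere _ => collapse

theorem continuous_char {n k : ℕ} (e : DiscCell n k) : Continuous e.char := by
  cases e with
  | top => exact continuous_id
  | base => exact continuous_const
  | sphere => exact ((continuous_collapseVec _).comp continuous_subtype_val).subtype_mk _

theorem norm_zero_ne_one (x : Disc 0) : ‖x.1‖ ≠ 1 := by
  rw [Subsingleton.elim x.1 0, norm_zero]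
  norm_num

theorem exists_of_norm {n : ℕ} (x : Disc n) (hx : ‖x.1‖ = 1) :
    ∃ k < n, ∃ (e : DiscCell n k) (x' : Disc k), x = e.char x' := by
  cases n with
  | zero => exact absurd hx (norm_zero_ne_one x)
  | succ n =>
    rcases exists_collapse x hx with h | ⟨y, h⟩
    · exact ⟨0, n.succ_pos, base n, ⟨0, by simp⟩, h⟩
    · exact ⟨n, n.lt_succ_self, sphere n, y, h⟩

theorem boundary {n k : ℕ} (e : DiscCell n k) (x : Disc k) (hx : ‖x.1‖ = 1) :
    ∃ l < k, ∃ (e' : DiscCell n l) (x' : Disc l), e.char x = e'.char x' := by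
  cases e with
  | top => exact exists_of_norm x hx
  | base => exact absurd hx (norm_zero_ne_one x)
  | sphere =>
    refine ⟨0, Nat.pos_of_ne_zero ?_, base k, ⟨0, by simp⟩, (collapse_eq_pole_iff x).2 hx⟩
    rintro rfl
    exact norm_zero_ne_one x hx

theorem norm_char_eq_one {n k : ℕ} (e : DiscCell n k) (hk : k < n) (x : Disc k) :
    ‖(e.char x).1‖ = 1 := by
  cases e with
  | top => exact absurd hk (lt_irrefl _)
  | base => exact norm_pole _
  | sphere => exact norm_collapse x

theorem le {n k : ℕ} (e : DiscCell n k) : k ≤ n := by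
  cases e <;> omega

theorem interior_inj {n k l : ℕ} (e : DiscCell n k) (e' : DiscCell n l) (x : Disc k) (x' : Disc l)
    (hx : ‖x.1‖ < 1) (hx' : ‖x'.1‖ < 1) (h : e.char x = e'.char x') :
    (⟨k, e, x⟩ : Σ k, DiscCell n k × Disc k) = ⟨l, e', x'⟩ := by
  cases e with
  | top =>
    cases e' with
    | top => exact congrArg (fun y => (⟨n, top n, y⟩ : Σ k, DiscCell n k × Disc k)) h
    | base => exact absurd ((congrArg (fun y => ‖y.1‖) h).trans (norm_pole _)) hx.ne
    | sphere => exact absurd ((congrArg (fun y => ‖y.1‖) h).trans (norm_collapse _)) hx.ne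
  | base m =>
    cases e' with
    | top => exact absurd ((congrArg (fun y => ‖y.1‖) h.symm).trans (norm_pole _)) hx'.ne
    | base => rw [Subsingleton.elim x x']
    | sphere => exact absurd ((collapse_eq_pole_iff _).1 h.symm) hx'.ne
  | sphere m =>
    cases e' with
    | top => exact absurd ((congrArg (fun y => ‖y.1‖) h.symm).trans (norm_collapse _)) hx'.ne
    | base => exact absurd ((collapse_eq_pole_iff _).1 h) hx.ne
    | sphere => rw [collapse_injOn x x' hx' h]

/-- An enumeration of the cells of a disc. -/
def index : ∀ {n k : ℕ}, DiscCell n k → Fin 3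
  | _, _, top _ => 0
  | _, _, base _ => 1
  | _, _, sphere _ => 2

instance (n : ℕ) : Finite (Σ k, DiscCell n k) := by
  refine Finite.of_injective (fun c : Σ k, DiscCell n k => c.2.index) ?_
  rintro ⟨k, e⟩ ⟨l, e'⟩ h
  cases e <;> cases e' <;> first | rfl | exact absurd h (by simp [index])

end DiscCell

/-- The trivial action on a disjoint union of discs. -/
abbrev discAction (K : Type u) [Group K] (J : Type u) (n : ℕ) : MulAction K (Σ _ : J, Disc n) where
  smul _ x := x
  one_smul _ := rfl
  mul_smul _ _ _ := rfl

/-- The disjoint union of copies of `Dⁿ` indexed by `J`, with the trivial action of `K`. -/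
def discSpace (K : Type u) [Group K] (J : Type u) (n : ℕ) : GSpace K :=
  { carrier := Σ _ : J, Disc n
    act := discAction K J n
    cont := @ContinuousConstSMul.mk _ _ _ (discAction K J n).toSMul fun _ => continuous_id }

/-- The boundary spheres. -/
def discBoundary (K : Type u) [Group K] (J : Type u) (n : ℕ) :
    SubMulAction K (discSpace K J n) where
  carrier := {y : Σ _ : J, Disc n | ‖y.2.1‖ = 1}
  smul_mem' _ _ h := h

/-- The CW-structure of a disjoint union of discs. -/
noncomputable def discCW (K : Type u) [Group K] (J : Type u) (n : ℕ) :
    GCWStructure (discSpace K J n) where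
  cell k := J × DiscCell n k
  stab _ := ⊤
  char e x := (⟨e.1, e.2.char x⟩ : Σ _ : J, Disc n)
  continuous_char e := continuous_sigmaMk.comp (DiscCell.continuous_char e.2)
  stab_smul _ _ _ _ := rfl
  boundary e x hx := by
    obtain ⟨l, hl, e', x', h⟩ := DiscCell.boundary e.2 x hx
    exact ⟨l, hl, (e.1, e'), 1, x', congrArg (Sigma.mk e.1) h⟩
  interior_inj {k l} e e' x x' g hx hx' h := by
    obtain ⟨j, e⟩ := e
    obtain ⟨j', e'⟩ := e'
    have h' : (⟨j, e.char x⟩ : Σ _ : J, Disc n) = ⟨j', e'.char x'⟩ := h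
    obtain ⟨rfl, h''⟩ := Sigma.mk.inj_iff.1 h'
    have := DiscCell.interior_inj e e' x x' hx hx' (eq_of_heq h'')
    exact ⟨congrArg (fun c : Σ k, DiscCell n k × Disc k =>
      (⟨c.1, (j, c.2.1), c.2.2⟩ : Σ k, (J × DiscCell n k) × Disc k)) this, trivial⟩
  cover y := ⟨n, (y.1, DiscCell.top n), 1, y.2, rfl⟩
  isClosed_of_skeleton N Z hZ hcl := by
    refine isClosed_sigma_iff.2 fun j => ?_
    change IsClosed {y : Disc n | (⟨j, y⟩ : Σ _ : J, Disc n) ∈ Z}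
    -- Each single disc has finitely many cells, even if `J` is infinite, so the part of `Z` in it
    -- is a finite union of images of compact sets.
    have : {y : Disc n | (⟨j, y⟩ : Σ _ : J, Disc n) ∈ Z} = ⋃ c : {c : Σ k, DiscCell n k // c.1 ≤ N},
        c.1.2.char '' {x | (⟨j, c.1.2.char x⟩ : Σ _ : J, Disc n) ∈ Z} := by
      ext y
      simp only [Set.mem_iUnion, Set.mem_image, Set.mem_ofPred_eq]
      constructor
      · intro hy
        obtain ⟨k, hk, e, g, x, h⟩ := hZ _ hy
        have h : (⟨j, y⟩ : Σ _ : J, Disc n) = ⟨e.1, e.2.char x⟩ := h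
        obtain ⟨hj, h⟩ := Sigma.mk.inj_iff.1 h
        obtain rfl := eq_of_heq h
        exact ⟨⟨⟨k, e.2⟩, hk⟩, x, hy, rfl⟩
      · rintro ⟨c, x, hx, rfl⟩
        exact hx
    rw [this]
    refine isClosed_iUnion_of_finite fun c => ?_
    have h : IsClosed {x | (⟨j, c.1.2.char x⟩ : Σ _ : J, Disc n) ∈ Z} :=
      hcl c.1.1 c.2 (j, c.1.2) 1
    exact (h.isCompact.image (DiscCell.continuous_char c.1.2)).isClosed
  isClosed_of_colimit Z hZ := by
    convert hZ n using 1
    ext y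
    exact ⟨fun h => ⟨h, n, le_rfl, (y.1, DiscCell.top n), 1, y.2, rfl⟩, fun h => h.1⟩

theorem discCW_isProper (K : Type u) [Group K] [Finite K] (J : Type u) (n : ℕ) :
    (discCW K J n).IsProper := fun _ _ => Subtype.finite

theorem discBoundary_isSubcomplex (K : Type u) [Group K] (J : Type u) (n : ℕ) :
    (discCW K J n).IsSubcomplex (discBoundary K J n) := by
  rintro k ⟨j, e⟩ x hx h x'
  have h : ‖(e.char x).1‖ = 1 := h
  change ‖(e.char x').1‖ = 1
  refine DiscCell.norm_char_eq_one e (e.le.lt_of_ne ?_) x'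
  rintro rfl
  cases e with
  | top => exact hx.ne h

/-! ### Finite proper complexes are unions of locally finitely many closed cells -/

theorem isClosed_sigma_prod_iff {ι κ : Type*} {α : ι → Type*} {β : κ → Type*}
    [∀ i, TopologicalSpace (α i)] [∀ i, TopologicalSpace (β i)]
    {E : Set ((Σ i, α i) × (Σ i, β i))} :
    IsClosed E ↔ ∀ i j, IsClosed {p : α i × β j | ((⟨i, p.1⟩, ⟨j, p.2⟩) :
      (Σ i, α i) × (Σ i, β i)) ∈ E} := by
  refine ⟨fun h i j => h.preimage (continuous_sigmaMk.prodMap continuous_sigmaMk), fun h => ?_⟩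
  rw [← isOpen_compl_iff, isOpen_iff_mem_nhds]
  rintro ⟨⟨i, x⟩, ⟨j, y⟩⟩ hp
  have ho := (@Topology.IsOpenEmbedding.sigmaMk _ α _ i).prodMap
    (@Topology.IsOpenEmbedding.sigmaMk _ β _ j)
  refine Filter.mem_of_superset ((ho.isOpenMap _ (h i j).isOpen_compl).mem_nhds ⟨(x, y), hp, rfl⟩) ?_
  rintro _ ⟨p, hp, rfl⟩
  exact hp

theorem isClosed_prod_sigma_iff {Y κ : Type*} {β : κ → Type*} [TopologicalSpace Y]
    [∀ i, TopologicalSpace (β i)] {E : Set (Y × (Σ i, β i))} :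
    IsClosed E ↔ ∀ j, IsClosed {p : Y × β j | ((p.1, ⟨j, p.2⟩) : Y × (Σ i, β i)) ∈ E} := by
  refine ⟨fun h j => h.preimage (continuous_id.prodMap continuous_sigmaMk), fun h => ?_⟩
  rw [← isOpen_compl_iff, isOpen_iff_mem_nhds]
  rintro ⟨x, ⟨j, y⟩⟩ hp
  have ho := (Topology.IsOpenEmbedding.id (X := Y)).prodMap
    (@Topology.IsOpenEmbedding.sigmaMk _ β _ j)
  refine Filter.mem_of_superset ((ho.isOpenMap _ (h j).isOpen_compl).mem_nhds ⟨(x, y), hp, rfl⟩) ?_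
  rintro _ ⟨p, hp, rfl⟩
  exact hp

namespace GCWStructure

variable {G : Type u} [Group G] {X : GSpace G}

/-- The cells of dimension less than `n` are locally finite, closed and Hausdorff. -/
structure LocallyFiniteBelow (S : GCWStructure X) (n : ℕ) : Prop where
  isClosedMap : ∀ k < n, ∀ e : S.cell k, IsClosedMap (S.char e)
  finite_meet : ∀ k < n, ∀ l < n, ∀ (e : S.cell k) (e' : S.cell l),
    {g : G | ∃ x x', g • S.char e x = S.char e' x'}.Finite
  isClosed_coincidence : ∀ k < n, ∀ l < n, ∀ (e : S.cell k) (e' : S.cell l) (g : G),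
    IsClosed {p : Disc k × Disc l | g • S.char e p.1 = S.char e' p.2}

/-- The index set of the closed cells of dimension less than `n`. -/
abbrev CellBelow (S : GCWStructure X) (n : ℕ) : Type u :=
  {c : Σ k, S.cell k // c.1 < n} × G

/-- The disjoint union of the closed cells of dimension less than `n`. -/
abbrev CellUnion (S : GCWStructure X) (n : ℕ) : Type u :=
  Σ c : S.CellBelow n, Disc c.1.1.1

/-- The map from the disjoint union of the closed cells. -/
def cellMap (S : GCWStructure X) (n : ℕ) (t : S.CellUnion n) : X := t.1.2 • S.char t.1.1.1.2 t.2

theorem continuous_cellMap (S : GCWStructure X) (n : ℕ) : Continuous (S.cellMap n) :=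
  continuous_sigma fun c => (continuous_const_smul c.2).comp (S.continuous_char c.1.1.2)

theorem range_cellMap (S : GCWStructure X) (n : ℕ) : Set.range (S.cellMap n) = S.skelLT n := by
  ext y
  constructor
  · rintro ⟨⟨⟨⟨⟨k, e⟩, hk⟩, g⟩, x⟩, rfl⟩
    exact ⟨k, hk, e, g, x, rfl⟩
  · rintro ⟨k, hk, e, g, x, rfl⟩
    exact ⟨⟨⟨⟨⟨k, e⟩, hk⟩, g⟩, x⟩, rfl⟩

/-! ### Properness of the map from the union of closed cells, and its consequences -/

namespace LocallyFiniteBelow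

variable {S : GCWStructure X} {n : ℕ}

/-- There are finitely many orbits of cells, and in each orbit finitely many translates meet the
given cell. -/
theorem finite_cells (h : S.LocallyFiniteBelow n) (hS : S.IsFinite) (c : S.CellBelow n) :
    {d : S.CellBelow n | ∃ x z, c.2 • S.char c.1.1.2 x = d.2 • S.char d.1.1.2 z}.Finite := by
  have : Finite (Σ n, S.cell n) := hS
  refine (Set.finite_iUnion (f := fun b : {c : Σ k, S.cell k // c.1 < n} =>
    (fun g : G => ((b, c.2 * g⁻¹) : S.CellBelow n)) ''
      {g | ∃ x x', g • S.char c.1.1.2 x = S.char b.1.2 x'}) fun b =>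
    (h.finite_meet _ c.1.2 _ b.2 _ _).image _).subset ?_
  rintro ⟨b, g⟩ ⟨x, z, hxz⟩
  refine Set.mem_iUnion.2 ⟨b, g⁻¹ * c.2, ⟨x, z, ?_⟩, by simp⟩
  rw [mul_smul, hxz, inv_smul_smul]

/-- Tested on one closed cell, the image of a closed set receives contributions only from the
finitely many cells that meet it, and each contribution is closed. For the same reason a fibre lies
in finitely many discs. -/
theorem isProperMap_cellMap (h : S.LocallyFiniteBelow n) (hS : S.IsFinite) :
    IsProperMap (S.cellMap n) := by
  have hcl : IsClosedMap (S.cellMap n) := by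
    intro C hC
    have hsub : S.cellMap n '' C ∩ S.skelLT n = S.cellMap n '' C :=
      Set.inter_eq_left.2 ((Set.image_subset_range _ _).trans (S.range_cellMap n).le)
    rw [← hsub]
    refine S.isClosed_inter_skelLT n _ fun k hk e g => Or.inl ?_
    have : {x | g • S.char e x ∈ S.cellMap n '' C} =
        ⋃ d ∈ {d : S.CellBelow n | ∃ x z, g • S.char e x = d.2 • S.char d.1.1.2 z},
          {x | d.2⁻¹ • g • S.char e x ∈ S.char d.1.1.2 '' {z | (⟨d, z⟩ : S.CellUnion n) ∈ C}} := by
      ext x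
      simp only [Set.mem_iUnion, Set.mem_ofPred_eq, Set.mem_image]
      constructor
      · rintro ⟨⟨d, z⟩, hd, hz⟩
        have hz : d.2 • S.char d.1.1.2 z = g • S.char e x := hz
        exact ⟨d, ⟨x, z, hz.symm⟩, z, hd, by rw [← hz, inv_smul_smul]⟩
      · rintro ⟨d, -, z, hd, hz⟩
        refine ⟨⟨d, z⟩, hd, ?_⟩
        change d.2 • S.char d.1.1.2 z = _
        rw [hz, smul_inv_smul]
    rw [this]
    refine (h.finite_cells hS (⟨⟨k, e⟩, hk⟩, g)).isClosed_biUnion fun d _ => ?_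
    exact (h.isClosedMap _ d.1.2 _ _ (hC.preimage continuous_sigmaMk)).preimage
      ((continuous_const_smul _).comp ((continuous_const_smul _).comp (S.continuous_char e)))
  refine isProperMap_iff_isClosedMap_and_compact_fibers.2 ⟨S.continuous_cellMap n, hcl, fun y => ?_⟩
  by_cases hy : ∃ t, S.cellMap n t = y
  · obtain ⟨t, rfl⟩ := hy
    have hpt : IsClosed {S.cellMap n t} := by
      have := hcl {t} isClosed_singleton
      rwa [Set.image_singleton] at this
    refine IsCompact.of_isClosed_subset ((h.finite_cells hS t.1).isCompact_biUnion
      (f := fun d => Set.range (Sigma.mk (β := fun c : S.CellBelow n => Disc c.1.1.1) d)) fun d _ => isCompact_range continuous_sigmaMk)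
      (hpt.preimage (S.continuous_cellMap n)) ?_
    intro s hs
    exact Set.mem_biUnion (x := s.1) ⟨t.2, s.2, hs.symm⟩ ⟨s.2, rfl⟩
  · convert isCompact_empty
    ext t
    exact ⟨fun ht => hy ⟨t, ht⟩, fun h => h.elim⟩

/-- The map from the disjoint union of the closed cells onto the skeleton. -/
def _root_.GCWStructure.cellMap' (S : GCWStructure X) (n : ℕ) (t : S.CellUnion n) :
    (S.skelLT n : Set X) := ⟨S.cellMap n t, S.range_cellMap n ▸ Set.mem_range_self t⟩

/-- The diagonal is the image of the coincidence relation of the cell map under its square. The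
relation is closed by assumption, and the square of a proper map is closed. -/
theorem t2Space (h : S.LocallyFiniteBelow n) (hS : S.IsFinite) :
    T2Space (S.skelLT n : Set X) := by
  have hp : IsProperMap (S.cellMap' n) :=
    isProperMap_of_comp_of_inj ((S.continuous_cellMap n).subtype_mk _) continuous_subtype_val
      (h.isProperMap_cellMap hS) Subtype.val_injective
  have hE : IsClosed {p : S.CellUnion n × S.CellUnion n | S.cellMap' n p.1 = S.cellMap' n p.2} := by
    refine isClosed_sigma_prod_iff.2 fun c d => ?_
    convert h.isClosed_coincidence _ c.1.2 _ d.1.2 c.1.1.2 d.1.1.2 (d.2⁻¹ * c.2) using 3 with p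
    rw [Set.mem_ofPred_eq, Subtype.ext_iff]
    change c.2 • S.char c.1.1.2 p.1 = d.2 • S.char d.1.1.2 p.2 ↔ _
    rw [mul_smul, inv_smul_eq_iff]
  rw [t2_iff_isClosed_diagonal]
  convert (hp.prodMap hp).isClosedMap _ hE using 1
  ext ⟨y, z⟩
  constructor
  · intro hyz
    obtain rfl : y = z := hyz
    have hy : y.1 ∈ Set.range (S.cellMap n) := by
      rw [S.range_cellMap n]
      exact y.2
    obtain ⟨t, ht⟩ := hy
    exact ⟨(t, t), rfl, Prod.ext (Subtype.ext ht) (Subtype.ext ht)⟩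
  · rintro ⟨⟨t, t'⟩, ht, hp⟩
    rw [← hp]
    exact ht

/-- The preimage of a compact set under the proper cell map is compact, so its projection to the
discrete set of indices is finite. -/
theorem finite_meet_compact (h : S.LocallyFiniteBelow n) (hS : S.IsFinite) {K : Type*}
    [TopologicalSpace K] [CompactSpace K] {s : K → X} (hs : Continuous s) :
    {c : S.CellBelow n | ∃ x a, c.2 • S.char c.1.1.2 x = s a}.Finite := by
  have hc := (h.isProperMap_cellMap hS).isCompact_preimage (isCompact_range hs)
  let _ : TopologicalSpace (S.CellBelow n) := ⊥
  have : DiscreteTopology (S.CellBelow n) := ⟨rfl⟩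
  have hfst : Continuous (Sigma.fst : S.CellUnion n → S.CellBelow n) :=
    continuous_sigma fun c => continuous_const
  refine (hc.image hfst).finite_of_discrete.subset ?_
  rintro c ⟨x, a, hxa⟩
  exact ⟨⟨c, x⟩, ⟨a, hxa.symm⟩, rfl⟩

theorem isClosed_coincidence_compact (h : S.LocallyFiniteBelow n) (hS : S.IsFinite) {K K' : Type*}
    [TopologicalSpace K] [TopologicalSpace K']
    {s : K → X} (hs : Continuous s) (hsn : ∀ a, s a ∈ S.skelLT n)
    {s' : K' → X} (hs' : Continuous s') (hsn' : ∀ a, s' a ∈ S.skelLT n) :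
    IsClosed {p : K × K' | s p.1 = s' p.2} := by
  have := h.t2Space hS
  have h₁ : Continuous fun a => (⟨s a, hsn a⟩ : (S.skelLT n : Set X)) := hs.subtype_mk _
  have h₂ : Continuous fun a => (⟨s' a, hsn' a⟩ : (S.skelLT n : Set X)) := hs'.subtype_mk _
  convert isClosed_eq (h₁.comp continuous_fst) (h₂.comp (continuous_snd (X := K))) using 3 with p
  exact (Subtype.ext_iff (a1 := (⟨s p.1, hsn p.1⟩ : (S.skelLT n : Set X)))
    (a2 := ⟨s' p.2, hsn' p.2⟩)).symm

theorem isClosedMap_compact (h : S.LocallyFiniteBelow n) (hS : S.IsFinite) {K : Type*}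
    [TopologicalSpace K] [CompactSpace K]
    {s : K → X} (hs : Continuous s) (hsn : ∀ a, s a ∈ S.skelLT n) : IsClosedMap s := by
  have := h.t2Space hS
  have h₁ : Continuous fun a => (⟨s a, hsn a⟩ : (S.skelLT n : Set X)) := hs.subtype_mk _
  exact (S.isSubcomplex_skelLT n).isClosed.isClosedMap_subtype_val.comp h₁.isClosedMap

end LocallyFiniteBelow

/-- The boundary sphere of `Dⁿ`. -/
abbrev Sph (n : ℕ) : Type := {x : Disc n // ‖x.1‖ = 1}

theorem isClosed_norm_eq_one (n : ℕ) : IsClosed {x : Disc n | ‖x.1‖ = 1} :=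
  isClosed_eq (by fun_prop) (by fun_prop)

instance (n : ℕ) : CompactSpace (Sph n) :=
  isCompact_iff_compactSpace.1 (isClosed_norm_eq_one n).isCompact

theorem continuous_char_sphere (S : GCWStructure X) {n : ℕ} (e : S.cell n) :
    Continuous fun x : Sph n => S.char e x.1 := (S.continuous_char e).comp continuous_subtype_val

theorem char_sphere_mem (S : GCWStructure X) {n : ℕ} (e : S.cell n) (x : Sph n) :
    S.char e x.1 ∈ S.skelLT n := S.char_mem_skelLT_of_norm e x.1 x.2

/-- Two points of cells of the same dimension which agree up to translation are interior points of
the same cell or lie on the boundaries. -/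
theorem same_dim_cases (S : GCWStructure X) {n : ℕ} {e e' : S.cell n} {x x' : Disc n} {g : G}
    (h : g • S.char e x = S.char e' x') :
    (e = e' ∧ x = x' ∧ g ∈ S.stab e) ∨ (‖x.1‖ = 1 ∧ ‖x'.1‖ = 1) := by
  rcases (norm_le_one x).lt_or_eq with hx | hx
  · rcases (norm_le_one x').lt_or_eq with hx' | hx'
    · obtain ⟨h₁, h₂⟩ := S.interior_inj e e' x x' g hx hx' h
      cases h₁
      exact Or.inl ⟨rfl, rfl, h₂⟩
    · refine absurd (S.norm_eq_one_of_mem_skelLT e x g ?_) hx.ne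
      rw [h]
      exact S.char_mem_skelLT_of_norm e' x' hx'
  · refine Or.inr ⟨hx, S.norm_eq_one_of_mem_skelLT e' x' 1 ?_⟩
    rw [one_smul, ← h]
    exact smul_char_mem_iff.2 (S.char_mem_skelLT_of_norm e x hx)

theorem lower_dim_norm (S : GCWStructure X) {n k : ℕ} {e : S.cell k} {e' : S.cell n} {x : Disc k}
    {x' : Disc n} {g : G} (hk : k < n) (h : g • S.char e x = S.char e' x') : ‖x'.1‖ = 1 := by
  refine S.norm_eq_one_of_mem_skelLT e' x' 1 ?_
  rw [one_smul, ← h]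
  exact ⟨k, hk, e, g, x, rfl⟩

/-- The part of a closed set on the sphere has closed image by compactness and the Hausdorff
property of the lower skeleton. The open cell is disjoint from all other closed cells of dimension
at most `n`, and the interiors of higher cells miss the image. -/
theorem LocallyFiniteBelow.isClosedMap_char {S : GCWStructure X} {n : ℕ}
    (h : S.LocallyFiniteBelow n) (hS : S.IsFinite) (e : S.cell n) : IsClosedMap (S.char e) := by
  have hs := h.isClosedMap_compact hS (S.continuous_char_sphere e) (S.char_sphere_mem e)
  intro C hC
  have hCS : IsClosed (S.char e '' {x | x ∈ C ∧ ‖x.1‖ = 1}) := by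
    convert hs _ (hC.preimage continuous_subtype_val) using 1
    ext y
    constructor
    · rintro ⟨x, hx, rfl⟩
      exact ⟨⟨x, hx.2⟩, hx.1, rfl⟩
    · rintro ⟨x, hx, rfl⟩
      exact ⟨x.1, ⟨hx, x.2⟩, rfl⟩
  refine S.isClosed_of_cells _ fun k e' g => ?_
  rcases lt_trichotomy k n with hk | rfl | hk
  · left
    convert hCS.preimage ((continuous_const_smul g).comp (S.continuous_char e')) using 1
    ext x
    constructor
    · rintro ⟨z, hz, hx⟩
      exact ⟨z, ⟨hz, S.lower_dim_norm hk hx.symm⟩, hx⟩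
    · rintro ⟨z, hz, hx⟩
      exact ⟨z, hz.1, hx⟩
  · by_cases hg : e' = e ∧ g ∈ S.stab e'
    · obtain ⟨rfl, hg⟩ := hg
      left
      convert hC.union (hCS.preimage (S.continuous_char e')) using 1
      ext x
      constructor
      · rintro ⟨z, hz, hx⟩
        rcases S.same_dim_cases hx.symm with ⟨-, rfl, -⟩ | h'
        · exact Or.inl hz
        · exact Or.inr ⟨z, ⟨hz, h'.2⟩, hx.trans (S.stab_smul e' g hg x)⟩
      · rintro (hx | ⟨z, hz, hx⟩)
        · exact ⟨x, hx, (S.stab_smul e' g hg x).symm⟩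
        · exact ⟨z, hz.1, hx.trans (S.stab_smul e' g hg x).symm⟩
    · right
      rintro x hx ⟨z, hz, hxz⟩
      rcases S.same_dim_cases hxz.symm with ⟨h₁, -, h₂⟩ | h'
      · exact hg ⟨h₁, h₂⟩
      · exact hx.ne h'.1
  · right
    rintro x hx ⟨z, -, hxz⟩
    exact hk.not_ge (S.dim_le (e := e') (g := g) (e' := e) (g' := 1) (x' := z) hx (by
      rw [one_smul, ← hxz]))

/-- Two closed `n`-cells meet either in an interior point, in which case they agree up to an element
of the stabilizer, finite by properness, or along their boundaries. The boundaries are compact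
subsets of the lower skeleton, where the induction hypothesis gives finiteness and the Hausdorff
property. -/
theorem LocallyFiniteBelow.succ {S : GCWStructure X} {n : ℕ} (h : S.LocallyFiniteBelow n)
    (hS : S.IsFinite) (hproper : S.IsProper) : S.LocallyFiniteBelow (n + 1) := by
  have hmeet : ∀ (e : S.cell n), {c : S.CellBelow n | ∃ x, ∃ a : Sph n,
      c.2 • S.char c.1.1.2 x = S.char e a.1}.Finite :=
    fun e => h.finite_meet_compact hS (S.continuous_char_sphere e)
  have hlow : ∀ k < n, ∀ (e : S.cell k) (e' : S.cell n),
      {g : G | ∃ x x', g • S.char e x = S.char e' x'}.Finite := by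
    intro k hk e e'
    refine ((hmeet e').image Prod.snd).subset ?_
    rintro g ⟨x, x', hx⟩
    exact ⟨(⟨⟨k, e⟩, hk⟩, g), ⟨x, ⟨x', S.lower_dim_norm hk hx⟩, hx⟩, rfl⟩
  have hsymm : ∀ k l (e : S.cell k) (e' : S.cell l),
      {g : G | ∃ x x', g • S.char e x = S.char e' x'}.Finite →
      {g : G | ∃ x x', g • S.char e' x = S.char e x'}.Finite := by
    intro k l e e' hf
    refine (hf.image (·⁻¹)).subset ?_
    rintro g ⟨x, x', hx⟩
    exact ⟨g⁻¹, ⟨x', x, by rw [← hx, inv_smul_smul]⟩, inv_inv g⟩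
  refine ⟨fun k hk e => ?_, fun k hk l hl e e' => ?_, fun k hk l hl e e' g => ?_⟩
  · rcases (Nat.lt_succ_iff.1 hk).lt_or_eq with hk | rfl
    · exact h.isClosedMap k hk e
    · exact h.isClosedMap_char hS e
  · rcases (Nat.lt_succ_iff.1 hk).lt_or_eq with hk | rfl <;>
      rcases (Nat.lt_succ_iff.1 hl).lt_or_eq with hl | rfl
    · exact h.finite_meet k hk l hl e e'
    · exact hlow k hk e e'
    · exact hsymm _ _ _ _ (hlow l hl e' e)
    · have := hproper _ e
      have hst : (S.stab e : Set G).Finite := Set.toFinite _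
      refine (hst.union (((hmeet e').image Prod.snd).image2 (fun a b => a * b⁻¹)
        ((hmeet e).image Prod.snd) |>.union (Set.finite_empty))).subset ?_
      rintro g ⟨x, x', hx⟩
      rcases S.same_dim_cases hx with ⟨-, -, hg⟩ | ⟨h₁, h₂⟩
      · exact Or.inl hg
      -- The common point lies in a translate by `a` of a lower cell, which meets the boundary of
      -- `e`; its translate by `g * a` meets the boundary of `e'`. Both `a` and `g * a` range over
      -- finite sets, hence so does `g = (g * a) * a⁻¹`.
      · obtain ⟨j, hj, e'', a, z, hz⟩ := S.boundary e x h₁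
        refine Or.inr (Or.inl ⟨g * a, ⟨(⟨⟨j, e''⟩, hj⟩, g * a), ⟨z, ⟨x', h₂⟩, ?_⟩, rfl⟩, a,
          ⟨(⟨⟨j, e''⟩, hj⟩, a), ⟨z, ⟨x, h₁⟩, hz.symm⟩, rfl⟩, by simp⟩)
        change (g * a) • S.char e'' z = S.char e' x'
        rw [mul_smul, ← hz, hx]
  · have hval : ∀ j, Topology.IsClosedEmbedding (Subtype.val : Sph j → Disc j) :=
      fun j => (isClosed_norm_eq_one j).isClosedEmbedding_subtypeVal
    rcases (Nat.lt_succ_iff.1 hk).lt_or_eq with hk | rfl <;>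
      rcases (Nat.lt_succ_iff.1 hl).lt_or_eq with hl | rfl
    · exact h.isClosed_coincidence k hk l hl e e' g
    · convert (Topology.IsClosedEmbedding.id.prodMap (hval l)).isClosedMap _
        (h.isClosed_coincidence_compact hS
          ((continuous_const_smul g).comp (S.continuous_char e)) (fun x => ⟨k, hk, e, g, x, rfl⟩)
          (S.continuous_char_sphere e') (S.char_sphere_mem e')) using 1
      ext ⟨x, x'⟩
      constructor
      · exact fun hx => ⟨(x, ⟨x', S.lower_dim_norm hk hx⟩), hx, rfl⟩
      · rintro ⟨p, hp, hpx⟩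
        cases hpx
        exact hp
    · convert ((hval k).prodMap Topology.IsClosedEmbedding.id).isClosedMap _
        (h.isClosed_coincidence_compact hS (S.continuous_char_sphere e) (S.char_sphere_mem e)
          ((continuous_const_smul g⁻¹).comp (S.continuous_char e'))
          (fun x => ⟨l, hl, e', g⁻¹, x, rfl⟩)) using 1
      ext ⟨x, x'⟩
      constructor
      · intro hx
        have hx' : g⁻¹ • S.char e' x' = S.char e x := by
          rw [← (show g • S.char e x = S.char e' x' from hx), inv_smul_smul]
        exact ⟨(⟨x, S.lower_dim_norm hl hx'⟩, x'), hx'.symm, rfl⟩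
      · rintro ⟨p, hp, hpx⟩
        cases hpx
        exact (eq_inv_smul_iff (g := g)).1 hp
    · have h₁ := ((hval l).prodMap (hval l)).isClosedMap _
        (h.isClosed_coincidence_compact hS
          ((continuous_const_smul g).comp (S.continuous_char_sphere e))
          (fun x => smul_char_mem_iff.2 (S.char_sphere_mem e x))
          (S.continuous_char_sphere e') (S.char_sphere_mem e'))
      by_cases hg : e = e' ∧ g ∈ S.stab e
      · obtain ⟨rfl, hg⟩ := hg
        convert isClosed_diagonal.union h₁ using 1
        ext ⟨x, x'⟩
        constructor
        · intro hx
          rcases S.same_dim_cases hx with ⟨-, h', -⟩ | h'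
          · exact Or.inl h'
          · exact Or.inr ⟨(⟨x, h'.1⟩, ⟨x', h'.2⟩), hx, rfl⟩
        · rintro (hx | ⟨p, hp, hpx⟩)
          · obtain rfl : x = x' := hx
            exact S.stab_smul e g hg x
          · cases hpx
            exact hp
      · convert h₁ using 1
        ext ⟨x, x'⟩
        constructor
        · intro hx
          rcases S.same_dim_cases hx with ⟨h', -, h''⟩ | h'
          · exact absurd ⟨h', h''⟩ hg
          · exact ⟨(⟨x, h'.1⟩, ⟨x', h'.2⟩), hx, rfl⟩
        · rintro ⟨p, hp, hpx⟩
          cases hpx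
          exact hp

theorem locallyFiniteBelow (S : GCWStructure X) (hS : S.IsFinite) (hproper : S.IsProper) (n : ℕ) :
    S.LocallyFiniteBelow n := by
  induction n with
  | zero => constructor <;> exact fun k hk => absurd hk (Nat.not_lt_zero k)
  | succ n ih => exact ih.succ hS hproper

theorem IsFinite.exists_dim_lt {S : GCWStructure X} (hS : S.IsFinite) :
    ∃ N, ∀ n, S.cell n → n < N := by
  have : Finite (Σ n, S.cell n) := hS
  obtain ⟨N, hN⟩ := (Set.finite_range (Sigma.fst : (Σ n, S.cell n) → ℕ)).bddAbove
  exact ⟨N + 1, fun n e => Nat.lt_succ_iff.2 (hN ⟨⟨n, e⟩, rfl⟩)⟩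

end GCWStructure

/-! ### Products of discs -/

/-- The product carries the maximum norm, so the linear isomorphism does not preserve norms. It is
followed by the radial rescaling between the image of the Euclidean ball and the unit ball of the
maximum norm, which matches their gauges. -/
theorem exists_norm_homeomorph (p q : ℕ) :
    ∃ Φ : EuclideanSpace ℝ (Fin (p + q)) ≃ₜ EuclideanSpace ℝ (Fin p) × EuclideanSpace ℝ (Fin q),
      ∀ v, ‖Φ v‖ = ‖v‖ := by
  let V := EuclideanSpace ℝ (Fin p) × EuclideanSpace ℝ (Fin q)
  let e : EuclideanSpace ℝ (Fin (p + q)) ≃L[ℝ] V := EuclideanSpace.finAddEquivProd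
  let ν : Seminorm ℝ V := (normSeminorm ℝ (EuclideanSpace ℝ (Fin (p + q)))).comp
    e.symm.toContinuousLinearMap.toLinearMap
  let s : Set V := ν.ball 0 1
  have hs : s = e.symm ⁻¹' Metric.ball 0 1 := by
    ext v
    simp only [s, ν, Seminorm.mem_ball, sub_zero, Set.mem_preimage, mem_ball_zero_iff]
    rfl
  have hs₀ : s ∈ nhds (0 : V) := by
    rw [hs]
    refine e.symm.continuous.continuousAt.preimage_mem_nhds ?_
    rw [map_zero]
    exact Metric.ball_mem_nhds _ one_pos
  have hsb : Bornology.IsVonNBounded ℝ s := by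
    have : s = e '' Metric.ball 0 1 := by
      rw [hs, ContinuousLinearEquiv.image_eq_preimage_symm]
    rw [this]
    exact (NormedSpace.isVonNBounded_ball ℝ _ 1).image e.toContinuousLinearMap
  let φ := gaugeRescaleHomeomorph s (Metric.ball (0 : V) 1) (Seminorm.convex_ball _ _ _) hs₀ hsb
    (convex_ball _ _) (Metric.ball_mem_nhds _ one_pos) (NormedSpace.isVonNBounded_ball ℝ _ 1)
  refine ⟨e.toHomeomorph.trans φ, fun v => ?_⟩
  have h₁ : gauge (Metric.ball (0 : V) 1) (φ (e v)) = gauge s (e v) :=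
    gauge_gaugeRescale s (absorbent_nhds_zero (Metric.ball_mem_nhds _ one_pos))
      (NormedSpace.isVonNBounded_ball ℝ _ 1) (e v)
  have h₂ : gauge s (e v) = ν (e v) := congrFun (Seminorm.gauge_ball ν) (e v)
  have h₃ : ν (e v) = ‖v‖ := by
    change ‖e.symm (e v)‖ = ‖v‖
    rw [e.symm_apply_apply]
  rw [gauge_unit_ball, h₂, h₃] at h₁
  exact h₁

/-- Product cells come as `Dᵖ × D𐞥` while the definition of a complex asks for `Dⁿ`. For the maximum
norm, the unit ball of the product is the product of the unit balls, open or closed. -/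
theorem exists_discProd {p q n : ℕ} (h : p + q = n) :
    ∃ Φ : Disc n ≃ₜ Disc p × Disc q,
      ∀ v, ‖v.1‖ < 1 ↔ ‖(Φ v).1.1‖ < 1 ∧ ‖(Φ v).2.1‖ < 1 := by
  subst h
  obtain ⟨Φ, hΦ⟩ := exists_norm_homeomorph p q
  have hle : ∀ v : EuclideanSpace ℝ (Fin (p + q)),
      v ∈ Metric.closedBall (0 : EuclideanSpace ℝ (Fin (p + q))) 1 ↔
        Φ v ∈ Metric.closedBall (0 : EuclideanSpace ℝ (Fin p)) 1 ×ˢ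
          Metric.closedBall (0 : EuclideanSpace ℝ (Fin q)) 1 := by
    intro v
    rw [closedBall_prod_same, mem_closedBall_zero_iff, ← Prod.zero_eq_mk, mem_closedBall_zero_iff,
      hΦ]
  refine ⟨(Φ.subtype hle).trans (Homeomorph.Set.prod _ _), fun v => ?_⟩
  rw [← hΦ, Prod.norm_def, max_lt_iff]
  rfl

/-- A homeomorphism from a disc to a product of discs. -/
noncomputable def discProd {p q n : ℕ} (h : p + q = n) : Disc n ≃ₜ Disc p × Disc q :=
  (exists_discProd h).choose

theorem norm_lt_one_iff_discProd {p q n : ℕ} (h : p + q = n) (v : Disc n) :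
    ‖v.1‖ < 1 ↔ ‖(discProd h v).1.1‖ < 1 ∧ ‖(discProd h v).2.1‖ < 1 :=
  (exists_discProd h).choose_spec v

/-! ### Products of complexes -/

namespace GCWStructure

variable {G : Type u} [Group G] {X Y : GSpace G}

theorem isQuotientMap_cells (S : GCWStructure Y) :
    Topology.IsQuotientMap fun t : Σ c : (Σ k, S.cell k) × G, Disc c.1.1 =>
      t.1.2 • S.char t.1.1.2 t.2 := by
  refine Topology.isQuotientMap_iff_isClosed.2 ⟨fun y => ?_, fun Z => ⟨fun hZ => hZ.preimage ?_,
    fun hZ => S.isClosed_of_cells Z fun k e g => Or.inl ?_⟩⟩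
  · obtain ⟨n, e, g, x, rfl⟩ := S.cover y
    exact ⟨⟨(⟨n, e⟩, g), x⟩, rfl⟩
  · exact continuous_sigma fun c => (continuous_const_smul c.2).comp (S.continuous_char c.1.2)
  · exact isClosed_sigma_iff.1 hZ (⟨k, e⟩, g)

/-- In the product of a complex with a finite proper complex, closedness can be tested on products
of closed cells. -/
theorem isClosed_prod_of_cells (S : GCWStructure Y) (T : GCWStructure X) (hT : T.IsFinite)
    (hproper : T.IsProper) (Z : Set (Y.prod X))
    (h : ∀ k (e : S.cell k) (g : G) l (e' : T.cell l) (g' : G),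
      IsClosed {p : Disc k × Disc l | ((g • S.char e p.1, g' • T.char e' p.2) : Y × X) ∈ Z}) :
    IsClosed Z := by
  obtain ⟨N, hN⟩ := hT.exists_dim_lt
  -- A proper map stays closed after taking the product with `Y`; this replaces the cells of `X` by
  -- discs. A mere quotient map would not suffice.
  have hp : IsProperMap (Prod.map (id : Y → Y) (T.cellMap N)) :=
    isProperMap_id.prodMap ((T.locallyFiniteBelow hT hproper N).isProperMap_cellMap hT)
  have hsurj : Function.Surjective (Prod.map (id : Y → Y) (T.cellMap N)) := by
    refine Function.surjective_id.prodMap fun x => ?_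
    obtain ⟨n, e, g, z, rfl⟩ := T.cover x
    exact ⟨⟨⟨⟨⟨n, e⟩, hN n e⟩, g⟩, z⟩, rfl⟩
  have hZ : IsClosed (Prod.map (id : Y → Y) (T.cellMap N) ⁻¹' Z) := by
    refine isClosed_prod_sigma_iff.2 fun d => ?_
    -- Openness of the complement is read as continuity of a map to `Prop`. It descends from the
    -- cells of `Y`, since the product of a quotient map with a locally compact disc is a quotient
    -- map.
    have hq : Continuous fun p : Y × Disc d.1.1.1 =>
        (((p.1, d.2 • T.char d.1.1.2 p.2) : Y × X) ∈ (Zᶜ : Set (Y × X))) := by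
      refine S.isQuotientMap_cells.continuous_lift_prod_left (continuous_Prop.2 ?_)
      rw [← isClosed_compl_iff]
      refine (Homeomorph.sigmaProdDistrib.symm.isClosed_preimage).1 (isClosed_sigma_iff.2 fun c => ?_)
      convert h c.1.1 c.1.2 c.2 d.1.1.1 d.1.1.2 d.2 using 1
      ext p
      exact not_not
    have := (continuous_Prop.1 hq).isClosed_compl
    convert this using 1
    ext p
    exact not_not.symm
  exact Eq.mp (congrArg (IsClosed (X := Y × X)) (Set.image_preimage_eq _ hsurj))
    (hp.isClosedMap _ hZ)

/-- The invariant subset `A × B` of a product. -/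
def _root_.GSpace.prodSub (A : SubMulAction G Y) (B : SubMulAction G X) :
    SubMulAction G (Y.prod X) where
  carrier := {z : Y × X | z.1 ∈ A ∧ z.2 ∈ B}
  smul_mem' g _ h := ⟨A.smul_mem g h.1, B.smul_mem g h.2⟩

/-- Closed subcomplexes of the factors give closed test sets. -/
theorem isClosed_inter_prodSub (S : GCWStructure Y) (T : GCWStructure X) (hT : T.IsFinite)
    (hproper : T.IsProper) {A : SubMulAction G Y} {B : SubMulAction G X} (hA : S.IsSubcomplex A)
    (hB : T.IsSubcomplex B) (Z : Set (Y.prod X))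
    (h : ∀ k (e : S.cell k) (g : G) l (e' : T.cell l) (g' : G), (∀ x, S.char e x ∈ A) →
      (∀ x, T.char e' x ∈ B) →
      IsClosed {p : Disc k × Disc l | ((g • S.char e p.1, g' • T.char e' p.2) : Y × X) ∈ Z}) :
    IsClosed (Z ∩ GSpace.prodSub A B) := by
  let ι : A × B → Y × X := Prod.map Subtype.val Subtype.val
  have hι : Topology.IsClosedEmbedding ι :=
    hA.isClosed.isClosedEmbedding_subtypeVal.prodMap hB.isClosed.isClosedEmbedding_subtypeVal
  have hcl := (S.restrict hA).isClosed_prod_of_cells (T.restrict hB) (hT.restrict hB)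
    (hproper.restrict hB) (ι ⁻¹' Z) fun k e g l e' g' => h k e.1 g l e'.1 g' e.2 e'.2
  refine Eq.mp (congrArg (IsClosed (X := Y × X)) (Set.ext ?_)) (hι.isClosedMap _ hcl)
  rintro ⟨y, x⟩
  refine Iff.symm ?_
  constructor
  · exact fun hz => ⟨(⟨y, hz.2.1⟩, ⟨x, hz.2.2⟩), hz.1, rfl⟩
  · rintro ⟨⟨a, b⟩, hz, hab⟩
    rw [← hab]
    exact ⟨hz, a.2, b.2⟩

theorem stab_eq_bot_of_free (S : GCWStructure Y) (hfree : ∀ (g : G) (y : Y), g • y = y → g = 1)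
    {n : ℕ} (e : S.cell n) {g : G} (hg : g ∈ S.stab e) : g = 1 :=
  hfree g _ (S.stab_smul e g hg ⟨0, by simp⟩)

theorem isProper_of_free (S : GCWStructure Y)
    (hfree : ∀ (g : G) (y : Y), g • y = y → g = 1) : S.IsProper := fun _ e =>
  have : Subsingleton (S.stab e) := ⟨fun a b => Subtype.ext
    ((S.stab_eq_bot_of_free hfree e a.2).trans (S.stab_eq_bot_of_free hfree e b.2).symm)⟩
  inferInstance

/-- The chosen representative of the coset of `g⁻¹ * g'` differs from it by an element of the
stabilizer. Hence a pair of cells translated by `(g, g')` is the `g`-translate of the product cell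
indexed by that coset. -/
theorem smul_out_smul_char (T : GCWStructure X) {n : ℕ} (e : T.cell n) (g g' : G) (x : Disc n) :
    g • ((g⁻¹ * g' : G) : G ⧸ T.stab e).out • T.char e x = g' • T.char e x := by
  have h := T.stab_smul e _
    (QuotientGroup.eq.1 (Quotient.out_eq ((g⁻¹ * g' : G) : G ⧸ T.stab e))) x
  rw [mul_smul, inv_smul_eq_iff, mul_smul, inv_smul_eq_iff] at h
  exact h.symm

/-- The product of a free complex with a finite proper complex. -/
noncomputable def prod (S : GCWStructure Y) (hfree : ∀ (g : G) (y : Y), g • y = y → g = 1)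
    (T : GCWStructure X) (hT : T.IsFinite) (hproper : T.IsProper) :
    GCWStructure (Y.prod X) where
  -- Because `Y` is free, each diagonal orbit of pairs of translated cells has a unique member whose
  -- first cell is untranslated. The second cell is then translated by a coset of its stabilizer,
  -- and the product cell has trivial stabilizer.
  cell n := {c : (Σ p, S.cell p) × (Σ d : (Σ q, T.cell q), G ⧸ T.stab d.2) //
    c.1.1 + c.2.1.1 = n}
  stab _ := ⊥
  char c x := (S.char c.1.1.2 (discProd c.2 x).1,
    c.1.2.2.out • T.char c.1.2.1.2 (discProd c.2 x).2)
  continuous_char c := by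
    refine Continuous.prodMk ?_ ?_
    · exact (S.continuous_char _).comp (continuous_fst.comp (discProd c.2).continuous)
    · exact (continuous_const_smul _).comp
        ((T.continuous_char _).comp (continuous_snd.comp (discProd c.2).continuous))
  stab_smul c g hg x := by
    obtain rfl := Subgroup.mem_bot.1 hg
    exact one_smul G (_ : Y.prod X)
  boundary := by
    rintro n ⟨⟨⟨p, e⟩, ⟨⟨q, e'⟩, a⟩⟩, hpq⟩ x hx
    have hpq' : p + q = n := hpq
    obtain ⟨k, hk, f, g, y, hy, hfy⟩ := S.exists_interior e 1 (discProd hpq' x).1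
    obtain ⟨l, hl, f', g', y', hy', hfy'⟩ := T.exists_interior e' a.out (discProd hpq' x).2
    -- If no dimension drops, both coordinates are interior points of their discs, contradicting
    -- `‖x‖ = 1`.
    have hlt : k + l < n := by
      by_contra hge
      obtain rfl : k = p := by omega
      obtain rfl : l = q := by omega
      refine hx.not_lt ((norm_lt_one_iff_discProd hpq' x).2 ⟨?_, ?_⟩)
      · by_contra hne
        refine hy.ne (S.norm_eq_one_of_mem_skelLT f y g ?_)
        rw [← hfy, one_smul]
        exact S.char_mem_skelLT_of_norm e _ (le_antisymm (norm_le_one _) (not_lt.1 hne))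
      · by_contra hne
        refine hy'.ne (T.norm_eq_one_of_mem_skelLT f' y' g' ?_)
        rw [← hfy']
        exact smul_char_mem_iff.2
          (T.char_mem_skelLT_of_norm e' _ (le_antisymm (norm_le_one _) (not_lt.1 hne)))
    refine ⟨k + l, hlt, ⟨⟨⟨k, f⟩, ⟨⟨l, f'⟩, ((g⁻¹ * g' : G) : G ⧸ T.stab f')⟩⟩, rfl⟩, g,
      (discProd rfl).symm (y, y'), ?_⟩
    rw [one_smul] at hfy
    refine Prod.ext ?_ ?_
    · change S.char e (discProd hpq' x).1 = g • S.char f (discProd rfl ((discProd rfl).symm (y, y'))).1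
      rw [Homeomorph.apply_symm_apply, hfy]
    · change a.out • T.char e' (discProd hpq' x).2 = g • ((g⁻¹ * g' : G) : G ⧸ T.stab f').out •
        T.char f' (discProd rfl ((discProd rfl).symm (y, y'))).2
      rw [Homeomorph.apply_symm_apply, hfy']
      exact (T.smul_out_smul_char f' g g' y').symm
  interior_inj := by
    rintro n k ⟨⟨⟨p, e⟩, ⟨⟨q, e'⟩, a⟩⟩, hpq⟩ ⟨⟨⟨p₁, e₁⟩, ⟨⟨q₁, e₁'⟩, a₁⟩⟩, hpq₁⟩ x x' g hx hx' h
    have hpq' : p + q = n := hpq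
    have hpq₁' : p₁ + q₁ = k := hpq₁
    have h₁ : g • S.char e (discProd hpq' x).1 = S.char e₁ (discProd hpq₁' x').1 :=
      congrArg Prod.fst h
    have h₂ : g • a.out • T.char e' (discProd hpq' x).2 =
        a₁.out • T.char e₁' (discProd hpq₁' x').2 := congrArg Prod.snd h
    rw [norm_lt_one_iff_discProd hpq'] at hx
    rw [norm_lt_one_iff_discProd hpq₁'] at hx'
    obtain ⟨h₃, h₄⟩ := S.interior_inj _ _ _ _ _ hx.1 hx'.1 h₁
    obtain rfl := S.stab_eq_bot_of_free hfree e h₄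
    rw [one_smul] at h₂
    obtain ⟨h₅, h₆⟩ := T.smul_interior_inj _ _ _ _ _ _ hx.2 hx'.2 h₂
    obtain rfl : p = p₁ := congrArg Sigma.fst h₃
    obtain rfl : q = q₁ := congrArg Sigma.fst h₅
    obtain rfl : n = k := hpq'.symm.trans hpq₁'
    have h₃' := eq_of_heq (Sigma.mk.inj_iff.1 h₃).2
    have h₅' := eq_of_heq (Sigma.mk.inj_iff.1 h₅).2
    obtain rfl : e = e₁ := congrArg Prod.fst h₃'
    obtain rfl : e' = e₁' := congrArg Prod.fst h₅'
    have hxx : x = x' := (discProd hpq').injective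
      (Prod.ext (Prod.ext_iff.1 h₃').2 (Prod.ext_iff.1 h₅').2)
    obtain rfl : a₁ = a := by
      rw [← Quotient.out_eq a, ← Quotient.out_eq a₁]
      exact QuotientGroup.eq.2 h₆
    subst hxx
    exact ⟨rfl, rfl⟩
  cover := by
    rintro ⟨y, x⟩
    obtain ⟨p, e, g, z, rfl⟩ := S.cover y
    obtain ⟨q, e', g', z', rfl⟩ := T.cover x
    refine ⟨p + q, ⟨⟨⟨p, e⟩, ⟨⟨q, e'⟩, ((g⁻¹ * g' : G) : G ⧸ T.stab e')⟩⟩, rfl⟩, g,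
      (discProd rfl).symm (z, z'), ?_⟩
    refine Prod.ext ?_ ?_
    · change g • S.char e z = g • S.char e (discProd rfl ((discProd rfl).symm (z, z'))).1
      rw [Homeomorph.apply_symm_apply]
    · change g' • T.char e' z' = g • ((g⁻¹ * g' : G) : G ⧸ T.stab e').out •
        T.char e' (discProd rfl ((discProd rfl).symm (z, z'))).2
      rw [Homeomorph.apply_symm_apply]
      exact (T.smul_out_smul_char e' g g' z').symm
  isClosed_of_skeleton := by
    intro N Z hZ hcl
    have hcell : ∀ k (e : S.cell k) (g : G) l (e' : T.cell l) (g' : G), k + l ≤ N →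
        IsClosed {p : Disc k × Disc l | ((g • S.char e p.1, g' • T.char e' p.2) : Y × X) ∈ Z} := by
      intro k e g l e' g' hkl
      have := hcl (k + l) hkl ⟨⟨⟨k, e⟩, ⟨⟨l, e'⟩, ((g⁻¹ * g' : G) : G ⧸ T.stab e')⟩⟩, rfl⟩ g
      convert this.preimage (discProd rfl).symm.continuous using 1
      ext p
      change ((g • S.char e p.1, g' • T.char e' p.2) : Y × X) ∈ Z ↔
        ((g • S.char e (discProd rfl ((discProd rfl).symm p)).1,
          g • ((g⁻¹ * g' : G) : G ⧸ T.stab e').out •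
            T.char e' (discProd rfl ((discProd rfl).symm p)).2) : Y × X) ∈ Z
      rw [Homeomorph.apply_symm_apply, T.smul_out_smul_char]
    -- The part of the product in dimensions at most `N` is the finite union of the products of the
    -- `p`-skeleton and the `(N - p)`-skeleton, and closedness can be tested on each of these.
    have hunion : Z = ⋃ p : Fin (N + 1), Z ∩ GSpace.prodSub (S.skelLT (p + 1))
        (T.skelLT (N - p + 1)) := by
      rw [← Set.inter_iUnion]
      refine (Set.inter_eq_left.2 fun z hz => ?_).symm
      obtain ⟨k, hk, ⟨⟨⟨p, e⟩, ⟨⟨q, e'⟩, a⟩⟩, hpq⟩, g, x, h⟩ := hZ z hz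
      have hpq' : p + q = k := hpq
      refine Set.mem_iUnion.2 ⟨⟨p, by omega⟩, ?_, ?_⟩
      · exact ⟨p, Nat.lt_succ_self p, e, g, (discProd hpq' x).1, congrArg Prod.fst h⟩
      · refine ⟨q, ?_, e', g * a.out, (discProd hpq' x).2, (congrArg Prod.snd h).trans ?_⟩
        · change q < N - p + 1
          omega
        · exact (mul_smul g a.out (T.char e' (discProd hpq' x).2)).symm
    rw [hunion]
    refine isClosed_iUnion_of_finite fun p => ?_
    refine S.isClosed_inter_prodSub T hT hproper (S.isSubcomplex_skelLT _) (T.isSubcomplex_skelLT _)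
      Z fun k e g l e' g' hA hB => hcell k e g l e' g' ?_
    obtain ⟨i, hi, f, a, z, hz⟩ := hA ⟨0, by simp⟩
    obtain ⟨i', hi', f', a', z', hz'⟩ := hB ⟨0, by simp⟩
    have h₁ := S.dim_le (g := 1) (e := e) (x := ⟨0, by simp⟩) (by simp) ((one_smul _ _).trans hz)
    have h₂ := T.dim_le (g := 1) (e := e') (x := ⟨0, by simp⟩) (by simp) ((one_smul _ _).trans hz')
    have := p.2
    omega
  isClosed_of_colimit := by
    intro Z hZ
    refine S.isClosed_prod_of_cells T hT hproper Z fun k e g l e' g' => ?_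
    have hc : Continuous fun p : Disc k × Disc l =>
        ((g • S.char e p.1, g' • T.char e' p.2) : Y × X) :=
      Continuous.prodMk
        ((continuous_const_smul g).comp ((S.continuous_char e).comp continuous_fst))
        ((continuous_const_smul g').comp ((T.continuous_char e').comp continuous_snd))
    convert (hZ (k + l)).preimage hc using 1
    ext p
    refine ⟨fun hp => ⟨hp, k + l, le_rfl, ⟨⟨⟨k, e⟩, ⟨⟨l, e'⟩, ((g⁻¹ * g' : G) : G ⧸ T.stab e')⟩⟩,
      rfl⟩, g, (discProd rfl).symm p, ?_⟩, fun hp => hp.1⟩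
    refine Prod.ext ?_ ?_
    · change g • S.char e p.1 = g • S.char e (discProd rfl ((discProd rfl).symm p)).1
      rw [Homeomorph.apply_symm_apply]
    · change g' • T.char e' p.2 = g • ((g⁻¹ * g' : G) : G ⧸ T.stab e').out •
        T.char e' (discProd rfl ((discProd rfl).symm p)).2
      rw [Homeomorph.apply_symm_apply]
      exact (T.smul_out_smul_char e' g g' p.2).symm

end GCWStructure

/-! ### Subcomplexes and skeleta of the product -/

namespace GCWStructure

variable {G : Type u} [Group G] {X Y : GSpace G}

theorem _root_.GSpace.prod_free (hfree : ∀ (g : G) (y : Y), g • y = y → g = 1) (g : G)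
    (z : Y.prod X) (h : g • z = z) : g = 1 := hfree g z.1 (congrArg Prod.fst h)

theorem _root_.GSpace.sub_free (hfree : ∀ (g : G) (y : Y), g • y = y → g = 1)
    (A : SubMulAction G Y) (g : G) (z : GSpace.sub A) (h : g • z = z) : g = 1 :=
  hfree g z.1 (congrArg Subtype.val h)

theorem IsSubcomplex.prodSub {S : GCWStructure Y} {T : GCWStructure X} {A : SubMulAction G Y}
    {B : SubMulAction G X} (hfree : ∀ (g : G) (y : Y), g • y = y → g = 1) (hT : T.IsFinite) (hproper : T.IsProper)
    (hA : S.IsSubcomplex A) (hB : T.IsSubcomplex B) :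
    (S.prod hfree T hT hproper).IsSubcomplex (GSpace.prodSub A B) := by
  intro n c x hx h x'
  rw [norm_lt_one_iff_discProd c.2] at hx
  exact ⟨hA _ _ _ hx.1 h.1 _, B.smul_mem _ (hB _ _ _ hx.2 (smul_char_mem_iff.1 h.2) _)⟩

section Prod

variable (S : GCWStructure Y) (hfree : ∀ (g : G) (y : Y), g • y = y → g = 1)
  (T : GCWStructure X) (hT : T.IsFinite) (hproper : T.IsProper)

theorem isProper_prod : (S.prod hfree T hT hproper).IsProper :=
  isProper_of_free _ (GSpace.prod_free hfree)

theorem prod_smul_char {k l : ℕ} (e : S.cell k) (e' : T.cell l) (g g' : G) (x : Disc k)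
    (x' : Disc l) : ∃ (c : (S.prod hfree T hT hproper).cell (k + l)) (z : Disc (k + l)),
      ((g • S.char e x, g' • T.char e' x') : Y × X) = g • (S.prod hfree T hT hproper).char c z := by
  refine ⟨⟨⟨⟨k, e⟩, ⟨⟨l, e'⟩, ((g⁻¹ * g' : G) : G ⧸ T.stab e')⟩⟩, rfl⟩,
    (discProd rfl).symm (x, x'), Prod.ext ?_ ?_⟩
  · change g • S.char e x = g • S.char e (discProd rfl ((discProd rfl).symm (x, x'))).1
    rw [Homeomorph.apply_symm_apply]
  · change g' • T.char e' x' = g • ((g⁻¹ * g' : G) : G ⧸ T.stab e').out •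
      T.char e' (discProd rfl ((discProd rfl).symm (x, x'))).2
    rw [Homeomorph.apply_symm_apply]
    exact (T.smul_out_smul_char e' g g' x').symm

theorem prodSkel_eq_skel (k : ℕ) : prodSkel S T k = (S.prod hfree T hT hproper).skel k := by
  ext z
  constructor
  · rintro ⟨p, q, hpq, ⟨p', hp, e, g, x, h⟩, ⟨q', hq, e', g', x', h'⟩⟩
    obtain ⟨c, w, hc⟩ := S.prod_smul_char hfree T hT hproper e e' g g' x x'
    refine ⟨p' + q', by omega, c, g, w, ?_⟩
    rw [← hc]
    exact Prod.ext h h'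
  · rintro ⟨n, hn, c, g, x, rfl⟩
    have hc := c.2
    refine ⟨c.1.1.1, k - c.1.1.1, by omega, ?_, ?_⟩
    · exact ⟨_, le_rfl, c.1.1.2, g, (discProd c.2 x).1, rfl⟩
    · refine ⟨c.1.2.1.1, by omega, c.1.2.1.2, g * c.1.2.2.out, (discProd c.2 x).2, ?_⟩
      exact (mul_smul _ _ (T.char c.1.2.1.2 (discProd c.2 x).2)).symm

theorem isSubcomplex_prodSkel (k : ℕ) :
    (S.prod hfree T hT hproper).IsSubcomplex (prodSkel S T k) := by
  rw [S.prodSkel_eq_skel hfree T hT hproper, ← skelLT_succ]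
  exact isSubcomplex_skelLT _ _

end Prod

end GCWStructure

/-! ### Restriction to subgroups -/

/-- The restriction of a `G`-space to a subgroup. -/
def GSpace.res {G : Type u} [Group G] (H : Subgroup G) (X : GSpace G) : GSpace H where
  carrier := X.carrier
  cont := ⟨fun h => X.cont.continuous_const_smul (h : G)⟩

theorem Subgroup.exists_eq_mul_out_rightRel {G : Type u} [Group G] (H : Subgroup G) (g : G) :
    ∃ h : H, g = h * (Quotient.mk (QuotientGroup.rightRel H) g).out := by
  have := QuotientGroup.rightRel_apply.1 (Quotient.mk_out (s := QuotientGroup.rightRel H) g)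
  exact ⟨⟨_, this⟩, by simp⟩

namespace GCWStructure

variable {G : Type u} [Group G] {X Y : GSpace G}

/-- The restriction of the structure of a free complex to a subgroup. -/
noncomputable def res (S : GCWStructure Y) (hfree : ∀ (g : G) (y : Y), g • y = y → g = 1)
    (H : Subgroup G) : GCWStructure (Y.res H) where
  -- By freeness the translates of a cell correspond to the elements of `G`, so their `H`-orbits
  -- correspond to the cosets `H g`.
  cell n := S.cell n × Quotient (QuotientGroup.rightRel H)
  stab _ := ⊥
  char c x := (c.2.out • S.char c.1 x : Y)
  continuous_char c := (Y.cont.continuous_const_smul c.2.out).comp (S.continuous_char c.1)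
  stab_smul c g hg x := by
    obtain rfl := Subgroup.mem_bot.1 hg
    exact one_smul H (_ : Y.res H)
  boundary c x hx := by
    obtain ⟨k, hk, e', g, x', h⟩ := S.boundary c.1 x hx
    obtain ⟨a, ha⟩ := H.exists_eq_mul_out_rightRel (c.2.out * g)
    refine ⟨k, hk, (e', Quotient.mk _ (c.2.out * g)), a, x', ?_⟩
    change (c.2.out • S.char c.1 x : Y) = (a : G) • _ • S.char e' x'
    rw [h, ← mul_smul, ← mul_smul, ← ha]
  interior_inj {n k} c c' x x' g hx hx' h := by
    have h : (g : G) • c.2.out • S.char c.1 x = c'.2.out • S.char c'.1 x' := h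
    rw [← mul_smul] at h
    obtain ⟨h₁, h₂⟩ := S.smul_interior_inj _ _ _ _ _ _ hx hx' h
    have h₃ : c'.2.out = g * c.2.out := inv_mul_eq_one.1 (S.stab_eq_bot_of_free hfree _ h₂)
    have h₄ : c.2 = c'.2 := by
      rw [← Quotient.out_eq c.2, ← Quotient.out_eq c'.2]
      refine Quotient.sound (QuotientGroup.rightRel_apply.2 ?_)
      rw [h₃, mul_inv_cancel_right]
      exact g.2
    obtain ⟨e, a⟩ := c
    obtain ⟨e', a'⟩ := c'
    obtain rfl : a = a' := h₄
    refine ⟨congrArg (fun t : Σ n, S.cell n × Disc n => (⟨t.1, (t.2.1, a), t.2.2⟩ :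
      Σ n, (S.cell n × Quotient (QuotientGroup.rightRel H)) × Disc n)) h₁, ?_⟩
    exact Subgroup.mem_bot.2 (Subtype.ext (right_eq_mul.1 h₃))
  cover y := by
    obtain ⟨n, e, g, x, h⟩ := S.cover y
    obtain ⟨a, ha⟩ := H.exists_eq_mul_out_rightRel g
    refine ⟨n, (e, Quotient.mk _ g), a, x, ?_⟩
    change y = ((a : G) • _ • S.char e x : Y)
    rw [h, ← mul_smul, ← ha]
  isClosed_of_skeleton N Z hZ hcl := by
    refine S.isClosed_of_skeleton N Z (fun y hy => ?_) fun k hk e g => ?_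
    · obtain ⟨k, hk, c, a, x, h⟩ := hZ y hy
      exact ⟨k, hk, c.1, a * c.2.out, x, h.trans (mul_smul (a : G) c.2.out (S.char c.1 x)).symm⟩
    · obtain ⟨a, ha⟩ := H.exists_eq_mul_out_rightRel g
      have h : {x : Disc k | (g • S.char e x : Y) ∈ Z} = {x : Disc k | ((a : G) •
          (Quotient.mk (QuotientGroup.rightRel H) g).out • S.char e x : Y) ∈ Z} := by
        simp only [← mul_smul, ← ha]
      exact h ▸ hcl k hk (e, Quotient.mk _ g) a
  isClosed_of_colimit Z hZ := by
    refine S.isClosed_of_colimit Z fun n => ?_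
    refine Eq.mp (congrArg (IsClosed (X := Y)) (Set.ext fun y => ?_)) (hZ n)
    refine and_congr_right fun _ => Iff.symm ⟨?_, ?_⟩
    · rintro ⟨k, hk, e, g, x, h⟩
      obtain ⟨a, ha⟩ := H.exists_eq_mul_out_rightRel g
      refine ⟨k, hk, (e, Quotient.mk _ g), a, x, ?_⟩
      change y = ((a : G) • _ • S.char e x : Y)
      rw [h, ← mul_smul, ← ha]
    · rintro ⟨k, hk, c, a, x, h⟩
      exact ⟨k, hk, c.1, a * c.2.out, x, h.trans (mul_smul (a : G) c.2.out (S.char c.1 x)).symm⟩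

theorem mem_skel_res (S : GCWStructure Y) (hfree : ∀ (g : G) (y : Y), g • y = y → g = 1)
    (H : Subgroup G) (n : ℕ) (y : Y) : (y : Y.res H) ∈ (S.res hfree H).skel n ↔ y ∈ S.skel n := by
  constructor
  · rintro ⟨k, hk, c, a, x, h⟩
    obtain ⟨e, b⟩ : S.cell k × Quotient (QuotientGroup.rightRel H) := c
    exact ⟨k, hk, e, a * b.out, x, h.trans (mul_smul (a : G) b.out (S.char e x)).symm⟩
  · rintro ⟨k, hk, e, g, x, h⟩
    obtain ⟨a, ha⟩ := H.exists_eq_mul_out_rightRel g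
    refine ⟨k, hk, ((e, Quotient.mk _ g) : S.cell k × Quotient (QuotientGroup.rightRel H)), a, x,
      ?_⟩
    change y = ((a : G) • _ • S.char e x : Y)
    rw [h, ← mul_smul, ← ha]

end GCWStructure

/-- The restriction of a model of `EG` to a subgroup `H` is a model of `EH`. -/
noncomputable def ClassifyingSpace.res {G : Type u} [Group G] (E : ClassifyingSpace G)
    (H : Subgroup G) : ClassifyingSpace H where
  space := E.space.res H
  cw := E.cw.res E.free H
  free h x hx := Subtype.ext (E.free h x hx)
  contractible := E.contractible

/-! ### Topology of induced spaces -/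

section Ind

variable {G H : Type u} [Group G] [Group H] (α : H →* G) (X : GSpace H)

/-- The preimage of the image of `U` in any other slice is a union of translates of `U`. -/
theorem isOpenMap_indMk (g : G) : IsOpenMap (indMk α X g) := by
  intro U hU
  rw [← isClosed_compl_iff, isClosed_ind_iff]
  intro g'
  rw [← isOpen_compl_iff]
  have : {x | indMk α X g' x ∈ (indMk α X g '' U)ᶜ}ᶜ =
      ⋃ (h : H) (_ : g' = g * α h), (fun x : X => h • x) ⁻¹' U := by
    ext x
    simp only [Set.mem_compl_iff, Set.mem_ofPred_eq, not_not, Set.mem_iUnion, Set.mem_preimage]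
    constructor
    · rintro ⟨y, hy, h⟩
      obtain ⟨k, hk, rfl⟩ := (indMk_eq_iff α X _ _ _ _).1 h
      exact ⟨k, hk, by rwa [smul_inv_smul]⟩
    · rintro ⟨k, rfl, hk⟩
      exact ⟨k • x, hk, (indMk_mul α X g k x).symm⟩
  rw [this]
  exact isOpen_iUnion fun h => isOpen_iUnion fun _ => hU.preimage (continuous_const_smul h)

/-- Open maps, unlike quotient maps, survive products with an arbitrary space `T`. This is what
allows homotopies on `X` to be extended to `ind_α X`. -/
theorem continuous_ind_prod {T Z : Type*} [TopologicalSpace T] [TopologicalSpace Z]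
    (f : IndCarrier α X × T → Z)
    (hf : ∀ g, Continuous fun p : X × T => f (indMk α X g p.1, p.2)) : Continuous f := by
  refine continuous_iff_continuousAt.2 ?_
  rintro ⟨y, t⟩
  obtain ⟨g, x, rfl⟩ := indMk_surj α X y
  have ho : IsOpenMap (Prod.map (indMk α X g) (id : T → T)) :=
    (isOpenMap_indMk α X g).prodMap IsOpenMap.id
  intro V hV
  have h : (fun p : X × T => f (indMk α X g p.1, p.2)) ⁻¹' V ∈ nhds (x, t) :=
    (hf g).continuousAt hV
  refine Filter.mem_map.2 (Filter.mem_of_superset (ho.image_mem_nhds h) ?_)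
  rintro _ ⟨p, hp, rfl⟩
  exact hp

theorem isOpenMap_subMap (A : SubMulAction H X) : IsOpenMap (Ind.subMap α A).toFun := by
  intro U hU
  have hV : ∀ g, ∃ V : Set X, IsOpen V ∧
      (Subtype.val : A → X) ⁻¹' V = indMk α (GSpace.sub A) g ⁻¹' U :=
    fun g => isOpen_induced_iff.1 (hU.preimage (continuous_indMk α (GSpace.sub A) g))
  choose V hVo hV using hV
  have : (Ind.subMap α A).toFun '' U =
      (Subtype.val : indSub α A → Ind α X) ⁻¹' ⋃ g, indMk α X g '' V g := by
    ext ⟨y, hy⟩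
    refine Iff.trans ?_ Set.mem_iUnion.symm
    constructor
    · rintro ⟨z, hz, h⟩
      obtain ⟨g, a, rfl⟩ := indMk_surj α _ z
      refine ⟨g, a.1, ?_, ?_⟩
      · change a ∈ (Subtype.val : A → X) ⁻¹' V g
        rw [hV]
        exact hz
      · have := congrArg Subtype.val h
        rw [← this]
        change indMk α X g a.1 = indMk α X (g * 1) a.1
        rw [mul_one]
    · rintro ⟨g, x, hx, rfl⟩
      have hxA : x ∈ A := (Ind.mk_mem_indSub α).1 hy
      refine ⟨indMk α (GSpace.sub A) g ⟨x, hxA⟩, ?_, Subtype.ext ?_⟩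
      · change (⟨x, hxA⟩ : A) ∈ indMk α (GSpace.sub A) g ⁻¹' U
        rw [← hV]
        exact hx
      · change indMk α X (g * 1) x = indMk α X g x
        rw [mul_one]
  rw [this]
  exact (isOpen_iUnion fun g => isOpenMap_indMk α X g _ (hVo g)).preimage continuous_subtype_val

/-- A homeomorphism is a pushout relative to empty subsets, so that excision turns it into an
isomorphism. -/
theorem isGPushout_subMap (A : SubMulAction H X) :
    IsGPushout ⊥ ⊥ (Ind.subMap α A) := by
  have hsurj : Function.Surjective (Ind.subMap α A).toFun := by
    rintro ⟨y, g, a, ha, rfl⟩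
    refine ⟨indMk α (GSpace.sub A) g ⟨a, ha⟩, Subtype.ext ?_⟩
    change indMk α X (g * 1) a = indMk α X g a
    rw [mul_one]
  refine ⟨fun _ => Iff.rfl, fun y y' _ h => ?_, fun y _ => hsurj y, fun Z hZ _ => ?_⟩
  · obtain ⟨g, a, rfl⟩ := indMk_surj α _ y
    obtain ⟨g', a', rfl⟩ := indMk_surj α _ y'
    have h : indMk α X (g * 1) a.1 = indMk α X (g' * 1) a'.1 := congrArg Subtype.val h
    rw [mul_one, mul_one] at h
    obtain ⟨k, hk, hk'⟩ := (indMk_eq_iff α X _ _ _ _).1 h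
    exact (indMk_eq_iff α _ _ _ _ _).2 ⟨k, hk, Subtype.ext hk'⟩
  · have := isOpenMap_subMap α X A _ hZ.isOpen_compl
    rw [← Set.preimage_compl, Set.image_preimage_eq _ hsurj] at this
    exact isOpen_compl_iff.1 this

end Ind

/-! ### Attaching cells -/

/-- The product of two `G`-maps. -/
def GMap.prodMap {G : Type u} [Group G] {X X' Y Y' : GSpace G} (f : GMap X X') (g : GMap Y Y') :
    GMap (X.prod Y) (X'.prod Y') :=
  ⟨Prod.map f g, f.continuous_toFun.prodMap g.continuous_toFun,
    fun a z => Prod.ext (f.map_smul' a z.1) (g.map_smul' a z.2)⟩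

namespace GCWStructure

variable {G : Type u} [Group G] {W X Y : GSpace G}

/-- Every cell of `X` lies in `B` or lifts along `F`. -/
def LiftsCells (S : GCWStructure X) (B : SubMulAction G X) (F : GMap W X) : Prop :=
  ∀ k (e : S.cell k) (g : G), (∀ x, S.char e x ∈ B) ∨
    ∃ s : Disc k → W, Continuous s ∧ ∀ x, F (s x) = g • S.char e x

/-- Closedness in `X` is tested on cells, and every cell either lies in `B` or factors continuously
through `F`. -/
theorem isGPushout_of_liftsCells (S : GCWStructure X) {A : SubMulAction G W}
    {B : SubMulAction G X} {F : GMap W X} (hF : S.LiftsCells B F) (mem_iff : ∀ x, F x ∈ B ↔ x ∈ A)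
    (inj : ∀ x x', x ∉ A → F x = F x' → x = x') (surj : ∀ y, y ∉ B → ∃ x, F x = y) :
    IsGPushout A B F where
  mem_iff := mem_iff
  inj := inj
  surj := surj
  isClosed Z hZ hZB := by
    refine S.isClosed_of_cells Z fun k e g => Or.inl ?_
    rcases hF k e g with h | ⟨s, hs, h⟩
    · have hc : Continuous fun x => (⟨g • S.char e x, B.smul_mem g (h x)⟩ : B) :=
        ((continuous_const_smul g).comp (S.continuous_char e)).subtype_mk _
      exact hZB.preimage hc
    · convert hZ.preimage hs using 1
      ext x
      simp only [Set.mem_preimage, h]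
      rfl

/-- A product with `Y` need not preserve pushouts of spaces. Here closedness can be tested on
products of cells, and the cells of the second factor lie in `B` or lift along `F`. -/
theorem isGPushout_prod (S : GCWStructure Y) (T : GCWStructure X) (hT : T.IsFinite)
    (hproper : T.IsProper) {A : SubMulAction G W} {B : SubMulAction G X} {F : GMap W X}
    (hF : T.LiftsCells B F) (hFp : IsGPushout A B F) :
    IsGPushout (GSpace.prodSub (⊤ : SubMulAction G Y) A) (GSpace.prodSub ⊤ B)
      ((GMap.id Y).prodMap F) where
  mem_iff z := and_congr_right fun _ => hFp.mem_iff z.2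
  inj z z' hz h := by
    have h : ((z.1, F z.2) : Y × X) = (z'.1, F z'.2) := h
    exact Prod.ext (Prod.ext_iff.1 h).1 (hFp.inj _ _ (fun hA => hz ⟨trivial, hA⟩) (Prod.ext_iff.1 h).2)
  surj z hz := by
    obtain ⟨x, hx⟩ := hFp.surj z.2 fun hB => hz ⟨trivial, hB⟩
    exact ⟨(z.1, x), Prod.ext rfl hx⟩
  isClosed Z hZ hZB := by
    refine S.isClosed_prod_of_cells T hT hproper Z fun k e g l e' g' => ?_
    have hc₁ : Continuous fun p : Disc k × Disc l => g • S.char e p.1 :=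
      (continuous_const_smul g).comp ((S.continuous_char e).comp continuous_fst)
    have hc₂ : Continuous fun p : Disc k × Disc l => g' • T.char e' p.2 :=
      (continuous_const_smul g').comp ((T.continuous_char e').comp continuous_snd)
    rcases hF l e' g' with h | ⟨s, hs, h⟩
    · have hc : Continuous fun p : Disc k × Disc l =>
          (⟨(g • S.char e p.1, g' • T.char e' p.2), trivial, B.smul_mem g' (h p.2)⟩ :
            GSpace.prodSub (⊤ : SubMulAction G Y) B) := (hc₁.prodMk hc₂).subtype_mk _
      exact hZB.preimage hc
    · have hc : Continuous fun p : Disc k × Disc l => ((g • S.char e p.1, s p.2) : Y × W) :=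
        hc₁.prodMk (hs.comp continuous_snd)
      convert hZ.preimage hc using 1
      ext p
      change _ ↔ ((g • S.char e p.1, F (s p.2)) : Y × X) ∈ Z
      rw [h]
      rfl

/-- The simultaneous characteristic map of the `n`-cells of a free complex. -/
def attachMap (S : GCWStructure X) (n : ℕ) :
    GMap (Ind (1 : PUnit.{u + 1} →* G) (discSpace PUnit.{u + 1} (S.cell n) n)) X :=
  Ind.desc _ (fun t : Σ _ : S.cell n, Disc n => S.char t.1 t.2)
    (continuous_sigma fun e => S.continuous_char e) fun _ t => (one_smul G (S.char t.1 t.2)).symm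

theorem isGPushout_attachMap (S : GCWStructure X) (hfree : ∀ (g : G) (y : X), g • y = y → g = 1)
    (n : ℕ) (hn : ∀ k, S.cell k → k ≤ n) :
    IsGPushout (indSub _ (discBoundary PUnit.{u + 1} (S.cell n) n)) (S.skelLT n)
      (S.attachMap n) := by
  have hmem : ∀ (g : G) (e : S.cell n) (x : Disc n), g • S.char e x ∈ S.skelLT n ↔ ‖x.1‖ = 1 :=
    fun g e x => ⟨S.norm_eq_one_of_mem_skelLT e x g, fun h =>
      smul_char_mem_iff.2 (S.char_mem_skelLT_of_norm e x h)⟩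
  refine S.isGPushout_of_liftsCells (fun k e g => ?_) (fun y => ?_) (fun y y' hy h => ?_)
    fun y hy => ?_
  · rcases (hn k e).lt_or_eq with hk | rfl
    · exact Or.inl fun x => ⟨k, hk, e, 1, x, (one_smul _ _).symm⟩
    · exact Or.inr ⟨fun x => Ind.mk _ g (⟨e, x⟩ : Σ _ : S.cell k, Disc k),
        (continuous_indMk _ (discSpace PUnit.{u + 1} (S.cell k) k) g).comp continuous_sigmaMk,
        fun x => rfl⟩
  · obtain ⟨g, ⟨e, x⟩, rfl⟩ := indMk_surj _ _ y
    exact (hmem g e x).trans (Ind.mk_mem_indSub _ (A := discBoundary PUnit.{u + 1} (S.cell n) n)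
      (g := g) (x := (⟨e, x⟩ : Σ _ : S.cell n, Disc n))).symm
  · obtain ⟨g, ⟨e, x⟩, rfl⟩ := indMk_surj _ _ y
    obtain ⟨g', ⟨e', x'⟩, rfl⟩ := indMk_surj _ _ y'
    have h : g • S.char e x = g' • S.char e' x' := h
    have hx : ‖x.1‖ < 1 := by
      refine (norm_le_one x).lt_of_ne fun hx => hy ?_
      exact (Ind.mk_mem_indSub _ (A := discBoundary PUnit.{u + 1} (S.cell n) n)
        (g := g) (x := (⟨e, x⟩ : Σ _ : S.cell n, Disc n))).2 hx
    have hx' : ‖x'.1‖ < 1 := by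
      refine (norm_le_one x').lt_of_ne fun hx' => hx.ne ((hmem g e x).1 ?_)
      rw [h]
      exact (hmem g' e' x').2 hx'
    obtain ⟨h₁, h₂⟩ := S.smul_interior_inj _ _ _ _ _ _ hx hx' h
    cases h₁
    obtain rfl : g' = g := inv_mul_eq_one.1 (S.stab_eq_bot_of_free hfree _ h₂)
    rfl
  · obtain ⟨k, e, g, x, rfl⟩ := S.cover y
    rcases (hn k e).lt_or_eq with hk | rfl
    · exact absurd ⟨k, hk, e, g, x, rfl⟩ hy
    · exact ⟨Ind.mk _ g (⟨e, x⟩ : Σ _ : S.cell k, Disc k), rfl⟩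

/-- The complement of the interior of an equivariant cell. -/
def deleteCell (S : GCWStructure X) {n : ℕ} (e : S.cell n) : SubMulAction G X where
  carrier := {y | ∀ (g : G) (x : Disc n), ‖x.1‖ < 1 → y ≠ g • S.char e x}
  smul_mem' a y hy g x hx h := hy (a⁻¹ * g) x hx (by rw [mul_smul, ← h, inv_smul_smul])

/-- A closed cell of dimension at most `n` can meet the interior of an `n`-cell only in an interior
point of its own, and then both belong to the same equivariant cell. -/
theorem char_mem_deleteCell (S : GCWStructure X) {n k : ℕ} (hk : k ≤ n) {e : S.cell n}
    {e' : S.cell k}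
    (h : (⟨k, e'⟩ : Σ k, S.cell k) ≠ ⟨n, e⟩) (x : Disc k) : S.char e' x ∈ S.deleteCell e := by
  intro g z hz hx
  have hx' : (1 : G) • S.char e' x = g • S.char e z := by rw [one_smul, hx]
  obtain rfl : k = n := hk.antisymm (S.dim_le hz hx'.symm)
  have hxn : ‖x.1‖ < 1 := by
    refine (norm_le_one x).lt_of_ne fun hx₁ => hz.ne (S.norm_eq_one_of_mem_skelLT e z g ?_)
    rw [← hx]
    exact S.char_mem_skelLT_of_norm e' x hx₁
  obtain ⟨h₁, -⟩ := S.smul_interior_inj _ _ _ _ _ _ hxn hz hx'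
  cases h₁
  exact h rfl

theorem isSubcomplex_deleteCell (S : GCWStructure X) {n : ℕ} (hn : ∀ k, S.cell k → k ≤ n)
    (e : S.cell n) : S.IsSubcomplex (S.deleteCell e) := by
  intro k e' x hx hmem x'
  refine S.char_mem_deleteCell (hn k e') ?_ x'
  intro h
  cases h
  exact hmem 1 x hx (one_smul _ _).symm

/-- The characteristic map `G/H × Dⁿ → X` of an equivariant cell. -/
def cellAttachMap (S : GCWStructure X) {n : ℕ} (e : S.cell n) :
    GMap (Ind (S.stab e).subtype (discSpace (S.stab e) PUnit.{u + 1} n)) X :=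
  Ind.desc _ (fun t : Σ _ : PUnit.{u + 1}, Disc n => S.char e t.2)
    (continuous_sigma fun _ => S.continuous_char e) fun h t => (S.stab_smul e h.1 h.2 t.2).symm

theorem liftsCells_cellAttachMap (S : GCWStructure X) {n : ℕ} (hn : ∀ k, S.cell k → k ≤ n)
    (e : S.cell n) : S.LiftsCells (S.deleteCell e) (S.cellAttachMap e) := by
  intro k e' g
  by_cases h : (⟨k, e'⟩ : Σ k, S.cell k) = ⟨n, e⟩
  · cases h
    exact Or.inr ⟨fun x => Ind.mk _ g (⟨PUnit.unit, x⟩ : Σ _ : PUnit.{u + 1}, Disc n),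
      (continuous_indMk _ (discSpace (S.stab e) PUnit.{u + 1} n) g).comp continuous_sigmaMk,
      fun x => rfl⟩
  · exact Or.inl (S.char_mem_deleteCell (hn k e') h)

theorem isGPushout_cellAttachMap (S : GCWStructure X) {n : ℕ} (hn : ∀ k, S.cell k → k ≤ n)
    (e : S.cell n) :
    IsGPushout (indSub _ (discBoundary (S.stab e) PUnit.{u + 1} n)) (S.deleteCell e)
      (S.cellAttachMap e) := by
  have hmem : ∀ (g : G) (x : Disc n), g • S.char e x ∈ S.deleteCell e ↔ ‖x.1‖ = 1 := by
    refine fun g x => ⟨fun h => ?_, fun h g' x' hx' hx => ?_⟩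
    · by_contra hne
      exact h g x ((norm_le_one x).lt_of_ne hne) rfl
    · refine hx'.ne (S.norm_eq_one_of_mem_skelLT e x' g' ?_)
      rw [← hx]
      exact smul_char_mem_iff.2 (S.char_mem_skelLT_of_norm e x h)
  refine S.isGPushout_of_liftsCells (S.liftsCells_cellAttachMap hn e) (fun y => ?_)
    (fun y y' hy h => ?_) fun y hy => ?_
  · obtain ⟨g, ⟨_, x⟩, rfl⟩ := indMk_surj _ _ y
    exact (hmem g x).trans (Ind.mk_mem_indSub _ (A := discBoundary (S.stab e) PUnit.{u + 1} n)
      (g := g) (x := (⟨PUnit.unit, x⟩ : Σ _ : PUnit.{u + 1}, Disc n))).symm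
  · obtain ⟨g, ⟨_, x⟩, rfl⟩ := indMk_surj _ _ y
    obtain ⟨g', ⟨_, x'⟩, rfl⟩ := indMk_surj _ _ y'
    have h : g • S.char e x = g' • S.char e x' := h
    have hx : ‖x.1‖ < 1 := by
      refine (norm_le_one x).lt_of_ne fun hx => hy ?_
      exact (Ind.mk_mem_indSub _ (A := discBoundary (S.stab e) PUnit.{u + 1} n)
        (g := g) (x := (⟨PUnit.unit, x⟩ : Σ _ : PUnit.{u + 1}, Disc n))).2 hx
    have hx' : ‖x'.1‖ < 1 := by
      refine (norm_le_one x').lt_of_ne fun hx' => hx.ne ((hmem g x).1 ?_)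
      rw [h]
      exact (hmem g' x').2 hx'
    obtain ⟨h₁, h₂⟩ := S.smul_interior_inj _ _ _ _ _ _ hx hx' h
    cases h₁
    -- The two translations differ by an element of the stabilizer, which is absorbed in `G ×_H Dⁿ`
    -- because it acts trivially on the disc.
    have := indMk_mul (S.stab e).subtype (discSpace (S.stab e) PUnit.{u + 1} n) g' ⟨_, h₂⟩
      (⟨PUnit.unit, x⟩ : Σ _ : PUnit.{u + 1}, Disc n)
    rw [Subgroup.coe_subtype, mul_inv_cancel_left] at this
    exact this
  · have hy' : ¬ ∀ (g : G) (x : Disc n), ‖x.1‖ < 1 → y ≠ g • S.char e x := hy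
    push Not at hy'
    obtain ⟨g, x, -, rfl⟩ := hy'
    exact ⟨Ind.mk _ g (⟨PUnit.unit, x⟩ : Σ _ : PUnit.{u + 1}, Disc n), rfl⟩

end GCWStructure

/-! ### Consequences of the axioms -/

theorem GCWStructure.properGCWPair {G : Type u} [Group G] {X : GSpace G} (S : GCWStructure X)
    (hS : S.IsProper) {A : SubMulAction G X} (hA : S.IsSubcomplex A) : ProperGCWPair X A :=
  ⟨S, hS, by rintro _ rfl; exact hA⟩

theorem GCWStructure.properGCWPair_bot {G : Type u} [Group G] {X : GSpace G} (S : GCWStructure X)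
    (hS : S.IsProper) : ProperGCWPair X ⊥ := S.properGCWPair hS S.isSubcomplex_bot

theorem ProperGCWPair.sub {G : Type u} [Group G] {X : GSpace G} {A : SubMulAction G X}
    (h : ProperGCWPair X A) : ProperGCWPair (GSpace.sub A) ⊥ := by
  obtain ⟨S, hS, hA⟩ := h
  exact (S.restrict (hA A rfl)).properGCWPair_bot (hS.restrict _)

namespace GCohomologyTheory

variable {R : Type w} [CommRing R] {G : Type u} [Group G] (T : GCohomologyTheory.{u, v, w} R G)

/-- Only the middle pair has to be proper: if one of the outer pairs is not, its cohomology is zero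
and both sides vanish. -/
theorem map_comp' (n : ℤ) {X Y Z : GSpace G} {A : SubMulAction G X} {B : SubMulAction G Y}
    {C : SubMulAction G Z} (f : GMap X Y) (g : GMap Y Z) (hf : ∀ x ∈ A, f x ∈ B)
    (hg : ∀ y ∈ B, g y ∈ C) (hY : ProperGCWPair Y B) (c : T.H n Z C) :
    T.map n f hf (T.map n g hg c) = T.map n (g.comp f) (fun x hx => hg _ (hf x hx)) c := by
  by_cases hX : ProperGCWPair X A
  · by_cases hZ : ProperGCWPair Z C
    · exact (T.map_comp n f g hf hg hX hY hZ c).symm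
    · have := T.subsingleton_of_not n Z C hZ
      rw [Subsingleton.elim c 0]
      simp
  · exact (T.subsingleton_of_not n X A hX).elim _ _

theorem bijective_of_homotopyEquiv (n : ℤ) {X Y : GSpace G} {A : SubMulAction G X}
    {B : SubMulAction G Y} (f : GMap X Y) (g : GMap Y X) (hf : ∀ x ∈ A, f x ∈ B)
    (hg : ∀ y ∈ B, g y ∈ A) (hX : ProperGCWPair X A) (hY : ProperGCWPair Y B)
    (hgf : GHomotopic A A (g.comp f) (GMap.id X)) (hfg : GHomotopic B B (f.comp g) (GMap.id Y)) :
    Function.Bijective (T.map n f hf) := by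
  have h₁ := T.map_homotopic n (g.comp f) (GMap.id X) (fun x hx => hg _ (hf x hx)) (fun _ h => h)
    hX hX hgf
  have h₂ := T.map_homotopic n (f.comp g) (GMap.id Y) (fun x hx => hf _ (hg x hx)) (fun _ h => h)
    hY hY hfg
  refine Function.bijective_iff_has_inverse.2 ⟨T.map n g hg, fun y => ?_, fun x => ?_⟩
  · rw [T.map_comp' n g f hg hf hX, h₂, T.map_id]
  · rw [T.map_comp' n f g hf hg hY, h₁, T.map_id]

/-- The inclusion of the empty subspace induces an isomorphism by excision and the zero map by the
exact sequence of the pair `(X, ∅)`. -/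
theorem subsingleton_of_isEmpty (n : ℤ) (X : GSpace G) (A : SubMulAction G X) [IsEmpty X] :
    Subsingleton (T.H n X A) := by
  obtain rfl : A = ⊥ := SubMulAction.ext fun x => isEmptyElim x
  by_cases hX : ProperGCWPair X ⊥
  · have hp : IsGPushout ⊥ ⊥ (GMap.incl (⊥ : SubMulAction G X)) :=
      ⟨fun x => isEmptyElim x.1, fun x => isEmptyElim x.1, fun x => isEmptyElim x,
        fun Z _ _ => by
          convert isClosed_empty
          exact Set.eq_empty_of_isEmpty Z⟩
    have hb := T.excision n _ hp hX.sub hX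
    refine subsingleton_of_forall_eq 0 fun a => hb.1 ?_
    rw [map_zero]
    have := (T.exact_space n (⊥ : SubMulAction G X) hX).apply_apply_eq_zero a
    rwa [T.map_id] at this
  · exact T.subsingleton_of_not n X ⊥ hX

/-- Here `Y` is the disjoint union of `B` and the image of `X`. This is the injectivity part of
finite additivity, obtained from excision and exactness. -/
theorem eq_zero_of_pushout (n : ℤ) {X Y : GSpace G} {B : SubMulAction G Y} (F : GMap X Y)
    (hF : IsGPushout ⊥ B F) (hX : ProperGCWPair X ⊥) (hY : ProperGCWPair Y B) (a : T.H n Y ⊥)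
    (h₁ : T.map n (GMap.incl B) (GMap.bot_mem _ _) a = 0)
    (h₂ : T.map n F (GMap.bot_mem _ ⊥) a = 0) : a = 0 := by
  obtain ⟨b, rfl⟩ := (T.exact_space n B hY a).1 h₁
  have hb : b = 0 := by
    refine (T.excision n F hF hX hY).1 ?_
    rw [map_zero, ← h₂]
    exact (T.map_comp' n F (GMap.id Y) (GMap.bot_mem _ _) (GMap.bot_mem _ _) hY.bot b).symm
  rw [hb, map_zero]

theorem bdry_cup_bot {M : T.MulStructure} {m n k : ℤ} {X : GSpace G} {A C : SubMulAction G X}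
    (h : m + n = k) (h' : m + 1 + n = k + 1) (hX : ProperGCWPair X A) (hC : A ⊔ ⊥ = C)
    (hAC : A ≤ C) (u : T.H m (GSpace.sub A) ⊥) (v : T.H n X ⊥) (z : T.H k (GSpace.sub C) ⊥)
    (hz : T.map k (GMap.inclusion hAC) (GMap.bot_mem _ _) z =
      M.cup h (bot_sup_eq _) u (T.map n (GMap.incl A) (GMap.bot_mem _ _) v)) :
    T.bdry k C z = M.cup h' hC (T.bdry m A u) v := by
  subst hC
  have := M.bdry_cup h h' ((ProperGCW.insert_bot hX).mono (by
    rintro B (rfl | rfl)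
    · exact Or.inr rfl
    · exact Or.inl rfl)) u v z hz
  rw [← this]
  exact congrArg _ (T.map_id k z).symm

end GCohomologyTheory

namespace MultiplicativeCohomologyTheory

variable {R : Type w} [CommRing R] (𝓗 : MultiplicativeCohomologyTheory.{u, v, w} R)
variable {G H : Type u} [Group G] [Group H]

theorem pull_comp (n : ℤ) {X Y Z : GSpace G} (f : GMap X Y) (g : GMap Y Z)
    (hY : ProperGCWPair Y ⊥) (c : 𝓗.Abs n Z) :
    𝓗.pull n f (𝓗.pull n g c) = 𝓗.pull n (g.comp f) c :=
  (𝓗.thy G).map_comp' n f g _ _ hY c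

theorem pull_id (n : ℤ) {X : GSpace G} (c : 𝓗.Abs n X) : 𝓗.pull n (GMap.id X) c = c :=
  (𝓗.thy G).map_id n c

/-- A class of degree `0` commutes without sign. The form with the scalar on the right is the one to
which compatibility of products with the boundary applies. -/
theorem act_eq_cup (n : ℤ) {X : GSpace G} {A : SubMulAction G X} (hX : ProperGCWPair X A)
    (hn : n + 0 = n) (a : 𝓗.Abs 0 X) (c : 𝓗.Rel n X A) :
    𝓗.act n a c = (𝓗.mul G).cup hn (sup_bot_eq _) c a := by
  have := (𝓗.mul G).cup_comm (zero_add n) hn (bot_sup_eq A) (sup_bot_eq A)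
    (ProperGCW.insert_bot hX) a c
  simpa [act] using this

/-- The boundary homomorphism is linear over the cohomology of the total space. -/
theorem bdry_act (n : ℤ) {X : GSpace G} {A : SubMulAction G X} (a : 𝓗.Abs 0 X)
    (c : 𝓗.Abs n (GSpace.sub A)) :
    (𝓗.thy G).bdry n A (𝓗.act n (𝓗.pull 0 (GMap.incl A) a) c) =
      𝓗.act (n + 1) a ((𝓗.thy G).bdry n A c) := by
  by_cases hX : ProperGCWPair X A
  · rw [𝓗.act_eq_cup n hX.sub (add_zero n), 𝓗.act_eq_cup (n + 1) hX (add_zero _)]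
    refine (𝓗.thy G).bdry_cup_bot (M := 𝓗.mul G) (add_zero n) _ hX (sup_bot_eq A) le_rfl c a _ ?_
    have hb : (⊥ : SubMulAction G (GSpace.sub A)) ⊔ ⊥ = ⊥ := bot_sup_eq _
    exact (𝓗.thy G).map_id n _
  · exact ((𝓗.thy G).subsingleton_of_not (n + 1) X A hX).elim _ _

theorem indAbs_act (α : H →* G) (n : ℤ) {X : GSpace H} (a : 𝓗.Abs 0 (Ind α X))
    (b : 𝓗.Abs n (Ind α X)) :
    𝓗.indAbs α n X (𝓗.act n a b) = 𝓗.act n (𝓗.indAbs α 0 X a) (𝓗.indAbs α n X b) := by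
  by_cases h : ProperGCWPair X ⊥
  · exact 𝓗.ind_cup α _ _ _ _ _ _ (ProperGCW.mono (𝒜 := {⊥}) h (by simp)) a b
  · exact ((𝓗.thy H).subsingleton_of_not n X ⊥ h).elim _ _

theorem indAbs_pull (α : H →* G) (n : ℤ) {X Y : GSpace H} (f : GMap X Y)
    (hY : ProperGCWPair Y ⊥) (d : 𝓗.Abs n (Ind α Y)) :
    𝓗.indAbs α n X (𝓗.pull n (Ind.map α f) d) = 𝓗.pull n f (𝓗.indAbs α n Y d) := by
  by_cases h : ProperGCWPair X ⊥
  · exact 𝓗.ind_natural α n (indSub_bot α) (indSub_bot α) f (f.bot_mem ⊥)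
      ((Ind.map α f).bot_mem ⊥) h hY d
  · exact ((𝓗.thy H).subsingleton_of_not n X ⊥ h).elim _ _

/-- This is functoriality of induction for the composite `H → G → 1`. -/
theorem indAbs_coeffMap (α : H →* G) (X : GSpace H) (c : 𝓗.Coeff) :
    𝓗.indAbs α 0 X (𝓗.coeffMap (Ind α X) c) = 𝓗.coeffMap X c := by
  by_cases hX : ProperGCWPair X ⊥
  · let β : G →* PUnit.{u + 1} := 1
    have h := 𝓗.ind_comp β α 0 (indSub_bot α) (indSub_bot β) (indSub_bot _)
      ((Ind.assocMap β α X).bot_mem ⊥) hX (𝓗.pull 0 (GMap.toPt _) c)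
    refine h.symm.trans ?_
    have h' := 𝓗.pull_comp 0 (Ind.assocMap β α X) (GMap.toPt _) ((hX.ind_bot α).ind_bot β) c
    refine (congrArg _ h').trans ?_
    have hβ : β.comp α = 1 := rfl
    exact rfl
  · exact ((𝓗.thy H).subsingleton_of_not 0 X ⊥ hX).elim _ _

theorem indAbs_coeff_smul (α : H →* G) (n : ℤ) (X : GSpace H) (c : 𝓗.Coeff)
    (y : 𝓗.Abs n (Ind α X)) : 𝓗.indAbs α n X (c • y) = c • 𝓗.indAbs α n X y := by
  rw [coeff_smul_def, coeff_smul_def, indAbs_act, indAbs_coeffMap]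

theorem indAbs_bijective (α : H →* G) (n : ℤ) {X : GSpace H} (hX : ProperGCWPair X ⊥)
    (h : ∀ h ∈ α.ker, ∀ x : X, h • x = x → h = 1) : Function.Bijective (𝓗.indAbs α n X) :=
  𝓗.ind_bijective α n (indSub_bot α) hX h

theorem act_zero (n : ℤ) {X : GSpace G} {A : SubMulAction G X} (c : 𝓗.Rel n X A) :
    𝓗.act n 0 c = 0 := by
  rw [map_zero]
  rfl

/-- The cohomology of the empty space vanishes. -/
theorem pull_eq_zero_of_isEmpty (n : ℤ) {X Y : GSpace G} [IsEmpty X] (f : GMap X Y)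
    (a : 𝓗.Abs n Y) : 𝓗.pull n f a = 0 :=
  ((𝓗.thy G).subsingleton_of_isEmpty n X ⊥).elim _ _

end MultiplicativeCohomologyTheory

/-! ### Nilpotency of the augmentation ideal -/

theorem GMap.ext {G : Type u} [Group G] {X Y : GSpace G} {f g : GMap X Y} (h : ∀ x, f x = g x) :
    f = g := by
  obtain ⟨f, h₁, h₂⟩ := f
  obtain ⟨g, h₃, h₄⟩ := g
  obtain rfl : f = g := funext h
  rfl

theorem Ind.hom_ext {G H : Type u} [Group G] [Group H] (α : H →* G) {X : GSpace H} {Z : GSpace G}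
    {f f' : GMap (Ind α X) Z} (h : ∀ x, f (Ind.mk α 1 x) = f' (Ind.mk α 1 x)) : f = f' := by
  refine GMap.ext fun y => ?_
  obtain ⟨g, x, rfl⟩ := indMk_surj α X y
  have : indMk α X g x = g • Ind.mk α 1 x := by
    change _ = indMk α X (g * 1) x
    rw [mul_one]
  exact (congrArg f this).trans (((f.map_smul' _ _).trans ((congrArg _ (h x)).trans
    (f'.map_smul' _ _).symm)).trans (congrArg f' this).symm)

theorem Ind.homotopic_desc {G H : Type u} [Group G] [Group H] (α : H →* G) {X : GSpace H}
    {Z : GSpace G} (h : X → I → Z) (hc : Continuous fun p : X × I => h p.1 p.2)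
    (hα : ∀ (k : H) (x : X) (t : I), h (k • x) t = α k • h x t) (f₀ f₁ : GMap (Ind α X) Z)
    (h₀ : ∀ x, f₀ (Ind.mk α 1 x) = h x 0) (h₁ : ∀ x, f₁ (Ind.mk α 1 x) = h x 1) :
    GHomotopic ⊥ ⊥ f₀ f₁ := by
  have hct : ∀ t, Continuous fun x => h x t := fun t =>
    hc.comp (continuous_id.prodMk continuous_const)
  refine ⟨fun y t => Ind.desc α (fun x => h x t) (hct t) (fun k x => hα k x t) y, ?_, ?_, ?_,
    fun g y t => (Ind.desc α (fun x => h x t) (hct t) (fun k x => hα k x t)).map_smul' g y,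
    fun x hx => absurd hx (by exact fun h => h)⟩
  · exact continuous_ind_prod α X _ fun g => (Z.cont.continuous_const_smul g).comp hc
  · have : Ind.desc α (fun x => h x 0) (hct 0) (fun k x => hα k x 0) = f₀ :=
      Ind.hom_ext α fun x => (one_smul G _).trans (h₀ x).symm
    exact fun y => congrArg (fun f : GMap _ _ => f y) this
  · have : Ind.desc α (fun x => h x 1) (hct 1) (fun k x => hα k x 1) = f₁ :=
      Ind.hom_ext α fun x => (one_smul G _).trans (h₁ x).symm
    exact fun y => congrArg (fun f : GMap _ _ => f y) this

/-- Scaling of the disc. -/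
def discScale {n : ℕ} (t : I) (y : Disc n) : Disc n :=
  ⟨(t : ℝ) • y.1, by
    rw [mem_closedBall_zero_iff, norm_smul, Real.norm_of_nonneg t.2.1]
    exact mul_le_one₀ t.2.2 (norm_nonneg _) (GCWStructure.norm_le_one y)⟩

theorem discScale_zero {n : ℕ} (y : Disc n) : discScale 0 y = ⟨0, by simp⟩ :=
  Subtype.ext (by simp [discScale])

theorem discScale_one {n : ℕ} (y : Disc n) : discScale 1 y = y :=
  Subtype.ext (by simp [discScale])

theorem continuous_discScale (n : ℕ) : Continuous fun p : I × Disc n => discScale p.1 p.2 :=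
  ((continuous_subtype_val.comp continuous_fst).smul
    (continuous_subtype_val.comp continuous_snd)).subtype_mk _

/-- Contraction of the discs in a disjoint union. -/
theorem continuous_discSpace_scale (J : Type u) (n : ℕ) :
    Continuous fun p : (Σ _ : J, Disc n) × I =>
      (⟨p.1.1, discScale p.2 p.1.2⟩ : Σ _ : J, Disc n) := by
  refine (Homeomorph.sigmaProdDistrib (X := fun _ : J => Disc n)
    (Y := I)).symm.isQuotientMap.continuous_iff.2 ?_
  exact continuous_sigma fun j => continuous_sigmaMk.comp
    ((continuous_discScale n).comp continuous_swap)

namespace GCWStructure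

variable {G : Type u} [Group G] {X : GSpace G}

theorem card_restrict_deleteCell_lt (S : GCWStructure X) (hS : S.IsFinite) {n : ℕ} (e : S.cell n)
    (he : S.IsSubcomplex (S.deleteCell e)) :
    Nat.card (Σ k, (S.restrict he).cell k) < Nat.card (Σ k, S.cell k) := by
  have : Finite (Σ k, S.cell k) := hS
  let φ : (Σ k, (S.restrict he).cell k) → Σ k, S.cell k := fun c => ⟨c.1, c.2.1⟩
  have hφ : Function.Injective φ := by
    rintro ⟨n, e₁⟩ ⟨m, e₂⟩ h
    obtain ⟨rfl, h⟩ := Sigma.mk.inj_iff.1 h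
    exact congrArg _ (Subtype.ext (eq_of_heq h))
  have hne : ∀ c, φ c ≠ ⟨n, e⟩ := by
    rintro ⟨k, e', he'⟩ h
    have h : (⟨k, e'⟩ : Σ k, S.cell k) = ⟨n, e⟩ := h
    cases h
    exact he' ⟨0, by simp⟩ 1 ⟨0, by simp⟩ (by simp) (one_smul _ _).symm
  have hφ' : Finite (Σ k, (S.restrict he).cell k) := Finite.of_injective φ hφ
  refine (Nat.card_le_card_of_injective φ hφ).lt_of_ne fun h => ?_
  obtain ⟨c, hc⟩ := ((Function.Injective.bijective_of_nat_card_le hφ h.ge).2) ⟨n, e⟩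
  exact hne c hc

theorem isEmpty_of_cell (S : GCWStructure X) (h : ∀ n, IsEmpty (S.cell n)) : IsEmpty X :=
  ⟨fun x => by
    obtain ⟨n, e, -⟩ := S.cover x
    exact (h n).elim e⟩

theorem isGPushout_orbitMap (S : GCWStructure X) (hfree : ∀ (g : G) (y : X), g • y = y → g = 1)
    (h₀ : ∀ k, S.cell k → k ≤ 0) (e : S.cell 0) (x : Disc 0) :
    IsGPushout ⊥ (S.deleteCell e) (GSpace.orbitMap (S.char e x)) := by
  have hx : ∀ y : Disc 0, y = x := fun y => Subsingleton.elim _ _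
  have hx₁ : ‖x.1‖ < 1 := by
    rw [Subsingleton.elim x.1 0, norm_zero]
    norm_num
  refine S.isGPushout_of_liftsCells (fun k e' g => ?_) (fun y => ?_) (fun y y' _ h => ?_)
    fun y hy => ?_
  · by_cases h : (⟨k, e'⟩ : Σ k, S.cell k) = ⟨0, e⟩
    · cases h
      refine Or.inr ⟨fun _ => Ind.mk _ g PUnit.unit, continuous_const, fun z => ?_⟩
      rw [hx z]
      rfl
    · exact Or.inl (S.char_mem_deleteCell (h₀ k e') h)
  · obtain ⟨g, p, rfl⟩ := indMk_surj _ _ y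
    exact ⟨fun h => absurd rfl (h g x hx₁), fun h => absurd h (by exact fun h => h)⟩
  · obtain ⟨g, p, rfl⟩ := indMk_surj _ _ y
    obtain ⟨g', p', rfl⟩ := indMk_surj _ _ y'
    have h : g • S.char e x = g' • S.char e x := h
    have := hfree (g'⁻¹ * g) _ (by rw [mul_smul, h, inv_smul_smul])
    obtain rfl := inv_mul_eq_one.1 this
    rfl
  · have hy' : ¬ ∀ (g : G) (x : Disc 0), ‖x.1‖ < 1 → y ≠ g • S.char e x := hy
    push Not at hy'
    obtain ⟨g, z, -, rfl⟩ := hy'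
    exact ⟨Ind.mk _ g PUnit.unit, by rw [hx z]; rfl⟩

end GCWStructure

/-! ### Vanishing of powers of the augmentation ideal on free complexes -/

namespace MultiplicativeCohomologyTheory

variable {R : Type w} [CommRing R] (𝓗 : MultiplicativeCohomologyTheory.{u, v, w} R)
variable {G : Type u} [Group G] {X Y : GSpace G}

theorem pull_mem_augmentationIdeal (f : GMap X Y) {a : 𝓗.Abs 0 Y}
    (ha : a ∈ 𝓗.augmentationIdeal Y) : 𝓗.pull 0 f a ∈ 𝓗.augmentationIdeal X := by
  by_cases hX : ProperGCWPair X ⊥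
  · intro x
    have h : f.comp (GSpace.orbitMap x) = GSpace.orbitMap (f x) :=
      GMap.ext fun y => by
        obtain ⟨g, p, rfl⟩ := indMk_surj _ _ y
        exact f.map_smul' g x
    have := ha (f x)
    unfold pointEval at this ⊢
    rwa [𝓗.pull_comp 0 _ f hX, h]
  · have := (𝓗.thy G).subsingleton_of_not 0 X ⊥ hX
    rw [Subsingleton.elim (𝓗.pull 0 f a) 0]
    exact zero_mem _

theorem pull_mem_augmentationIdeal_pow (f : GMap X Y) (hY : ProperGCWPair Y ⊥) {k : ℕ}
    {a : 𝓗.Abs 0 Y} (ha : a ∈ 𝓗.augmentationIdeal Y ^ k) :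
    𝓗.pull 0 f a ∈ 𝓗.augmentationIdeal X ^ k := by
  have h : (𝓗.augmentationIdeal Y).map (𝓗.pullRingHom f hY) ≤ 𝓗.augmentationIdeal X :=
    Ideal.map_le_iff_le_comap.2 fun a ha => 𝓗.pull_mem_augmentationIdeal f ha
  have h' := Ideal.mem_map_of_mem (𝓗.pullRingHom f hY) ha
  rw [Ideal.map_pow] at h'
  exact Ideal.pow_right_mono h k h'

/-- Induction along `1 → G` is injective on cohomology because its kernel is trivial; hence a class
with zero augmentation already vanishes on each free orbit `G → X`. -/
theorem pull_orbitMap_eq_zero {a : 𝓗.Abs 0 X} (ha : a ∈ 𝓗.augmentationIdeal X) (x : X) :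
    𝓗.pull 0 (GSpace.orbitMap x) a = 0 := by
  refine (𝓗.indAbs_bijective (1 : PUnit.{u + 1} →* G) 0 ProperGCWPair.point
    fun _ _ _ _ => rfl).1 ?_
  rw [map_zero]
  exact ha x

/-- The augmentation ideal of a finite free `0`-dimensional complex vanishes. -/
theorem eq_zero_of_mem_augmentationIdeal (S : GCWStructure X)
    (hfree : ∀ (g : G) (y : X), g • y = y → g = 1) (hS : S.IsFinite)
    (h₀ : ∀ k, S.cell k → k ≤ 0) {a : 𝓗.Abs 0 X} (ha : a ∈ 𝓗.augmentationIdeal X) : a = 0 := by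
  induction hc : Nat.card (Σ k, S.cell k) using Nat.strong_induction_on generalizing X with
  | _ c ih =>
    have hp := GCWStructure.isProper_of_free S hfree
    by_cases he : Nonempty (S.cell 0)
    · obtain ⟨e⟩ := he
      have hsub := S.isSubcomplex_deleteCell h₀ e
      -- One free orbit is split off at a time; the class vanishes on it by assumption and on the
      -- rest by induction on the number of cells. Finiteness is essential, as there is no disjoint
      -- union axiom.
      refine (𝓗.thy G).eq_zero_of_pushout 0 _ (S.isGPushout_orbitMap hfree h₀ e ⟨0, by simp⟩)
        (ProperGCWPair.point.ind_bot _) (S.properGCWPair hp hsub) a ?_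
        (𝓗.pull_orbitMap_eq_zero ha _)
      exact ih _ (hc ▸ S.card_restrict_deleteCell_lt hS e hsub) (S.restrict hsub)
        (GSpace.sub_free hfree _) (hS.restrict hsub) (fun k e => h₀ k e.1)
        (𝓗.pull_mem_augmentationIdeal _ ha) rfl
    · have : IsEmpty X := S.isEmpty_of_cell fun n => ⟨fun e => by
        obtain rfl := Nat.le_zero.1 (h₀ n e)
        exact he ⟨e⟩⟩
      exact ((𝓗.thy G).subsingleton_of_isEmpty 0 X ⊥).elim _ _

/-- The augmentation ideal of a finite proper complex vanishes on free discs of any number. -/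
theorem pull_discs_eq_zero (T : GCWStructure X) (hT : T.IsFinite) (hproper : T.IsProper)
    (J : Type u) (n : ℕ)
    (ψ : GMap (Ind (1 : PUnit.{u + 1} →* G) (discSpace PUnit.{u + 1} J n)) X)
    {a : 𝓗.Abs 0 X} (ha : a ∈ 𝓗.augmentationIdeal X) : 𝓗.pull 0 ψ a = 0 := by
  have hX := T.properGCWPair_bot hproper
  let α : PUnit.{u + 1} →* G := 1
  let C := Σ k, T.cell k
  have hC : Finite C := hT
  have hcov : ∀ j : J, ∃ (c : C) (g : G) (x : Disc c.1),
      ψ (Ind.mk α 1 (⟨j, ⟨0, by simp⟩⟩ : Σ _ : J, Disc n)) = g • T.char c.2 x := fun j => by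
    obtain ⟨n, e, g, x, h⟩ := T.cover (ψ (Ind.mk α 1 (⟨j, ⟨0, by simp⟩⟩ : Σ _ : J, Disc n)))
    exact ⟨⟨n, e⟩, g, x, h⟩
  choose c γ x hx using hcov
  -- `Q` is a disjoint union of copies of `G`, one for each of the finitely many cells of `X`. The
  -- map `q` sends the `j`-th disc to the translate by `γ j` of the point for the cell containing
  -- the image of its centre, and `p` sends that point to the centre of the cell. Thus `ψ` factors
  -- through `Q` up to homotopy, however large `J` is.
  let Q := Ind α (discSpace PUnit.{u + 1} C 0)
  have hQp : ProperGCWPair Q ⊥ :=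
    ((discCW PUnit.{u + 1} C 0).properGCWPair_bot (discCW_isProper _ _ _)).ind_bot α
  have hDp : ProperGCWPair (Ind α (discSpace PUnit.{u + 1} J n)) ⊥ :=
    ((discCW PUnit.{u + 1} J n).properGCWPair_bot (discCW_isProper _ _ _)).ind_bot α
  let z₀ : Disc 0 := ⟨0, by simp⟩
  let q' : (Σ _ : J, Disc n) → Q := fun t => Ind.mk α (γ t.1) (⟨c t.1, z₀⟩ : Σ _ : C, Disc 0)
  have hq' : Continuous q' := continuous_sigma fun j => by
    change Continuous fun _ : Disc n => q' ⟨j, ⟨0, by simp⟩⟩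
    exact continuous_const
  let q : GMap (Ind α (discSpace PUnit.{u + 1} J n)) Q :=
    Ind.desc α q' hq' fun _ _ => (one_smul G _).symm
  let p' : (Σ _ : C, Disc 0) → X := fun t => T.char t.1.2 ⟨0, by simp⟩
  have hp' : Continuous p' := continuous_sigma fun j => by
    change Continuous fun _ : Disc 0 => p' ⟨j, z₀⟩
    exact continuous_const
  let p : GMap Q X := Ind.desc α p' hp' fun _ _ => (one_smul G _).symm
  let ψ' : (Σ _ : J, Disc n) → X := fun t => γ t.1 • T.char (c t.1).2 (x t.1)
  have hψ' : Continuous ψ' := continuous_sigma fun j => by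
    change Continuous fun _ : Disc n => ψ' ⟨j, ⟨0, by simp⟩⟩
    exact continuous_const
  let ψ₁ : GMap (Ind α (discSpace PUnit.{u + 1} J n)) X :=
    Ind.desc α ψ' hψ' fun _ _ => (one_smul G _).symm
  -- Move from the centre of the cell to the point `x j` inside that cell.
  have h₁ : GHomotopic ⊥ ⊥ (p.comp q) ψ₁ := by
    refine Ind.homotopic_desc α (fun (t : Σ _ : J, Disc n) s =>
      γ t.1 • T.char (c t.1).2 (discScale s (x t.1))) ?_ (fun _ _ _ => (one_smul G _).symm) _ _
      (fun t => ?_) fun t => ?_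
    · refine (Homeomorph.sigmaProdDistrib (X := fun _ : J => Disc n)
        (Y := I)).symm.isQuotientMap.continuous_iff.2 (continuous_sigma fun j => ?_)
      change Continuous fun b : Disc n × I => γ j • T.char (c j).2 (discScale b.2 (x j))
      exact (X.cont.continuous_const_smul (γ j)).comp ((T.continuous_char _).comp
        ((continuous_discScale _).comp (continuous_snd.prodMk continuous_const)))
    · obtain ⟨j, y⟩ := t
      rw [discScale_zero]
      exact congrArg p (one_smul G (Ind.mk α (γ j) (⟨c j, z₀⟩ : Σ _ : C, Disc 0) : Q))
    · obtain ⟨j, y⟩ := t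
      change (1 : G) • γ j • T.char (c j).2 (x j) = _
      rw [one_smul, discScale_one]
  -- Expand each disc from its centre.
  have h₂ : GHomotopic ⊥ ⊥ ψ₁ ψ := by
    refine Ind.homotopic_desc α (fun (t : Σ _ : J, Disc n) s =>
      ψ (Ind.mk α 1 (⟨t.1, discScale s t.2⟩ : Σ _ : J, Disc n))) ?_
      (fun _ _ _ => (one_smul G _).symm) _ _ (fun t => ?_) fun t => ?_
    · exact ψ.continuous_toFun.comp
        ((continuous_indMk α (discSpace PUnit.{u + 1} J n) 1).comp
          (continuous_discSpace_scale J n))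
    · obtain ⟨j, y⟩ := t
      change (1 : G) • γ j • T.char (c j).2 (x j) = _
      rw [one_smul, discScale_zero, hx]
    · obtain ⟨j, y⟩ := t
      change ψ _ = ψ _
      rw [discScale_one]
  have hz : 𝓗.pull 0 p a = 0 := by
    refine 𝓗.eq_zero_of_mem_augmentationIdeal ((discCW PUnit.{u + 1} C 0).ind α) ?_ ?_
      (fun k e => e.2.le) (𝓗.pull_mem_augmentationIdeal p ha)
    · intro g y hy
      obtain ⟨g', t, rfl⟩ := indMk_surj _ _ y
      obtain ⟨k, hk, -⟩ := (indMk_eq_iff α _ (g * g') g' t t).1 hy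
      have : g' = g * g' := hk.trans (mul_one _)
      exact (right_eq_mul.1 this)
    · refine Finite.of_injective (fun s : Σ k, ((discCW PUnit.{u + 1} C 0).ind α).cell k =>
        ((s.2.1, ⟨s.1, s.2.2⟩) : C × Σ k, DiscCell 0 k)) ?_
      rintro ⟨k, e₁, e₂⟩ ⟨l, e₃, e₄⟩ h
      obtain ⟨h, h'⟩ := Prod.ext_iff.1 h
      obtain rfl : e₁ = e₃ := h
      obtain ⟨rfl, h'⟩ := Sigma.mk.inj_iff.1 h'
      obtain rfl := eq_of_heq h'
      rfl
  have e₁ : 𝓗.pull 0 (p.comp q) = 𝓗.pull 0 ψ₁ :=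
    (𝓗.thy G).map_homotopic 0 _ _ _ _ hDp hX h₁
  have e₂ : 𝓗.pull 0 ψ₁ = 𝓗.pull 0 ψ :=
    (𝓗.thy G).map_homotopic 0 _ _ _ _ hDp hX h₂
  rw [← e₂, ← e₁, ← 𝓗.pull_comp 0 q p hQp, hz, map_zero]

/-- The `k`-th power of the augmentation ideal of a finite proper complex vanishes on free complexes
of dimension less than `k`. -/
theorem pull_eq_zero_of_mem_pow (T : GCWStructure X) (hT : T.IsFinite) (hproper : T.IsProper)
    (k : ℕ) {Y : GSpace G} (S : GCWStructure Y) (hfree : ∀ (g : G) (y : Y), g • y = y → g = 1)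
    (hS : ∀ n, S.cell n → n < k) (p : GMap Y X) {a : 𝓗.Abs 0 X}
    (ha : a ∈ 𝓗.augmentationIdeal X ^ k) : 𝓗.pull 0 p a = 0 := by
  induction k generalizing Y a with
  | zero =>
    have : IsEmpty Y := S.isEmpty_of_cell fun n => ⟨fun e => absurd (hS n e) n.not_lt_zero⟩
    exact 𝓗.pull_eq_zero_of_isEmpty 0 p a
  | succ k ih =>
    have hX := T.properGCWPair_bot hproper
    have hp := GCWStructure.isProper_of_free S hfree
    have hY := S.properGCWPair_bot hp
    have hsub := S.isSubcomplex_skelLT k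
    have hYB := S.properGCWPair hp hsub
    rw [pow_succ] at ha
    induction ha using Submodule.mul_induction_on' with
    | add x _ y _ hx hy => rw [map_add, hx, hy, add_zero]
    | mem_mul_mem b hb c hc =>
      rw [mul_comm]
      refine ((𝓗.pullRingHom p hX).map_mul c b).trans ?_
      -- The product consists of `b` in the `k`-th power and `c` in the ideal itself. By induction
      -- `b` vanishes below dimension `k`, so it lifts to a relative class `z` of the top cells.
      have hb' : 𝓗.pull 0 (GMap.incl (S.skelLT k)) (𝓗.pull 0 p b) = 0 := by
        rw [𝓗.pull_comp 0 _ _ hY]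
        refine ih (S.restrict hsub) (GSpace.sub_free hfree _)
          (fun n e => ?_) _ hb
        obtain ⟨l, hl, e', g, x', h⟩ := e.2 ⟨0, by simp⟩
        exact (S.dim_le (g := 1) (by simp) ((one_smul _ _).trans h)).trans_lt hl
      obtain ⟨z, hz⟩ := ((𝓗.thy G).exact_space 0 (S.skelLT k) hYB (𝓗.pull 0 p b)).1 hb'
      -- After excision `z` lives on free discs relative to their boundaries, where `c` acts by
      -- zero; and `c · z` maps to the product `c · b` on `Y`.
      have hcz : 𝓗.act 0 (𝓗.pull 0 p c) z = 0 := by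
        have hn : ∀ n, S.cell n → n ≤ k := fun n e => Nat.lt_succ_iff.1 (hS n e)
        have hpo := S.isGPushout_attachMap hfree k hn
        refine ((𝓗.thy G).excision 0 _ hpo (((discCW PUnit.{u + 1} (S.cell k) k).properGCWPair
          (discCW_isProper _ _ _) (discBoundary_isSubcomplex _ _ _)).ind _) hYB).1 ?_
        rw [map_zero]
        refine (𝓗.map_act 0 _ _ hYB _ z).trans ?_
        rw [𝓗.pull_comp 0 _ _ hY, 𝓗.pull_discs_eq_zero T hT hproper _ _ _ hc]
        exact 𝓗.act_zero 0 _
      have := 𝓗.map_act 0 (A := ⊥) (GMap.id Y) (GMap.bot_mem _ _) hYB (𝓗.pull 0 p c) z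
      rw [hcz, map_zero, hz, 𝓗.pull_id] at this
      exact this.symm

end MultiplicativeCohomologyTheory

/-! ### The comparison of a pair with its Borel construction -/

/-- `(X, A)` is a pair of finite proper `G`-CW-complexes. -/
def FiniteProperPair {G : Type u} [Group G] (X : GSpace G) (A : SubMulAction G X) : Prop :=
  ∃ T : GCWStructure X, T.IsFinite ∧ T.IsProper ∧ T.IsSubcomplex A

namespace FiniteProperPair

variable {G : Type u} [Group G] {X Y : GSpace G} {A : SubMulAction G X}

theorem proper (h : FiniteProperPair X A) : ProperGCWPair X A := by
  obtain ⟨T, -, hT, hA⟩ := h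
  exact T.properGCWPair hT hA

theorem bot (h : FiniteProperPair X A) : FiniteProperPair X (⊥ : SubMulAction G X) := by
  obtain ⟨T, hf, hT, -⟩ := h
  exact ⟨T, hf, hT, T.isSubcomplex_bot⟩

theorem prod (h : FiniteProperPair X A) (S : GCWStructure Y)
    (hfree : ∀ (g : G) (y : Y), g • y = y → g = 1) :
    ProperGCWPair (Y.prod X) (GSpace.prodSub ⊤ A) := by
  obtain ⟨T, hf, hT, hA⟩ := h
  exact (S.prod hfree T hf hT).properGCWPair (S.isProper_prod hfree T hf hT)
    (GCWStructure.IsSubcomplex.prodSub hfree hf hT (fun _ _ _ _ _ _ => trivial) hA)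

end FiniteProperPair

theorem GCWStructure.isSubcomplex_skel {G : Type u} [Group G] {X : GSpace G} (S : GCWStructure X)
    (k : ℕ) : S.IsSubcomplex (S.skel k) := S.skelLT_succ k ▸ S.isSubcomplex_skelLT (k + 1)

theorem GCWStructure.dim_le_of_mem_skel {G : Type u} [Group G] {X : GSpace G}
    (S : GCWStructure X) {n k : ℕ} {e : S.cell n} {x : Disc n} (hx : ‖x.1‖ < 1)
    (h : S.char e x ∈ S.skel k) : n ≤ k := by
  obtain ⟨l, hl, e', g, x', h⟩ := h
  exact (S.dim_le (g := 1) hx ((one_smul _ _).trans h)).trans hl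

theorem GSpace.prodSub_top_bot {G : Type u} [Group G] {X Y : GSpace G} :
    GSpace.prodSub (⊤ : SubMulAction G Y) (⊥ : SubMulAction G X) = ⊥ :=
  SubMulAction.ext fun _ => ⟨fun h => absurd h.2 (by exact fun h => h),
    fun h => absurd h (by exact fun h => h)⟩

theorem GMap.prodMap_mem {G : Type u} [Group G] {X X' Y Y' : GSpace G} {A : SubMulAction G X}
    {B : SubMulAction G X'} (e : GMap Y Y') (g : GMap X X') (hg : ∀ x ∈ A, g x ∈ B) :
    ∀ z ∈ GSpace.prodSub (⊤ : SubMulAction G Y) A, e.prodMap g z ∈ GSpace.prodSub ⊤ B :=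
  fun z hz => ⟨trivial, hg z.2 hz.2⟩

theorem GMap.snd_mem {G : Type u} [Group G] {X : GSpace G} (Y : GSpace G) (A : SubMulAction G X) :
    ∀ z ∈ GSpace.prodSub (⊤ : SubMulAction G Y) A, GMap.snd Y X z ∈ A := fun _ hz => hz.2

theorem GHomotopic.prodMap {G : Type u} [Group G] {X X' Y : GSpace G} {A : SubMulAction G X}
    {B : SubMulAction G X'} {f₀ f₁ : GMap X X'} (h : GHomotopic A B f₀ f₁) :
    GHomotopic (GSpace.prodSub ⊤ A) (GSpace.prodSub ⊤ B) ((GMap.id Y).prodMap f₀)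
      ((GMap.id Y).prodMap f₁) := by
  obtain ⟨h, hc, h₀, h₁, hs, hA⟩ := h
  refine ⟨fun z t => (z.1, h z.2 t), ?_, fun z => Prod.ext rfl (h₀ z.2),
    fun z => Prod.ext rfl (h₁ z.2), fun g z t => Prod.ext rfl (hs g z.2 t),
    fun z hz t => ⟨trivial, hA _ hz.2 t⟩⟩
  exact (continuous_fst.comp continuous_fst).prodMk
    (hc.comp ((continuous_snd.comp continuous_fst).prodMk continuous_snd))

/-- The canonical homeomorphism from the subspace `Y × A ⊆ Y × X` to `Y × A`. -/
def GMap.prodSubMap {G : Type u} [Group G] {X : GSpace G} (Y : GSpace G) (A : SubMulAction G X) :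
    GMap (GSpace.sub (X := Y.prod X) (GSpace.prodSub ⊤ A)) (Y.prod (GSpace.sub A)) where
  toFun z := (z.1.1, ⟨z.1.2, z.2.2⟩)
  continuous_toFun := by
    have h : Continuous fun z : GSpace.sub (X := Y.prod X) (GSpace.prodSub ⊤ A) =>
      (z.1 : Y × X) := continuous_subtype_val
    exact (continuous_fst.comp h).prodMk ((continuous_snd.comp h).subtype_mk _)
  map_smul' _ _ := rfl

/-- The inverse of `GMap.prodSubMap`. -/
def GMap.prodSubMapSymm {G : Type u} [Group G] {X : GSpace G} (Y : GSpace G)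
    (A : SubMulAction G X) :
    GMap (Y.prod (GSpace.sub A)) (GSpace.sub (X := Y.prod X) (GSpace.prodSub ⊤ A)) where
  toFun z := ⟨(z.1, z.2.1), trivial, z.2.2⟩
  continuous_toFun := by
    have h : Continuous fun z : Y × A => ((z.1, z.2.1) : Y × X) :=
      continuous_fst.prodMk (continuous_subtype_val.comp continuous_snd)
    exact h.subtype_mk _
  map_smul' _ _ := rfl

namespace ClassifyingSpace

variable {G : Type u} [Group G] (E : ClassifyingSpace G)

/-- The skeleta of `EG`. -/
def skelSpace (k : ℕ) : GSpace G := GSpace.sub (E.cw.skel k)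

def skelCW (k : ℕ) : GCWStructure (E.skelSpace k) := E.cw.restrict (E.cw.isSubcomplex_skel k)

theorem skel_free (k : ℕ) : ∀ (g : G) (y : E.skelSpace k), g • y = y → g = 1 :=
  GSpace.sub_free E.free _

theorem skelCW_dim_le (k n : ℕ) (e : (E.skelCW k).cell n) : n ≤ k :=
  E.cw.dim_le_of_mem_skel (x := ⟨0, by simp⟩) (by simp) (e.2 ⟨0, by simp⟩)

def skelIncl {j k : ℕ} (h : j ≤ k) : GMap (E.skelSpace j) (E.skelSpace k) :=
  GMap.inclusion (E.cw.skel_mono h)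

end ClassifyingSpace

theorem FiniteProperPair.skelProd {G : Type u} [Group G] {X : GSpace G} {A : SubMulAction G X}
    (h : FiniteProperPair X A) (E : ClassifyingSpace G) (k : ℕ) :
    ProperGCWPair ((E.skelSpace k).prod X) (GSpace.prodSub ⊤ A) :=
  h.prod (E.skelCW k) (E.skel_free k)

namespace GCohomologyTheory

variable {R : Type w} [CommRing R] {G : Type u} [Group G] (T : GCohomologyTheory.{u, v, w} R G)

theorem map_map (n : ℤ) {X Y Z : GSpace G} {A : SubMulAction G X} {B : SubMulAction G Y}
    {C : SubMulAction G Z} {f : GMap X Y} {g : GMap Y Z} {k : GMap X Z} (h : g.comp f = k)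
    (hf : ∀ x ∈ A, f x ∈ B) (hg : ∀ y ∈ B, g y ∈ C) (hk : ∀ x ∈ A, k x ∈ C)
    (hY : ProperGCWPair Y B) (c : T.H n Z C) :
    T.map n f hf (T.map n g hg c) = T.map n k hk c := by
  subst h
  exact T.map_comp' n f g hf hg hY c

theorem map_inverse (n : ℤ) {X Y : GSpace G} {A : SubMulAction G X}
    {B : SubMulAction G Y} {f : GMap X Y} {g : GMap Y X} (hf : ∀ x ∈ A, f x ∈ B)
    (hg : ∀ y ∈ B, g y ∈ A) (hY : ProperGCWPair Y B)
    (hgf : g.comp f = GMap.id X) (a : T.H n X A) : T.map n f hf (T.map n g hg a) = a := by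
  rw [T.map_map n hgf hf hg (fun _ h => h) hY, T.map_id]

theorem bijective_of_inverse (n : ℤ) {X Y : GSpace G} {A : SubMulAction G X}
    {B : SubMulAction G Y} {f : GMap X Y} (g : GMap Y X) (hf : ∀ x ∈ A, f x ∈ B)
    (hg : ∀ y ∈ B, g y ∈ A) (hX : ProperGCWPair X A) (hY : ProperGCWPair Y B)
    (hgf : g.comp f = GMap.id X) (hfg : f.comp g = GMap.id Y) :
    Function.Bijective (T.map n f hf) :=
  Function.bijective_iff_has_inverse.2 ⟨T.map n g hg, T.map_inverse n hg hf hX hfg,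
    T.map_inverse n hf hg hY hgf⟩

/-! The long exact sequence of a pair `(Z, A)` in terms of a space `W` homeomorphic to `A`. -/

section Exact

variable (n : ℤ) {Z W : GSpace G} {A C : SubMulAction G Z} {C' : SubMulAction G W} (hC : C = ⊥)
  (hC' : C' = ⊥) (hZ : ProperGCWPair Z A) (hW : ProperGCWPair W C') {κ : GMap (GSpace.sub A) W}
  {ι : GMap W (GSpace.sub A)} (hικ : ι.comp κ = GMap.id _) (hκι : κ.comp ι = GMap.id _)
  {i : GMap Z Z} (hi : i = GMap.id Z) (hi' : ∀ z ∈ C, i z ∈ A)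
  {j : GMap W Z} (hj : (GMap.incl A).comp ι = j) (hj' : ∀ z ∈ C', j z ∈ C)
  (hκ : ∀ z ∈ (⊥ : SubMulAction G (GSpace.sub A)), κ z ∈ C')

-- The subsets and maps are arbitrary up to given equalities because `Y × ∅` is the empty subset
-- only propositionally, and because `Y × A` as a product and as a subspace of `Y × X` are different
-- spaces.
include hC hC' hZ hW hικ hκι hi hj in
theorem exact_space_of_iso : Function.Exact (T.map n i hi') (T.map n j hj') := by
  subst hC hC' hi hj
  intro a
  rw [← T.exact_space n A hZ a]
  have h := T.map_map n rfl (GMap.bot_mem ι ⊥) (GMap.bot_mem (GMap.incl A) ⊥) hj' hZ.sub a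
  rw [← h]
  exact map_eq_zero_iff _ (T.bijective_of_inverse n κ _ (GMap.bot_mem κ ⊥) hW hZ.sub hκι hικ).1

include hC hC' hZ hW hικ hκι hj in
theorem exact_sub_of_iso :
    Function.Exact (T.map n j hj') ((T.bdry n A).comp (T.map n κ hκ)) := by
  subst hC hC' hj
  intro a
  refine (T.exact_sub n A hZ _).trans ?_
  constructor
  · rintro ⟨b, hb⟩
    refine ⟨b, ?_⟩
    rw [← T.map_map n rfl (GMap.bot_mem ι ⊥) (GMap.bot_mem (GMap.incl A) ⊥) hj' hZ.sub b, hb]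
    exact T.map_inverse n _ _ hZ.sub hκι a
  · rintro ⟨b, rfl⟩
    refine ⟨b, ?_⟩
    rw [← T.map_map n rfl (GMap.bot_mem ι ⊥) (GMap.bot_mem (GMap.incl A) ⊥) hj' hZ.sub b]
    exact (T.map_inverse n _ _ hW hικ _).symm

include hC hC' hZ hW hικ hκι hi in
theorem exact_pair_of_iso :
    Function.Exact ((T.bdry n A).comp (T.map n κ hκ)) (T.map (n + 1) i hi') := by
  subst hC hC' hi
  intro a
  refine (T.exact_pair n A hZ a).trans ⟨?_, ?_⟩
  · rintro ⟨b, rfl⟩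
    obtain ⟨c, rfl⟩ := (T.bijective_of_inverse n ι (GMap.bot_mem κ ⊥) (GMap.bot_mem ι ⊥)
      hZ.sub hW hικ hκι).2 b
    exact ⟨c, rfl⟩
  · rintro ⟨b, rfl⟩
    exact ⟨_, rfl⟩

end Exact

end GCohomologyTheory

/-! ### The comparison maps and their long exact sequences -/

namespace MultiplicativeCohomologyTheory

variable {R : Type w} [CommRing R] (𝓗 : MultiplicativeCohomologyTheory.{u, v, w} R)
variable {G : Type u} [Group G] {X Y L : GSpace G}

/-- The module structure of `𝓗ⁿ_G(X, A)` over `𝓗⁰_G(L)` for a `G`-map `X → L`. -/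
@[reducible] def relModule (hL : ProperGCWPair L ⊥) (f : GMap X L) (A : SubMulAction G X) (n : ℤ) :
    Module (𝓗.Abs 0 L) (𝓗.Rel n X A) where
  smul a x := 𝓗.act n (𝓗.pull 0 f a) x
  one_smul x := by
    change 𝓗.act n (𝓗.pullRingHom f hL 1) x = x
    rw [map_one]
    exact 𝓗.one_act n x
  mul_smul a b x := by
    change 𝓗.act n (𝓗.pullRingHom f hL (a * b)) x = _
    rw [map_mul]
    exact 𝓗.act_act n _ _ x
  smul_zero a := (𝓗.act n (𝓗.pull 0 f a)).map_zero
  smul_add a := (𝓗.act n (𝓗.pull 0 f a)).map_add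
  add_smul a b x := by
    change 𝓗.act n (𝓗.pull 0 f (a + b)) x = _
    rw [map_add]
    exact congrArg (fun f => f x) ((𝓗.act n).map_add _ _)
  zero_smul x := by
    change 𝓗.act n (𝓗.pull 0 f 0) x = 0
    rw [map_zero]
    exact congrArg (fun f => f x) (𝓗.act n).map_zero

/-- The comparison of `𝓗ⁿ_G(X, A)` with the groups `𝓗ⁿ_G(EG_k × (X, A))`. -/
def comparison (E : ClassifyingSpace G) (hL : ProperGCWPair L ⊥) (f : GMap X L)
    {A : SubMulAction G X} (hA : FiniteProperPair X A) (n : ℤ) : Comparison (𝓗.Abs 0 L) where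
  source := 𝓗.Rel n X A
  module := 𝓗.relModule hL f A n
  -- Only `EG` is filtered by skeleta. So every map of pairs over `L`, cellular or not, induces a
  -- levelwise map, and each level has exact sequences and excision in `(X, A)`.
  target k := 𝓗.Rel n ((E.skelSpace k).prod X) (GSpace.prodSub ⊤ A)
  res h := ((𝓗.thy G).map n ((E.skelIncl h).prodMap (GMap.id X))
    (GMap.prodMap_mem _ _ fun _ h => h)).toAddMonoidHom
  res_res _ _ x := (𝓗.thy G).map_map n rfl _ _ _ (hA.skelProd E _) x
  app k := ((𝓗.thy G).map n (GMap.snd (E.skelSpace k) X) (GMap.snd_mem _ _)).toAddMonoidHom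
  res_app _ x := (𝓗.thy G).map_map n rfl _ _ _ (hA.skelProd E _) x

variable {E : ClassifyingSpace G} {hL : ProperGCWPair L ⊥}

/-- The comparisons are natural with respect to maps of pairs over `L`. -/
def comparisonMap {A : SubMulAction G X} {B : SubMulAction G Y} {f : GMap X L} {f' : GMap Y L}
    (hA : FiniteProperPair X A) (hB : FiniteProperPair Y B) (g : GMap X Y)
    (hg : ∀ x ∈ A, g x ∈ B) (hf : f'.comp g = f) (n : ℤ) :
    Comparison.Hom (𝓗.comparison E hL f' hB n) (𝓗.comparison E hL f hA n) where
  src :=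
    { (𝓗.thy G).map n g hg with
      map_smul' := fun a x => by
        subst hf
        refine (𝓗.map_act n g hg hB.proper _ x).trans ?_
        rw [𝓗.pull_comp 0 g f' hB.proper.bot]
        rfl }
  tgt k := ((𝓗.thy G).map n ((GMap.id (E.skelSpace k)).prodMap g)
    (GMap.prodMap_mem _ _ hg)).toAddMonoidHom
  tgt_res h x := ((𝓗.thy G).map_map n rfl _ _ (GMap.prodMap_mem (E.skelIncl h) g hg)
    (hB.skelProd E _) x).trans ((𝓗.thy G).map_map n (f := (E.skelIncl h).prodMap (GMap.id X))
      (g := (GMap.id _).prodMap g) rfl _ _ _ (hA.skelProd E _) x).symm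
  tgt_app k x := ((𝓗.thy G).map_map n (f := (GMap.id (E.skelSpace k)).prodMap g)
    (g := GMap.snd _ Y) rfl _ _ (fun z hz => hg _ (GMap.snd_mem _ _ z hz)) (hB.skelProd E _) x).trans
      ((𝓗.thy G).map_map n (f := GMap.snd (E.skelSpace k) X) (g := g) rfl _ _ _ hA.proper x).symm

/-- The comparisons are compatible with boundary homomorphisms. -/
def comparisonBdry {A : SubMulAction G X} {f : GMap X L} {f' : GMap (GSpace.sub A) L}
    (hA : FiniteProperPair X A) (hA' : FiniteProperPair (GSpace.sub A) ⊥)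
    (hf : f.comp (GMap.incl A) = f') (n : ℤ) :
    Comparison.Hom (𝓗.comparison E hL f' hA' n) (𝓗.comparison E hL f hA (n + 1)) where
  src :=
    { (𝓗.thy G).bdry n A with
      map_smul' := fun a x => by
        subst hf
        refine Eq.trans ?_ (𝓗.bdry_act n (𝓗.pull 0 f a) x)
        rw [𝓗.pull_comp 0 _ _ hA.proper.bot]
        rfl }
  tgt k := (((𝓗.thy G).bdry n (GSpace.prodSub ⊤ A)).comp
    ((𝓗.thy G).map n (GMap.prodSubMap (E.skelSpace k) A) (GMap.bot_mem _ _))).toAddMonoidHom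
  tgt_res {j k} h x := by
    refine Eq.trans ?_ ((𝓗.thy G).bdry_natural n ((E.skelIncl h).prodMap (GMap.id X)) _
      (hA.skelProd E _) (hA.skelProd E _) _)
    refine congrArg ((𝓗.thy G).bdry n (GSpace.prodSub ⊤ A)) ?_
    exact ((𝓗.thy G).map_map n rfl _ _ (GMap.bot_mem _ _) (hA'.skelProd E _) x).trans
      ((𝓗.thy G).map_map n (f := ((E.skelIncl h).prodMap (GMap.id X)).restrict (GSpace.prodSub ⊤ A)
        (GSpace.prodSub ⊤ A) _) (g := GMap.prodSubMap _ A) rfl _ _ _ (hA.skelProd E _).sub x).symm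
  tgt_app k x := by
    refine Eq.trans ?_ ((𝓗.thy G).bdry_natural n (GMap.snd (E.skelSpace k) X) (GMap.snd_mem _ _)
      (hA.skelProd E _) hA.proper _)
    refine congrArg ((𝓗.thy G).bdry n (GSpace.prodSub ⊤ A)) ?_
    exact (𝓗.thy G).map_map n rfl _ _ _ (hA'.skelProd E _) x

section Exact

variable {A : SubMulAction G X} {f : GMap X L} {f' : GMap (GSpace.sub A) L}
    (hA : FiniteProperPair X A) (hX : FiniteProperPair X ⊥)
    (hA' : FiniteProperPair (GSpace.sub A) ⊥)
    (hf : f.comp (GMap.incl A) = f') (n : ℤ)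

theorem comparison_exact_space :
    Comparison.Exact (𝓗.comparisonMap (E := E) (hL := hL) hX hA (GMap.id X) (GMap.bot_mem _ _)
      (f := f) rfl n) (𝓗.comparisonMap hA' hX (GMap.incl A) (GMap.bot_mem _ _) hf n) where
  src := (𝓗.thy G).exact_space n A hA.proper
  tgt k := (𝓗.thy G).exact_space_of_iso n GSpace.prodSub_top_bot GSpace.prodSub_top_bot
    (hA.skelProd E k) (hA'.skelProd E k) (κ := GMap.prodSubMap _ _)
    (ι := GMap.prodSubMapSymm _ _) rfl rfl rfl _ rfl _

theorem comparison_exact_sub :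
    Comparison.Exact (𝓗.comparisonMap (E := E) (hL := hL) hA' hX (GMap.incl A)
      (GMap.bot_mem _ _) hf n) (𝓗.comparisonBdry hA hA' hf n) where
  src := (𝓗.thy G).exact_sub n A hA.proper
  tgt k := (𝓗.thy G).exact_sub_of_iso n GSpace.prodSub_top_bot GSpace.prodSub_top_bot
    (hA.skelProd E k) (hA'.skelProd E k) (κ := GMap.prodSubMap _ _)
    (ι := GMap.prodSubMapSymm _ _) rfl rfl rfl _ _

theorem comparison_exact_pair :
    Comparison.Exact (𝓗.comparisonBdry (E := E) (hL := hL) hA hA' hf n)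
      (𝓗.comparisonMap hX hA (GMap.id X) (GMap.bot_mem _ _) (f := f) rfl (n + 1)) where
  src := (𝓗.thy G).exact_pair n A hA.proper
  tgt k := (𝓗.thy G).exact_pair_of_iso n GSpace.prodSub_top_bot GSpace.prodSub_top_bot
    (hA.skelProd E k) (hA'.skelProd E k) (κ := GMap.prodSubMap _ _)
    (ι := GMap.prodSubMapSymm _ _) rfl rfl rfl _ _

end Exact

/-- `EG_k × X` is free of dimension less than `k + N` if all cells of `X` have dimension less than
`N`. As `L` need not be finite, its augmentation ideal is first pulled back to that of the finite
complex `X`, where nilpotency applies. -/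
theorem comparison_isContinuous {A : SubMulAction G X} (hA : FiniteProperPair X A) (f : GMap X L)
    (n : ℤ) : (𝓗.comparison E hL f hA n).IsContinuous (𝓗.augmentationIdeal L) := by
  intro k
  have hA₀ := hA
  obtain ⟨T, hT, hproper, hTA⟩ := hA₀
  obtain ⟨N, hN⟩ := hT.exists_dim_lt
  refine ⟨k + N, fun x hx => ?_⟩
  have hker : ∀ a ∈ 𝓗.augmentationIdeal L ^ (k + N),
      𝓗.pull 0 (GMap.snd (E.skelSpace k) X) (𝓗.pull 0 f a) = 0 := fun a ha =>
    𝓗.pull_eq_zero_of_mem_pow T hT hproper (k + N)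
      ((E.skelCW k).prod (E.skel_free k) T hT hproper) (GSpace.prod_free (E.skel_free k))
      (fun l c => by
        have h₁ := E.skelCW_dim_le k _ c.1.1.2
        have h₂ := hN _ c.1.2.1.2
        have h₃ := c.2
        omega) _ (𝓗.pull_mem_augmentationIdeal_pow f hL ha)
  induction hx using Submodule.smul_induction_on' with
  | smul a ha x _ =>
    refine (𝓗.map_act n (GMap.snd (E.skelSpace k) X) (GMap.snd_mem _ _) hA.proper _ _).trans ?_
    rw [hker a ha]
    exact 𝓗.act_zero n _
  | add x _ y _ hx hy => rw [map_add, hx, hy, add_zero]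

/-- The comparisons for `(X, A)` are pro-isomorphisms in all degrees. -/
def IsGoodPair (E : ClassifyingSpace G) (hL : ProperGCWPair L ⊥) (f : GMap X L)
    (A : SubMulAction G X) : Prop :=
  ∃ hA : FiniteProperPair X A, ∀ n,
    (𝓗.comparison E hL f hA n).IsGood (𝓗.augmentationIdeal L)

/-- The five lemma in the stretch of the exact sequence of `(X, A)` with the relative group in the
middle. -/
theorem IsGoodPair.pair {A : SubMulAction G X} (hA : FiniteProperPair X A) {f : GMap X L}
    {f' : GMap (GSpace.sub A) L} (hf : f.comp (GMap.incl A) = f')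
    (h₁ : 𝓗.IsGoodPair E hL f ⊥) (h₂ : 𝓗.IsGoodPair E hL f' ⊥) : 𝓗.IsGoodPair E hL f A := by
  obtain ⟨hX, h₁⟩ := h₁
  obtain ⟨hA', h₂⟩ := h₂
  refine ⟨hA, fun m => ?_⟩
  obtain ⟨n, rfl⟩ : ∃ n, m = n + 1 := ⟨m - 1, by ring⟩
  exact Comparison.IsGood.five (𝓗.comparison_exact_sub hA hX hA' hf n)
    (𝓗.comparison_exact_pair hA hX hA' hf n) (𝓗.comparison_exact_space hA hX hA' hf (n + 1))
    (h₁ n) (h₂ n) (𝓗.comparison_isContinuous hA f _) (h₁ _) (h₂ _)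

/-- The same exact sequence, now with the absolute group of `X` in the middle. -/
theorem IsGoodPair.space {A : SubMulAction G X} {f : GMap X L}
    {f' : GMap (GSpace.sub A) L} (hf : f.comp (GMap.incl A) = f')
    (h₁ : 𝓗.IsGoodPair E hL f A) (h₂ : 𝓗.IsGoodPair E hL f' ⊥) : 𝓗.IsGoodPair E hL f ⊥ := by
  obtain ⟨hA, h₁⟩ := h₁
  obtain ⟨hA', h₂⟩ := h₂
  have hX := hA.bot
  refine ⟨hX, fun m => ?_⟩
  obtain ⟨n, rfl⟩ : ∃ n, m = n + 1 := ⟨m - 1, by ring⟩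
  exact Comparison.IsGood.five (𝓗.comparison_exact_pair hA hX hA' hf n)
    (𝓗.comparison_exact_space hA hX hA' hf (n + 1)) (𝓗.comparison_exact_sub hA hX hA' hf (n + 1))
    (h₂ n) (h₁ _) (𝓗.comparison_isContinuous hX f _) (h₂ _) (h₁ _)

/-- Excision gives isomorphisms on the source and, since the pushout persists after taking the
product with `EG_k`, on each target. -/
theorem IsGoodPair.of_pushout {A : SubMulAction G Y} {B : SubMulAction G X} {F : GMap Y X}
    (T : GCWStructure X) (hT : T.IsFinite) (hproper : T.IsProper)
    (hB : T.IsSubcomplex B) (hl : T.LiftsCells B F) (hF : IsGPushout A B F) {f : GMap X L}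
    (h : 𝓗.IsGoodPair E hL (f.comp F) A) : 𝓗.IsGoodPair E hL f B := by
  obtain ⟨hA, h⟩ := h
  have hB' : FiniteProperPair X B := ⟨T, hT, hproper, hB⟩
  refine ⟨hB', fun n => ?_⟩
  refine Comparison.IsGood.of_bijective' (𝓗.comparisonMap hA hB' F
    (fun x hx => (hF.mem_iff x).2 hx) rfl n) ((𝓗.thy G).excision n F hF hA.proper hB'.proper)
    (fun k => ?_) (h n)
  exact (𝓗.thy G).excision n _ (GCWStructure.isGPushout_prod (E.skelCW k) T hT hproper hl hF)
    (hA.skelProd E k) (hB'.skelProd E k)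

theorem IsGoodPair.of_homotopyEquiv (hY : FiniteProperPair Y ⊥) {g : GMap X Y} (g' : GMap Y X)
    (hg : GHomotopic ⊥ ⊥ (g'.comp g) (GMap.id X)) (hg' : GHomotopic ⊥ ⊥ (g.comp g') (GMap.id Y))
    {f : GMap X L} {f' : GMap Y L} (hf : f'.comp g = f)
    (h : 𝓗.IsGoodPair E hL f ⊥) : 𝓗.IsGoodPair E hL f' ⊥ := by
  obtain ⟨hX, h⟩ := h
  have h₁ : ∀ k, GHomotopic (GSpace.prodSub ⊤ ⊥) (GSpace.prodSub ⊤ ⊥)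
      (((GMap.id (E.skelSpace k)).prodMap g').comp ((GMap.id (E.skelSpace k)).prodMap g))
      (GMap.id _) := fun k => hg.prodMap
  have h₂ : ∀ k, GHomotopic (GSpace.prodSub ⊤ ⊥) (GSpace.prodSub ⊤ ⊥)
      (((GMap.id (E.skelSpace k)).prodMap g).comp ((GMap.id (E.skelSpace k)).prodMap g'))
      (GMap.id _) := fun k => hg'.prodMap
  refine ⟨hY, fun n => ?_⟩
  refine Comparison.IsGood.of_bijective' (𝓗.comparisonMap hX hY g (GMap.bot_mem _ _) hf n)
    ((𝓗.thy G).bijective_of_homotopyEquiv n g g' _ (GMap.bot_mem _ _) hX.proper hY.proper hg hg')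
    (fun k => ?_) (h n)
  exact (𝓗.thy G).bijective_of_homotopyEquiv n _ ((GMap.id _).prodMap g') _
    (GMap.prodMap_mem _ _ (GMap.bot_mem _ _)) (hX.skelProd E k) (hY.skelProd E k) (h₁ k) (h₂ k)

end MultiplicativeCohomologyTheory

/-! ### The completion map in terms of the skeleta of `EG × X` -/

section Skeleta

variable {G : Type u} [Group G] (E : ClassifyingSpace G) {X : GSpace G} {S : GCWStructure X}

theorem properGCWPair_prodSkel (hfinite : S.IsFinite) (hproper : S.IsProper) (k : ℕ) :
    ProperGCWPair (E.space.prod X) (prodSkel E.cw S k) :=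
  (E.cw.prod E.free S hfinite hproper).properGCWPair (E.cw.isProper_prod E.free S hfinite hproper)
    (E.cw.isSubcomplex_prodSkel E.free S hfinite hproper k)

theorem prodSkel_mono (S : GCWStructure X) : Monotone (prodSkel E.cw S) :=
  monotone_nat_of_le_succ (prodSkel_succ_le E.cw S)

/-- The projection from the skeleton of `EG × X` to `X`. -/
def skelProj (S : GCWStructure X) (k : ℕ) : GMap (GSpace.sub (prodSkel E.cw S k)) X :=
  (GMap.snd E.space X).comp (GMap.incl _)

end Skeleta

namespace MultiplicativeCohomologyTheory

variable {R : Type w} [CommRing R] (𝓗 : MultiplicativeCohomologyTheory.{u, v, w} R)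
variable {G : Type u} [Group G] (E : ClassifyingSpace G) {X L : GSpace G} {S : GCWStructure X}
  (hfinite : S.IsFinite) (hproper : S.IsProper)

/-- The map `𝓗ᵐ((EG ×_G X)_k) → 𝓗ᵐ_G((EG × X)_k)`. -/
def borelMap (S : GCWStructure X) (m : ℤ) (k : ℕ) :
    𝓗.Abs m (GSpace.sub (borelSkel E S k)) →ₗ[𝓗.Coeff]
      𝓗.Abs m (GSpace.sub (prodSkel E.cw S k)) where
  toFun y := 𝓗.indAbs 1 m _ (𝓗.pull m (Ind.subMap 1 (prodSkel E.cw S k)) y)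
  map_add' y z := (congrArg (𝓗.indAbs 1 m _) (map_add _ y z)).trans (map_add _ _ _)
  map_smul' c y := (congrArg (𝓗.indAbs 1 m _) (𝓗.pull_coeff_smul m _ c y)).trans
    (𝓗.indAbs_coeff_smul _ m _ c _)

-- Induction along `G → 1` is bijective because `G` acts freely on the skeleton; the other factor
-- comes from the homeomorphism of the quotient of the skeleton with the skeleton of the quotient.
include hfinite hproper in
theorem borelMap_bijective (m : ℤ) (k : ℕ) : Function.Bijective (𝓗.borelMap E S m k) := by
  have hp := properGCWPair_prodSkel E hfinite hproper k
  refine (𝓗.indAbs_bijective _ m hp.sub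
    fun g _ x hx => GSpace.sub_free (GSpace.prod_free E.free) _ g x hx).comp ?_
  exact (𝓗.thy _).excision m _ (isGPushout_subMap _ _ _) (hp.sub.ind_bot _) (hp.ind _).sub

include hfinite hproper in
theorem borelMap_pull (m : ℤ) {j k : ℕ} (h : j ≤ k) (h' : borelSkel E S j ≤ borelSkel E S k)
    (y : 𝓗.Abs m (GSpace.sub (borelSkel E S k))) :
    𝓗.borelMap E S m j (𝓗.pull m (GMap.inclusion h') y) =
      𝓗.pull m (GMap.inclusion (prodSkel_mono E S h)) (𝓗.borelMap E S m k y) := by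
  have hp := fun k => properGCWPair_prodSkel E hfinite hproper k
  refine Eq.trans ?_ (𝓗.indAbs_pull _ m _ (hp k).sub _)
  refine congrArg (𝓗.indAbs 1 m _) ?_
  refine ((𝓗.thy _).map_map m rfl _ _ (GMap.bot_mem _ _) ((hp j).ind _).sub y).trans
    ((𝓗.thy _).map_map m ?_ _ _ _ ((hp k).sub.ind_bot _) y).symm
  exact Ind.hom_ext _ fun x => rfl

include hfinite hproper in
theorem borelMap_pull_incl (m : ℤ) (k : ℕ) (y : 𝓗.Abs m (borelConstruction E X)) :
    𝓗.borelMap E S m k (𝓗.pull m (GMap.incl (borelSkel E S k)) y) =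
      𝓗.pull m (GMap.incl (prodSkel E.cw S k)) (𝓗.indAbs 1 m (E.space.prod X) y) := by
  have hp := properGCWPair_prodSkel E hfinite hproper k
  refine Eq.trans ?_ (𝓗.indAbs_pull _ m _ hp.bot _)
  refine congrArg (𝓗.indAbs 1 m _) ?_
  refine ((𝓗.thy _).map_map m rfl _ _ (GMap.bot_mem _ _) (hp.ind _).sub y).trans
    (congrArg (fun g => 𝓗.pull m g y) (Ind.hom_ext _ fun x => rfl))

-- This makes the completion map well defined: the `k`-skeleton of `EG × X` is free of dimension
-- less than `k + 1`, so the power `k + 1` of the augmentation ideal acts on its cohomology by zero.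
include hfinite hproper in
theorem powSubmodule_le_ker (hL : ProperGCWPair L ⊥) (f : GMap X L) (m : ℤ) (k : ℕ) :
    𝓗.powSubmodule f m (k + 1) ≤ LinearMap.ker (𝓗.pullCoeff m (skelProj E S k)) := by
  refine Submodule.span_le.2 ?_
  rintro y ⟨a, ha, x, rfl⟩
  have hX := S.properGCWPair_bot hproper
  have hs := E.cw.isSubcomplex_prodSkel E.free S hfinite hproper k
  have h : 𝓗.pull 0 (skelProj E S k) (𝓗.pull 0 f a) = 0 := by
    refine 𝓗.pull_eq_zero_of_mem_pow S hfinite hproper (k + 1)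
      ((E.cw.prod E.free S hfinite hproper).restrict hs)
      (GSpace.sub_free (GSpace.prod_free E.free) _) (fun n c => ?_) _
      (𝓗.pull_mem_augmentationIdeal_pow f hL ha)
    have hc : (E.cw.prod E.free S hfinite hproper).char c.1 ⟨0, by simp⟩ ∈ prodSkel E.cw S k :=
      c.2 ⟨0, by simp⟩
    exact Nat.lt_succ_iff.2 (GCWStructure.dim_le_of_mem_skel _ (by simp)
      ((E.cw.prodSkel_eq_skel E.free S hfinite hproper k).le hc))
  refine (𝓗.map_act m _ _ hX _ _).trans ?_
  rw [h]
  exact 𝓗.act_zero m _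

/-- `borelMap` as an isomorphism. -/
noncomputable def borelEquiv (m : ℤ) (k : ℕ) :
    𝓗.Abs m (GSpace.sub (borelSkel E S k)) ≃ₗ[𝓗.Coeff]
      𝓗.Abs m (GSpace.sub (prodSkel E.cw S k)) :=
  LinearEquiv.ofBijective (𝓗.borelMap E S m k) (𝓗.borelMap_bijective E hfinite hproper m k)

/-- The components of the completion map. -/
noncomputable def completionApp (hL : ProperGCWPair L ⊥) (f : GMap X L) (m : ℤ) (k : ℕ) :
    (𝓗.Abs m X ⧸ 𝓗.powSubmodule f m (k + 1)) →ₗ[𝓗.Coeff]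
      𝓗.Abs m (GSpace.sub (borelSkel E S k)) :=
  (𝓗.powSubmodule f m (k + 1)).liftQ
    ((𝓗.borelEquiv E hfinite hproper m k).symm.toLinearMap.comp
      (𝓗.pullCoeff m (skelProj E S k))) fun x hx => by
    rw [LinearMap.mem_ker, LinearMap.comp_apply,
      LinearMap.mem_ker.1 (𝓗.powSubmodule_le_ker E hfinite hproper hL f m k hx), map_zero]

/-- The completion map. -/
noncomputable def completionMap (hL : ProperGCWPair L ⊥) (f : GMap X L) (m : ℤ) :
    StrictProHom (completionSource 𝓗 f m) (completionTarget 𝓗 E S m) where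
  app := 𝓗.completionApp E hfinite hproper hL f m
  comm k x := by
    obtain ⟨x, rfl⟩ := Submodule.Quotient.mk_surjective _ x
    refine (LinearEquiv.eq_symm_apply (𝓗.borelEquiv E hfinite hproper m k)).2 ?_
    refine (𝓗.borelMap_pull E hfinite hproper m k.le_succ _ _).trans ?_
    refine (congrArg _ ((𝓗.borelEquiv E hfinite hproper m (k + 1)).apply_symm_apply _)).trans ?_
    exact 𝓗.pull_comp m _ _ (properGCWPair_prodSkel E hfinite hproper (k + 1)).sub _

theorem borelMap_completionMap (hL : ProperGCWPair L ⊥) (f : GMap X L) (m : ℤ) (k : ℕ)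
    (x : 𝓗.Abs m X) :
    𝓗.borelMap E S m k ((𝓗.completionMap E hfinite hproper hL f m).app k
      (Submodule.Quotient.mk x)) = 𝓗.pull m (skelProj E S k) x :=
  (𝓗.borelEquiv E hfinite hproper m k).apply_symm_apply _

theorem isCompletionMap_completionMap (hL : ProperGCWPair L ⊥) (f : GMap X L) (m : ℤ) :
    IsCompletionMap 𝓗 E S f m (𝓗.completionMap E hfinite hproper hL f m) := by
  intro k x y hy
  refine (𝓗.borelMap_bijective E hfinite hproper m k).1 ?_
  rw [𝓗.borelMap_completionMap, 𝓗.borelMap_pull_incl E hfinite hproper, hy]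
  exact (𝓗.pull_comp m _ _ (properGCWPair_prodSkel E hfinite hproper k).bot x).symm

theorem completionSource_trans_mk (f : GMap X L) (m : ℤ) (k d : ℕ) (x : 𝓗.Abs m X) :
    (completionSource 𝓗 f m).trans k d
      (Submodule.Quotient.mk (p := 𝓗.powSubmodule f m (k + d + 1)) x) =
        Submodule.Quotient.mk (p := 𝓗.powSubmodule f m (k + 1)) x := by
  induction d with
  | zero => rfl
  | succ d ih => exact ih

include hfinite hproper in
theorem borelMap_trans (m : ℤ) (k d : ℕ) (y : (completionTarget 𝓗 E S m).obj (k + d)) :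
    𝓗.borelMap E S m k ((completionTarget 𝓗 E S m).trans k d y) =
      𝓗.pull m (GMap.inclusion (prodSkel_mono E S (Nat.le_add_right k d)))
        (𝓗.borelMap E S m (k + d) y) := by
  induction d with
  | zero => exact (𝓗.pull_id m _).symm
  | succ d ih =>
    refine (ih _).trans ?_
    refine (congrArg _ (𝓗.borelMap_pull E hfinite hproper m (k + d).le_succ _ y)).trans ?_
    exact 𝓗.pull_comp m _ _ (properGCWPair_prodSkel E hfinite hproper (k + d)).sub _

/-- The isomorphisms `borelMap` remove the Borel construction, leaving only restrictions to the
skeleta of `EG × X`. The exponent is `k + 1` because `obj k` is the member with number `k + 1`. -/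
theorem completionMap_isProIso_iff (hL : ProperGCWPair L ⊥) (f : GMap X L) (m : ℤ) :
    (𝓗.completionMap E hfinite hproper hL f m).IsProIso ↔
      (∀ k, ∃ d, ∀ x, 𝓗.pull m (skelProj E S (k + d)) x = 0 → x ∈ 𝓗.powSubmodule f m (k + 1)) ∧
      ∀ k, ∃ d, ∀ y, ∃ x, 𝓗.pull m (skelProj E S k) x =
        𝓗.pull m (GMap.inclusion (prodSkel_mono E S (Nat.le_add_right k d))) y := by
  refine and_congr (forall_congr' fun k => exists_congr fun d => ?_)
    (forall_congr' fun k => exists_congr fun d => ?_)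
  · constructor
    · intro h x hx
      have := h (Submodule.Quotient.mk x) ((𝓗.borelMap_bijective E hfinite hproper m _).1 ((𝓗.borelMap_completionMap E hfinite hproper hL f m _ x).trans
          (hx.trans (map_zero (𝓗.borelMap E S m (k + d))).symm)))
      rw [𝓗.completionSource_trans_mk] at this
      exact (Submodule.Quotient.mk_eq_zero _).1 this
    · intro h x hx
      obtain ⟨x, rfl⟩ := Submodule.Quotient.mk_surjective _ x
      refine (𝓗.completionSource_trans_mk f m k d x).trans
        ((Submodule.Quotient.mk_eq_zero _).2 (h x ?_))
      rw [← 𝓗.borelMap_completionMap E hfinite hproper hL f, hx]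
      exact map_zero (𝓗.borelMap E S m (k + d))
  · constructor
    · intro h y
      obtain ⟨z, rfl⟩ := (𝓗.borelMap_bijective E hfinite hproper m _).2 y
      obtain ⟨x, hx⟩ := h z
      obtain ⟨x, rfl⟩ := Submodule.Quotient.mk_surjective _ x
      refine ⟨x, ?_⟩
      rw [← 𝓗.borelMap_completionMap E hfinite hproper hL f, hx]
      exact 𝓗.borelMap_trans E hfinite hproper m k d z
    · intro h y
      obtain ⟨x, hx⟩ := h (𝓗.borelMap E S m _ y)
      refine ⟨Submodule.Quotient.mk x, (𝓗.borelMap_bijective E hfinite hproper m _).1 ?_⟩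
      rw [𝓗.borelMap_completionMap, hx]
      exact (𝓗.borelMap_trans E hfinite hproper m k d y).symm

end MultiplicativeCohomologyTheory

/-! ### Orbits -/

section Orbit

variable {G : Type u} [Group G] (E : ClassifyingSpace G) (H : Subgroup G)

instance : DiscreteTopology (Ind H.subtype (GSpace.pt : GSpace H)) :=
  discreteTopology_iff_forall_isClosed.2 fun Z =>
    (isClosed_ind_iff H.subtype GSpace.pt Z).2 fun _ =>
      isClosed_discrete (α := PUnit.{u + 1}) _

theorem isFinite_point : (GCWStructure.point : GCWStructure (GSpace.pt : GSpace G)).IsFinite := by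
  refine Finite.of_injective (β := Unit) (fun _ => ()) ?_
  rintro ⟨n, ⟨⟩, hn⟩ ⟨m, ⟨⟩, hm⟩ -
  subst hn hm
  rfl

theorem isProper_point [Finite G] :
    (GCWStructure.point : GCWStructure (GSpace.pt : GSpace G)).IsProper := fun _ _ =>
  Subtype.finite

theorem finiteProperPair_orbit [Finite H] :
    FiniteProperPair (Ind H.subtype (GSpace.pt : GSpace H)) ⊥ :=
  ⟨GCWStructure.point.ind H.subtype, isFinite_point (G := H), fun _ _ =>
    Set.Finite.image H.subtype (Set.toFinite _), GCWStructure.isSubcomplex_bot _⟩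

theorem orbit_mk_eq (g : G) (h : H) (x y : (GSpace.pt : GSpace H)) :
    Ind.mk H.subtype (g * h) x = Ind.mk H.subtype g y :=
  indMk_mul H.subtype GSpace.pt g h x

/-- The `k`-skeleton of `EG × pt` as a complex over the subgroup `H`. -/
noncomputable abbrev orbitSkel (k : ℕ) : SubMulAction H ((E.res H).space.prod GSpace.pt) :=
  prodSkel (E.res H).cw GCWStructure.point k

theorem mem_orbitSkel (k : ℕ) (y : E.space) (p : (GSpace.pt : GSpace H)) :
    ((y, p) : (E.res H).space × (GSpace.pt : GSpace H)) ∈ orbitSkel E H k ↔ y ∈ E.cw.skel k := by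
  constructor
  · rintro ⟨p, q, hpq, hp, -⟩
    exact E.cw.skel_mono (by omega) ((E.cw.mem_skel_res E.free H p y).1 hp)
  · intro h
    exact ⟨k, 0, rfl, (E.cw.mem_skel_res E.free H k y).2 h, 0, le_rfl, ⟨PUnit.unit, rfl⟩, 1,
      ⟨0, by simp⟩, rfl⟩

/-- The homeomorphism `ind_H (EG_k) → EG_k × G/H`. -/
noncomputable def orbitSkelMap (k : ℕ) :
    GMap (Ind H.subtype (GSpace.sub (orbitSkel E H k)))
      ((E.skelSpace k).prod (Ind H.subtype GSpace.pt)) :=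
  Ind.desc H.subtype
    (fun z => (⟨z.1.1, (mem_orbitSkel E H k z.1.1 z.1.2).1 z.2⟩, Ind.mk H.subtype 1 PUnit.unit))
    (by
      have h : Continuous fun z : GSpace.sub (orbitSkel E H k) =>
        (z.1 : E.space × PUnit.{u + 1}) := continuous_subtype_val
      exact ((continuous_fst.comp h).subtype_mk _).prodMk continuous_const)
    fun h z => Prod.ext rfl (by
      have := orbit_mk_eq H 1 h PUnit.unit PUnit.unit
      rw [one_mul] at this
      change _ = Ind.mk H.subtype (h * 1) _
      rw [mul_one]
      exact this.symm)

/-- Untwisting: `[(g, y)] ↦ (g y, gH)` is a homeomorphism. Since `G/H` is discrete, continuity of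
the inverse is checked on the slices over each coset, where `ρ g` provides it. -/
theorem isGPushout_orbitSkelMap (k : ℕ) :
    IsGPushout ⊥ (GSpace.prodSub ⊤ ⊥) (orbitSkelMap E H k) := by
  let ρ : ∀ g : G, E.skelSpace k → GSpace.sub (orbitSkel E H k) := fun g y =>
    ⟨(g⁻¹ • y.1, PUnit.unit),
      (mem_orbitSkel E H k _ _).2 ((E.cw.skel k).smul_mem g⁻¹ y.2)⟩
  have hρ : ∀ g, Continuous (ρ g) := fun g => by
    have h : Continuous fun y : E.skelSpace k => (g⁻¹ • y.1 : E.space) :=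
      (E.space.cont.continuous_const_smul g⁻¹).comp continuous_subtype_val
    exact (h.prodMk continuous_const).subtype_mk _
  have key : ∀ (g : G) (y : E.skelSpace k), orbitSkelMap E H k (Ind.mk H.subtype g (ρ g y)) =
      (y, Ind.mk H.subtype g PUnit.unit) := fun g y => Prod.ext
    (Subtype.ext (smul_inv_smul g y.1)) (congrArg
      (fun a => Ind.mk (X := GSpace.pt) H.subtype a PUnit.unit) (mul_one g))
  refine ⟨fun y => ⟨fun h => absurd h.2 (by exact fun h => h),
    fun h => absurd h (by exact fun h => h)⟩, fun y y' _ h => ?_, fun z _ => ?_, fun Z hZ _ => ?_⟩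
  · obtain ⟨g, x, rfl⟩ := indMk_surj _ _ y
    obtain ⟨g', x', rfl⟩ := indMk_surj _ _ y'
    let π : GSpace.sub (orbitSkel E H k) → E.space := fun z => z.1.1
    have h₁ : g • π x = g' • π x' := congrArg (fun z => z.1.1) h
    have h₂ : Ind.mk (X := GSpace.pt) H.subtype (g * 1) PUnit.unit =
      Ind.mk (X := GSpace.pt) H.subtype (g' * 1) PUnit.unit := congrArg Prod.snd h
    rw [mul_one, mul_one] at h₂
    obtain ⟨a, ha, -⟩ := (indMk_eq_iff _ _ _ _ _ _).1 h₂
    refine (indMk_eq_iff _ _ _ _ _ _).2 ⟨a, ha, Subtype.ext (Prod.ext ?_ rfl)⟩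
    change π x' = (a : G)⁻¹ • π x
    rw [eq_inv_smul_iff]
    refine MulAction.injective g ?_
    change g • (a : G) • π x' = g • π x
    rw [← mul_smul, h₁, ha]
    rfl
  · obtain ⟨y, o⟩ : E.skelSpace k × Ind H.subtype GSpace.pt := z
    obtain ⟨g, p, rfl⟩ := indMk_surj _ _ o
    exact ⟨_, key g y⟩
  · refine isOpen_compl_iff.1 ?_
    have : Continuous fun z : E.skelSpace k × Ind H.subtype (GSpace.pt : GSpace H) => z ∈ Zᶜ := by
      refine continuous_prod_of_discrete_right.2 fun o => ?_
      obtain ⟨g, p, rfl⟩ := indMk_surj _ _ o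
      refine continuous_Prop.2 ?_
      have := (hZ.preimage ((continuous_indMk _ _ g).comp (hρ g))).isOpen_compl
      convert this using 1
      ext y
      exact not_congr (Iff.of_eq (congrArg (· ∈ Z) (key g y).symm))
    exact continuous_Prop.1 this

end Orbit

/-! ### The case of an orbit `G/H` -/

namespace MultiplicativeCohomologyTheory

variable {R : Type w} [CommRing R] (𝓗 : MultiplicativeCohomologyTheory.{u, v, w} R)
variable {G : Type u} [Group G] (E : ClassifyingSpace G) {L : GSpace G} (H : Subgroup G) [Finite H]

/-- The isomorphism `𝓗ᵐ_G(EG_k × G/H) → 𝓗ᵐ_H(EG_k)`. -/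
noncomputable def orbitSkelHom (m : ℤ) (k : ℕ) :
    𝓗.Rel m ((E.skelSpace k).prod (Ind H.subtype GSpace.pt)) (GSpace.prodSub ⊤ ⊥) →ₗ[R]
      𝓗.Abs m (GSpace.sub (orbitSkel E H k)) :=
  (𝓗.indAbs H.subtype m _).comp ((𝓗.thy G).map m (orbitSkelMap E H k) (GMap.bot_mem _ _))

theorem properGCWPair_orbitSkel (k : ℕ) :
    ProperGCWPair (GSpace.sub (orbitSkel E H k)) ⊥ :=
  (properGCWPair_prodSkel (E.res H) isFinite_point isProper_point k).sub

theorem orbitSkelHom_bijective (m : ℤ) (k : ℕ) :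
    Function.Bijective (𝓗.orbitSkelHom E H m k) := by
  have hp := properGCWPair_orbitSkel E H k
  refine (𝓗.indAbs_bijective H.subtype m hp fun h hh x _ => ?_).comp
    ((𝓗.thy G).excision m _ (isGPushout_orbitSkelMap E H k) (hp.ind_bot _)
      ((finiteProperPair_orbit H).skelProd E k))
  exact Subtype.ext hh

theorem orbitSkelHom_res (m : ℤ) {j k : ℕ} (h : j ≤ k)
    (y : 𝓗.Rel m ((E.skelSpace k).prod (Ind H.subtype GSpace.pt)) (GSpace.prodSub ⊤ ⊥)) :
    𝓗.orbitSkelHom E H m j ((𝓗.thy G).map m ((E.skelIncl h).prodMap (GMap.id _))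
      (GMap.prodMap_mem _ _ fun _ h => h) y) =
      𝓗.pull m (GMap.inclusion (prodSkel_mono (E.res H) GCWStructure.point h))
        (𝓗.orbitSkelHom E H m k y) := by
  refine Eq.trans ?_ (𝓗.indAbs_pull H.subtype m _ (properGCWPair_orbitSkel E H k) _)
  refine congrArg (𝓗.indAbs H.subtype m _) ?_
  refine ((𝓗.thy G).map_map m rfl _ _ (GMap.bot_mem _ _)
    ((finiteProperPair_orbit H).skelProd E j) y).trans
    ((𝓗.thy G).map_map m ?_ _ _ _ ((properGCWPair_orbitSkel E H k).ind_bot _) y).symm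
  exact Ind.hom_ext _ fun x => congrArg (orbitSkelMap E H k) (one_smul G (Ind.mk H.subtype 1
    (GMap.inclusion (prodSkel_mono (E.res H) GCWStructure.point h) x)))

theorem orbitSkelHom_snd (m : ℤ) (k : ℕ) (x : 𝓗.Abs m (Ind H.subtype GSpace.pt)) :
    𝓗.orbitSkelHom E H m k ((𝓗.thy G).map m (GMap.snd _ _) (GMap.snd_mem _ _) x) =
      𝓗.pull m (skelProj (E.res H) GCWStructure.point k) (𝓗.indAbs H.subtype m GSpace.pt x) := by
  refine Eq.trans ?_ (𝓗.indAbs_pull H.subtype m _ ProperGCWPair.point _)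
  refine congrArg (𝓗.indAbs H.subtype m _) ?_
  refine (𝓗.thy G).map_map m ?_ _ _ _ ((finiteProperPair_orbit H).skelProd E k) x
  exact Ind.hom_ext _ fun x => rfl


variable (hL : ProperGCWPair L ⊥) (f : GMap (Ind H.subtype (GSpace.pt : GSpace H)) L)

/-- The homomorphism of rings `𝓗⁰_G(L) → 𝓗⁰_G(G/H) → 𝓗⁰_H(pt)`. -/
def orbitRingHom : 𝓗.Abs 0 L →+* 𝓗.Abs 0 (GSpace.pt : GSpace H) :=
  (𝓗.indRingHom H.subtype GSpace.pt).comp (𝓗.pullRingHom f hL)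

theorem indAbs_orbit_bijective (m : ℤ) :
    Function.Bijective (𝓗.indAbs H.subtype m (GSpace.pt : GSpace H)) :=
  𝓗.indAbs_bijective H.subtype m ProperGCWPair.point fun _ hh _ _ => Subtype.ext hh

/-- Generators of the extended ideal act through `𝓗⁰_G(L)`, while coefficients from `𝓗⁰_H(*)` are
moved onto `y`. So the extended ideal acts no more widely than `𝔟`, although `𝓗⁰_G(L) → 𝓗⁰_H(*)`
need not be surjective. -/
theorem exists_indAbs_eq_act (m : ℤ) (𝔟 : Ideal (𝓗.Abs 0 L))
    {a : 𝓗.Abs 0 (GSpace.pt : GSpace H)} (ha : a ∈ 𝔟.map (𝓗.orbitRingHom H hL f))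
    (y : 𝓗.Abs m (GSpace.pt : GSpace H)) :
    letI := 𝓗.relModule hL f ⊥ m
    ∃ x ∈ 𝔟 • (⊤ : Submodule (𝓗.Abs 0 L) (𝓗.Rel m (Ind H.subtype GSpace.pt) ⊥)),
      𝓗.indAbs H.subtype m GSpace.pt x = 𝓗.act m a y := by
  let _ := 𝓗.relModule hL f ⊥ m
  induction ha using Submodule.span_induction generalizing y with
  | mem a ha =>
    obtain ⟨b, hb, rfl⟩ := ha
    obtain ⟨x, rfl⟩ := (𝓗.indAbs_orbit_bijective H m).2 y
    exact ⟨b • x, Submodule.smul_mem_smul hb Submodule.mem_top, 𝓗.indAbs_act _ m _ _⟩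
  | zero => exact ⟨0, zero_mem _, by rw [map_zero, 𝓗.act_zero]⟩
  | add a b _ _ ha hb =>
    obtain ⟨x, hx, hx'⟩ := ha y
    obtain ⟨z, hz, hz'⟩ := hb y
    refine ⟨x + z, add_mem hx hz, ?_⟩
    rw [map_add, map_add, hx', hz']
    rfl
  | smul r a _ ha =>
    obtain ⟨x, hx, hx'⟩ := ha (𝓗.act m r y)
    refine ⟨x, hx, hx'.trans ?_⟩
    rw [← 𝓗.act_act, ← mul_def, mul_comm]
    rfl

/-- The coefficient ring acts through `𝓗⁰_G(L)`, so every submodule over the latter is one over the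
coefficients. -/
theorem isNoetherian_orbit (m : ℤ)
    (h : IsNoetherian 𝓗.Coeff (𝓗.Abs m (GSpace.pt : GSpace H))) :
    letI := 𝓗.relModule hL f ⊥ m
    IsNoetherian (𝓗.Abs 0 L) (𝓗.Rel m (Ind H.subtype GSpace.pt) ⊥) := by
  let _ := 𝓗.relModule hL f ⊥ m
  let ε : 𝓗.Abs m (Ind H.subtype GSpace.pt) →ₗ[𝓗.Coeff] 𝓗.Abs m (GSpace.pt : GSpace H) :=
    { 𝓗.indAbs H.subtype m GSpace.pt with
      map_smul' := 𝓗.indAbs_coeff_smul H.subtype m GSpace.pt }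
  have hN : IsNoetherian 𝓗.Coeff (𝓗.Abs m (Ind H.subtype (GSpace.pt : GSpace H))) :=
    isNoetherian_of_injective ε (𝓗.indAbs_orbit_bijective H m).1
  have : IsScalarTower 𝓗.Coeff (𝓗.Abs 0 L) (𝓗.Abs m (Ind H.subtype (GSpace.pt : GSpace H))) := by
    refine ⟨fun c a x => ?_⟩
    change 𝓗.act m (𝓗.pull 0 f (c • a)) x = c • 𝓗.act m (𝓗.pull 0 f a) x
    rw [𝓗.pull_coeff_smul, coeff_smul_def, coeff_smul_def, act_act]
  exact isNoetherian_of_tower 𝓗.Coeff hN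

theorem isNoetherianRing_abs {X : GSpace G} (h : IsNoetherian 𝓗.Coeff (𝓗.Abs 0 X)) :
    IsNoetherianRing (𝓗.Abs 0 X) := by
  have : IsScalarTower 𝓗.Coeff (𝓗.Abs 0 X) (𝓗.Abs 0 X) := by
    refine ⟨fun c a x => ?_⟩
    change 𝓗.act 0 (c • a) x = c • 𝓗.act 0 a x
    rw [coeff_smul_def, coeff_smul_def, act_act]
  exact isNoetherianRing_iff.2 (isNoetherian_of_tower 𝓗.Coeff h)

-- The condition on primes says that `𝕀(H)` lies in every prime containing the extended ideal, that
-- is, in its radical; being finitely generated, it has a power in the ideal itself.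
omit [Finite H] in
theorem exists_pow_augmentationIdeal_le
    (hN : IsNoetherianRing (𝓗.Abs 0 (GSpace.pt : GSpace H)))
    (ideals : ∀ P : Ideal (𝓗.Abs 0 (GSpace.pt : GSpace H)), P.IsPrime →
      (∀ a ∈ 𝓗.augmentationIdeal L, 𝓗.indAbs H.subtype 0 GSpace.pt (𝓗.pull 0 f a) ∈ P) →
      𝓗.augmentationIdeal (GSpace.pt : GSpace H) ≤ P) :
    ∃ N, 𝓗.augmentationIdeal (GSpace.pt : GSpace H) ^ N ≤
      (𝓗.augmentationIdeal L).map (𝓗.orbitRingHom H hL f) := by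
  refine Ideal.exists_pow_le_of_le_radical_of_fg ?_ (IsNoetherian.noetherian _)
  rw [Ideal.radical_eq_sInf]
  refine le_sInf ?_
  rintro P ⟨hP, hprime⟩
  exact ideals P hprime fun a ha => hP (Ideal.mem_map_of_mem (𝓗.orbitRingHom H hL f) ha)

/-- The comparison for an orbit with finite isotropy. -/
theorem isGoodPair_orbit (noetherian : IsNoetherianRing 𝓗.Coeff)
    (finite : ∀ m : ℤ, Module.Finite 𝓗.Coeff (𝓗.Abs m (GSpace.pt : GSpace H)))
    (ideals : ∀ P : Ideal (𝓗.Abs 0 (GSpace.pt : GSpace H)), P.IsPrime →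
      (∀ a ∈ 𝓗.augmentationIdeal L, 𝓗.indAbs H.subtype 0 GSpace.pt (𝓗.pull 0 f a) ∈ P) →
      𝓗.augmentationIdeal (GSpace.pt : GSpace H) ≤ P)
    (completion : ∀ (m : ℤ)
      (l : StrictProHom (completionSource 𝓗 (GMap.id (GSpace.pt : GSpace H)) m)
        (completionTarget 𝓗 (E.res H) GCWStructure.point m)),
      IsCompletionMap 𝓗 (E.res H) GCWStructure.point (GMap.id GSpace.pt) m l → l.IsProIso) :
    𝓗.IsGoodPair E hL f ⊥ := by
  have hO := finiteProperPair_orbit H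
  have hnoeth : ∀ m, IsNoetherian 𝓗.Coeff (𝓗.Abs m (GSpace.pt : GSpace H)) := fun m =>
    have := finite m
    isNoetherian_of_isNoetherianRing_of_finite _ _
  obtain ⟨N, hN⟩ := 𝓗.exists_pow_augmentationIdeal_le H hL f (𝓗.isNoetherianRing_abs (hnoeth 0))
    ideals
  refine ⟨hO, fun m => ?_⟩
  have hiso := completion m _ (𝓗.isCompletionMap_completionMap (E.res H) isFinite_point
    isProper_point ProperGCWPair.point (GMap.id (GSpace.pt : GSpace H)) m)
  rw [𝓗.completionMap_isProIso_iff] at hiso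
  refine ⟨𝓗.isNoetherian_orbit H hL f m (hnoeth m), 𝓗.comparison_isContinuous hO f m,
    fun j => ?_, fun k => ?_⟩
  -- The `N`-th power of `𝕀(H)` lies in the extension of `𝕀_G(L)`, so the power `N * j` lies in the
  -- `j`-th power of the extension. The index shift of pro-modules yields the exponent `N * j + 1`,
  -- which is more than enough.
  · obtain ⟨d, hd⟩ := hiso.1 (N * j)
    refine ⟨N * j + d, fun x hx => ?_⟩
    let _ := 𝓗.relModule hL f ⊥ m
    have h₁ : 𝓗.pull m (skelProj (E.res H) GCWStructure.point (N * j + d))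
        (𝓗.indAbs H.subtype m GSpace.pt x) = 0 := by
      refine (𝓗.orbitSkelHom_snd E H m _ x).symm.trans ?_
      exact (congrArg (𝓗.orbitSkelHom E H m _) hx).trans (map_zero _)
    have key : ∀ y ∈ 𝓗.powSubmodule (GMap.id (GSpace.pt : GSpace H)) m (N * j + 1),
        ∃ x ∈ 𝓗.augmentationIdeal L ^ j •
          (⊤ : Submodule (𝓗.Abs 0 L) (𝓗.Rel m (Ind H.subtype GSpace.pt) ⊥)),
          𝓗.indAbs H.subtype m GSpace.pt x = y := by
      intro y hy
      induction hy using Submodule.span_induction with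
      | mem y hy =>
        obtain ⟨a, ha, x, rfl⟩ := hy
        rw [𝓗.pull_id]
        refine 𝓗.exists_indAbs_eq_act H hL f m _ ?_ x
        rw [Ideal.map_pow]
        refine Ideal.pow_right_mono hN j ?_
        rw [← pow_mul]
        exact Ideal.pow_le_pow_right (Nat.le_succ _) ha
      | zero => exact ⟨0, zero_mem _, map_zero _⟩
      | add y z _ _ hy hz =>
        obtain ⟨x, hx, rfl⟩ := hy
        obtain ⟨x', hx', rfl⟩ := hz
        exact ⟨x + x', add_mem hx hx', map_add _ _ _⟩
      | smul c y _ hy =>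
        obtain ⟨x, hx, rfl⟩ := hy
        refine ⟨𝓗.coeffMap L c • x, Submodule.smul_mem _ _ hx, ?_⟩
        rw [← 𝓗.indAbs_coeff_smul, coeff_smul_def, ← 𝓗.pull_coeffMap f hO.proper hL]
        rfl
    obtain ⟨x', hx', h⟩ := key _ (hd _ h₁)
    exact (𝓗.indAbs_orbit_bijective H m).1 h ▸ hx'
  · obtain ⟨d, hd⟩ := hiso.2 k
    refine ⟨k + d, Nat.le_add_right k d, fun y => ?_⟩
    obtain ⟨x, hx⟩ := hd (𝓗.orbitSkelHom E H m (k + d) y)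
    obtain ⟨x, rfl⟩ := (𝓗.indAbs_orbit_bijective H m).2 x
    refine ⟨x, (𝓗.orbitSkelHom_bijective E H m k).1 ?_⟩
    exact (𝓗.orbitSkelHom_snd E H m k x).trans
      (hx.trans (𝓗.orbitSkelHom_res E H m (Nat.le_add_right k d) y).symm)

end MultiplicativeCohomologyTheory

/-! ### The completion theorem -/

theorem Ind.map_mk {G H : Type u} [Group G] [Group H] (α : H →* G) {X Y : GSpace H} (f : GMap X Y)
    (g : G) (x : X) : Ind.map α f (Ind.mk α g x) = Ind.mk α g (f x) :=
  congrArg (fun a => Ind.mk α a (f x)) (mul_one g)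

section Discs

variable {G : Type u} [Group G] (H : Subgroup G) (n : ℕ)

/-- The inclusion of the centre of a disc. -/
def discCentre : GMap (GSpace.pt : GSpace H) (discSpace H PUnit.{u + 1} n) where
  toFun _ := (⟨PUnit.unit, ⟨0, by simp⟩⟩ : Σ _ : PUnit.{u + 1}, Disc n)
  continuous_toFun := continuous_const
  map_smul' _ _ := rfl

theorem discCentre_homotopic :
    GHomotopic ⊥ ⊥ ((Ind.map H.subtype (discCentre H n)).comp
      (Ind.map H.subtype (GMap.toPt (discSpace H PUnit.{u + 1} n)))) (GMap.id _) := by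
  refine Ind.homotopic_desc H.subtype (fun (x : Σ _ : PUnit.{u + 1}, Disc n) t =>
    Ind.mk (X := discSpace H PUnit.{u + 1} n) H.subtype 1
      (⟨x.1, discScale t x.2⟩ : Σ _ : PUnit.{u + 1}, Disc n)) ?_ ?_ _ _ ?_ ?_
  · exact (continuous_indMk H.subtype (discSpace H PUnit.{u + 1} n) 1).comp
      (continuous_discSpace_scale PUnit.{u + 1} n)
  · intro k x t
    have := indMk_mul H.subtype (discSpace H PUnit.{u + 1} n) 1 k
      (⟨x.1, discScale t x.2⟩ : Σ _ : PUnit.{u + 1}, Disc n)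
    refine this.symm.trans ?_
    change Ind.mk (X := discSpace H PUnit.{u + 1} n) H.subtype (1 * k) _ =
      Ind.mk (X := discSpace H PUnit.{u + 1} n) H.subtype (k * 1) _
    rw [one_mul, mul_one]
  · intro x
    refine (congrArg (Ind.map H.subtype (discCentre H n)) (Ind.map_mk _ _ _ _)).trans
      ((Ind.map_mk _ _ _ _).trans ?_)
    refine congrArg (Ind.mk (X := discSpace H PUnit.{u + 1} n) H.subtype 1) ?_
    exact congrArg (Sigma.mk PUnit.unit) (discScale_zero _).symm
  · intro x
    refine congrArg (Ind.mk (X := discSpace H PUnit.{u + 1} n) H.subtype 1) ?_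
    exact congrArg (Sigma.mk PUnit.unit) (discScale_one _).symm

theorem isFinite_disc : ((discCW H PUnit.{u + 1} n).ind H.subtype).IsFinite := by
  refine Finite.of_injective (fun s : Σ k, ((discCW H PUnit.{u + 1} n).ind H.subtype).cell k =>
    (⟨s.1, s.2.2⟩ : Σ k, DiscCell n k)) ?_
  rintro ⟨k, ⟨⟩, e₂⟩ ⟨l, ⟨⟩, e₄⟩ h
  obtain ⟨rfl, h'⟩ := Sigma.mk.inj_iff.1 h
  obtain rfl := eq_of_heq h'
  rfl

theorem isProper_disc [Finite H] : ((discCW H PUnit.{u + 1} n).ind H.subtype).IsProper :=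
  fun _ _ => Set.Finite.image H.subtype (Set.toFinite _)

theorem isSubcomplex_disc : ((discCW H PUnit.{u + 1} n).ind H.subtype).IsSubcomplex
    (indSub H.subtype (discBoundary H PUnit.{u + 1} n)) := fun k e x hx hm x' =>
  (Ind.mk_mem_indSub _).2 (discBoundary_isSubcomplex H PUnit.{u + 1} n k e x hx
    ((Ind.mk_mem_indSub _).1 hm) x')

theorem restrict_disc_dim_lt (k : ℕ)
    (e : (((discCW H PUnit.{u + 1} n).ind H.subtype).restrict (isSubcomplex_disc H n)).cell k) :
    k < n := by
  obtain ⟨⟨j, c⟩, he⟩ := e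
  refine c.le.lt_of_ne ?_
  rintro rfl
  let z : Disc k := ⟨0, by simp⟩
  have h : ‖(c.char z).1‖ = 1 :=
    (Ind.mk_mem_indSub H.subtype (A := discBoundary H PUnit.{u + 1} k) (g := 1)
      (x := (⟨j, c.char z⟩ : Σ _ : PUnit.{u + 1}, Disc k))).1 (he z)
  cases c with
  | top => exact zero_ne_one (norm_zero.symm.trans h)

theorem finiteProperPair_disc [Finite H] :
    FiniteProperPair (Ind H.subtype (discSpace H PUnit.{u + 1} n))
      (indSub H.subtype (discBoundary H PUnit.{u + 1} n)) :=
  ⟨_, isFinite_disc H n, isProper_disc H n, isSubcomplex_disc H n⟩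

end Discs

/-! ### Induction over cells and passage to the skeleta of `EG × X` -/

namespace MultiplicativeCohomologyTheory

variable {R : Type w} [CommRing R] (𝓗 : MultiplicativeCohomologyTheory.{u, v, w} R)
variable {G : Type u} [Group G] (E : ClassifyingSpace G) {X L : GSpace G} (hL : ProperGCWPair L ⊥)

theorem isGoodPair_of_isEmpty [IsEmpty X] (hX : FiniteProperPair X ⊥) (f : GMap X L) :
    𝓗.IsGoodPair E hL f ⊥ := by
  refine ⟨hX, fun n => ?_⟩
  have h₁ : Subsingleton (𝓗.comparison E hL f hX n).source :=
    (𝓗.thy G).subsingleton_of_isEmpty n X ⊥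
  have h₂ : ∀ k, Subsingleton ((𝓗.comparison E hL f hX n).target k) := fun k =>
    have : IsEmpty ((E.skelSpace k).prod X) := ⟨fun z => isEmptyElim (z.2 : X)⟩
    (𝓗.thy G).subsingleton_of_isEmpty n _ _
  exact ⟨inferInstance, 𝓗.comparison_isContinuous hX f n,
    fun j => ⟨0, fun x _ => Subsingleton.elim 0 x ▸ zero_mem _⟩,
    fun k => ⟨k, le_rfl, fun y => ⟨0, Subsingleton.elim _ _⟩⟩⟩

/-- The induction over the cells of a finite proper complex. -/
theorem isGoodPair_of_orbits
    (horbit : ∀ (H : Subgroup G) [Finite H] (f : GMap (Ind H.subtype GSpace.pt) L),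
      𝓗.IsGoodPair E hL f ⊥) (n : ℕ) {X : GSpace G} (S : GCWStructure X) (hfinite : S.IsFinite)
    (hproper : S.IsProper) (hn : ∀ k, S.cell k → k < n) (f : GMap X L) :
    𝓗.IsGoodPair E hL f ⊥ := by
  induction n generalizing X with
  | zero =>
    have : IsEmpty X := S.isEmpty_of_cell fun k => ⟨fun e => absurd (hn k e) k.not_lt_zero⟩
    exact 𝓗.isGoodPair_of_isEmpty E hL ⟨S, hfinite, hproper, S.isSubcomplex_bot⟩ f
  | succ n ihn =>
    -- The inner induction removes top-dimensional cells one by one; the outer one is needed for the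
    -- boundary spheres, which may have many cells but have lower dimension.
    induction hc : Nat.card (Σ k, S.cell k) using Nat.strong_induction_on generalizing X with
    | _ c ihc =>
      by_cases he : Nonempty (S.cell n)
      · obtain ⟨e⟩ := he
        have hn' : ∀ k, S.cell k → k ≤ n := fun k e => Nat.lt_succ_iff.1 (hn k e)
        have hsub := S.isSubcomplex_deleteCell hn' e
        have hfin : Finite (S.stab e) := hproper n e
        have hD := finiteProperPair_disc (S.stab e) n
        have hA : 𝓗.IsGoodPair E hL (f.comp (GMap.incl (S.deleteCell e))) ⊥ :=
          ihc _ (hc ▸ S.card_restrict_deleteCell_lt hfinite e hsub) (S.restrict hsub)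
            (hfinite.restrict hsub) (hproper.restrict hsub) (fun k e => hn k e.1) _ rfl
        -- By excision the pair of `X` and the complement of the open cell reduces to `G/H × (Dⁿ,
        -- Sⁿ⁻¹)`, with `H` the stabilizer. The disc part is homotopy equivalent to `G/H`.
        refine IsGoodPair.space 𝓗 rfl (IsGoodPair.of_pushout 𝓗 S hfinite hproper hsub
          (S.liftsCells_cellAttachMap hn' e) (S.isGPushout_cellAttachMap hn' e) ?_) hA
        refine IsGoodPair.pair 𝓗 hD rfl (IsGoodPair.of_homotopyEquiv 𝓗 hD.bot
          (Ind.map _ (GMap.toPt _)) ?_ (discCentre_homotopic _ n) rfl (horbit _ _)) ?_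
        · have : (Ind.map (S.stab e).subtype (GMap.toPt (discSpace (S.stab e) PUnit.{u + 1} n))).comp
              (Ind.map (S.stab e).subtype (discCentre (S.stab e) n)) = GMap.id _ :=
            Ind.hom_ext _ fun x => (congrArg (Ind.map _ _) (Ind.map_mk _ _ _ _)).trans
              (Ind.map_mk _ _ _ _)
          rw [this]
          exact ⟨fun y _ => y, continuous_fst, fun _ => rfl, fun _ => rfl, fun _ _ _ => rfl,
            fun _ h _ => h⟩
        · exact ihn _ ((isFinite_disc _ n).restrict (isSubcomplex_disc _ n))
            ((isProper_disc _ n).restrict (isSubcomplex_disc _ n)) (restrict_disc_dim_lt _ n) _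
      · exact ihn S hfinite hproper (fun k e => (Nat.lt_succ_iff.1 (hn k e)).lt_of_ne (by
          rintro rfl
          exact he ⟨e⟩)) f

theorem mem_powSubmodule_of_mem_smul (f : GMap X L) (m : ℤ) (j : ℕ) {x : 𝓗.Abs m X}
    (hx : letI := 𝓗.relModule hL f ⊥ m
      x ∈ 𝓗.augmentationIdeal L ^ j • (⊤ : Submodule (𝓗.Abs 0 L) (𝓗.Abs m X))) :
    x ∈ 𝓗.powSubmodule f m j := by
  let _ := 𝓗.relModule hL f ⊥ m
  induction hx using Submodule.smul_induction_on' with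
  | smul a ha x _ => exact Submodule.subset_span ⟨a, ha, x, rfl⟩
  | add x _ y _ hx hy => exact add_mem hx hy

/-- The inclusion of the skeleton of `EG × X` into `EG_k × X`. -/
def skelToProd (S : GCWStructure X) (k : ℕ) :
    GMap (GSpace.sub (prodSkel E.cw S k)) ((E.skelSpace k).prod X) where
  toFun z := (⟨z.1.1, by
    obtain ⟨p, q, hpq, hp, -⟩ := z.2
    exact E.cw.skel_mono (by omega) hp⟩, z.1.2)
  continuous_toFun := by
    have h : Continuous fun z : GSpace.sub (prodSkel E.cw S k) => (z.1 : E.space × X) :=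
      continuous_subtype_val
    exact ((continuous_fst.comp h).subtype_mk _).prodMk (continuous_snd.comp h)
  map_smul' _ _ := rfl

/-- For `X` of bounded dimension the inclusion of `EG_j × X` into a skeleton of `EG × X`. -/
def prodToSkel {S : GCWStructure X} {N : ℕ} (hN : ∀ x, x ∈ S.skel N) {j k : ℕ} (h : j + N ≤ k) :
    GMap ((E.skelSpace j).prod X) (GSpace.sub (prodSkel E.cw S k)) where
  toFun z := ⟨(z.1.1, z.2), prodSkel_mono E S h ⟨j, N, rfl, z.1.2, hN z.2⟩⟩
  continuous_toFun := by
    have h : Continuous fun z : (E.skelSpace j) × X => ((z.1.1, z.2) : E.space × X) :=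
      (continuous_subtype_val.comp continuous_fst).prodMk continuous_snd
    exact h.subtype_mk _
  map_smul' _ _ := rfl

theorem bot_of_prodSub {Y Z : GSpace G} (γ : GMap (Y.prod X) Z) :
    ∀ z ∈ GSpace.prodSub (⊤ : SubMulAction G Y) (⊥ : SubMulAction G X),
      γ z ∈ (⊥ : SubMulAction G Z) :=
  fun _ hz => absurd hz.2 (by exact fun h => h)

/-- The comparison with the products `EG_k × X` determines the completion map. -/
theorem isProIso_of_isGoodPair {S : GCWStructure X} (hfinite : S.IsFinite) (hproper : S.IsProper)
    (f : GMap X L) (h : 𝓗.IsGoodPair E hL f ⊥) (m : ℤ) :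
    (𝓗.completionMap E hfinite hproper hL f m).IsProIso := by
  obtain ⟨hX, h⟩ := h
  obtain ⟨N, hN⟩ := hfinite.exists_dim_lt
  have hskel : ∀ x : X, x ∈ S.skel N := fun x => by
    obtain ⟨k, e, g, y, rfl⟩ := S.cover x
    exact ⟨k, (hN k e).le, e, g, y, rfl⟩
  have hF := fun k => (properGCWPair_prodSkel E hfinite hproper k).sub
  refine (𝓗.completionMap_isProIso_iff E hfinite hproper hL f m).2 ⟨fun k => ?_, fun k => ?_⟩
  · obtain ⟨j, hj⟩ := (h m).mono (k + 1)
    -- `EG_j × X` lies in the skeleton of dimension `j + N`, so a class vanishing on that skeleton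
    -- or a larger one vanishes on `EG_j × X`.
    refine ⟨j + N, fun x hx => 𝓗.mem_powSubmodule_of_mem_smul hL f m (k + 1) (hj x ?_)⟩
    have hjk : j + N ≤ k + (j + N) := Nat.le_add_left _ _
    have := congrArg ((𝓗.thy G).map m (prodToSkel E hskel hjk) (bot_of_prodSub _)) hx
    rw [map_zero] at this
    exact ((𝓗.thy G).map_map m (f := prodToSkel E hskel hjk) (g := skelProj E S _) rfl _ _
      (bot_of_prodSub _) (hF _) x).symm.trans this
  · obtain ⟨j, hkj, hj⟩ := (h m).epi k
    refine ⟨j + N, fun y => ?_⟩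
    have hjk : j + N ≤ k + (j + N) := Nat.le_add_left _ _
    obtain ⟨x, hx⟩ := hj ((𝓗.thy G).map m (prodToSkel E hskel hjk) (bot_of_prodSub _) y)
    refine ⟨x, ?_⟩
    have := congrArg ((𝓗.thy G).map m (A := ⊥) (skelToProd E S k) (GMap.bot_mem _ _)) hx
    refine Eq.trans ?_ (this.trans ?_)
    · exact ((𝓗.thy G).map_map m (f := skelToProd E S k) (g := GMap.snd _ X) rfl _
        (GMap.snd_mem _ _) _ (hX.skelProd E k) x).symm
    · refine (congrArg _ ((𝓗.thy G).map_map m rfl _ _ (bot_of_prodSub _) (hX.skelProd E j)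
        y)).trans ?_
      exact (𝓗.thy G).map_map m rfl _ _ _ (hX.skelProd E k) y

end MultiplicativeCohomologyTheory

theorem mem_fixedFamily_of_orbit {G : Type u} [Group G] {L : GSpace G} (H : Subgroup G)
    (f : GMap (Ind H.subtype (GSpace.pt : GSpace H)) L) : H ∈ fixedFamily L := by
  refine ⟨f (Ind.mk H.subtype 1 PUnit.unit), fun h hh => ?_⟩
  rw [← f.map_smul']
  refine congrArg f ?_
  change Ind.mk H.subtype (h * 1) _ = _
  rw [mul_one, ← one_mul h]
  exact orbit_mk_eq H 1 ⟨h, hh⟩ _ _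

theorem theorem4p1 {R : Type w} [CommRing R]
    (𝓗 : MultiplicativeCohomologyTheory.{u, v, w} R) {G : Type u} [Group G]
    (L : GSpace G) (hL : ProperGCWPair L ⊥)
    -- the ring `𝓗⁰(*)` is Noetherian
    (noetherian : IsNoetherianRing 𝓗.Coeff)
    -- `𝓗ᵐ_H(*)` is a finitely generated `𝓗⁰(*)`-module
    (finite : ∀ H ∈ fixedFamily L, ∀ m : ℤ,
      Module.Finite 𝓗.Coeff (𝓗.Abs m (GSpace.pt : GSpace H)))
    -- the condition on prime ideals; here `ind_H^G * = G/H`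
    (ideals : ∀ H ∈ fixedFamily L, ∀ P : Ideal (𝓗.Abs 0 (GSpace.pt : GSpace H)), P.IsPrime →
      ∀ f : GMap (Ind H.subtype GSpace.pt) L,
        (∀ a ∈ 𝓗.augmentationIdeal L, 𝓗.indAbs H.subtype 0 GSpace.pt (𝓗.pull 0 f a) ∈ P) →
          𝓗.augmentationIdeal (GSpace.pt : GSpace H) ≤ P)
    -- the completion theorem for `H` and `id : * → *`
    (finite_groups : ∀ H ∈ fixedFamily L, ∀ (m : ℤ) (E : ClassifyingSpace H)
      (l : StrictProHom (completionSource 𝓗 (GMap.id (GSpace.pt : GSpace H)) m)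
        (completionTarget 𝓗 E GCWStructure.point m)),
      IsCompletionMap 𝓗 E GCWStructure.point (GMap.id GSpace.pt) m l → l.IsProIso)
    (X : GSpace G) (S : GCWStructure X) (hproper : S.IsProper) (hfinite : S.IsFinite)
    (f : GMap X L) (E : ClassifyingSpace G) (m : ℤ) :
    ∃ l : StrictProHom (completionSource 𝓗 f m) (completionTarget 𝓗 E S m),
      IsCompletionMap 𝓗 E S f m l ∧ l.IsProIso := by
  have hgood : 𝓗.IsGoodPair E hL f ⊥ := by
    obtain ⟨N, hN⟩ := hfinite.exists_dim_lt
    refine 𝓗.isGoodPair_of_orbits E hL (fun H _ f => ?_) N S hfinite hproper hN f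
    have hH := mem_fixedFamily_of_orbit H f
    exact 𝓗.isGoodPair_orbit E H hL f noetherian (finite H hH)
      -- The completion hypothesis for `H` is applied to the model of `EH` obtained by restricting
      -- the action on `EG`.
      (fun P hP h => ideals H hH P hP f h) fun m l hl => finite_groups H hH m _ l hl
  exact ⟨𝓗.completionMap E hfinite hproper hL f m,
    𝓗.isCompletionMap_completionMap E hfinite hproper hL f m,
    𝓗.isProIso_of_isGoodPair E hL hfinite hproper f hgood m⟩
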